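/- A computable presentation of a field $K$ identifies $K$ with a computable subset of $\mathbb{N}$ on which addition and multiplication are computable functions. With respect to such a presentation, a valuation $v$ on $K$ is computable if the relation $v(a)\le v(b)$ is computable; $K$ has a splitting algorithm if the set of polynomials in $K[X]$ that are reducible over $K$ (given by their lists of coefficients) is computable; subsets of $K$, and embeddings between presented fields, are computable if they are so as subsets of, respectively functions on, $\mathbb{N}$. For a subfield $K$ of an algebraically closed valued field $(L,w)$, the Henselization of $K$ in $(L,w)$ is the smallest subfield of $L$ containing $K$ that is Henselian for the restriction of $w$. Let $0'$ denote the set of all $i\in\mathbb{N}$ such that the $i$-th program halts on input $i$. There is a field $K$, algebraic over $\mathbb{Q}$, with a computable presentation and a computable (surjective) valuation $v$, such that the following hold. 1. $K$ has a splitting algorithm. 2. There are a prime $r$, a computable enumeration $p_0,p_1,\dots$ without repetition of all primes different from $r$, pairwise distinct primes $q_i\equiv 1 \pmod r$ for $i\in 0'$, and elements $\beta_i\in K$ with $\beta_i^{p_i}=r q_i$ for $i\in 0'$, such that $K=\mathbb{Q}(\beta_i : i\in 0')$, and $v$ extends the $r$-adic valuation of $\mathbb{Q}$. 3. There is a computable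 embedding of $K$ into a computably presented algebraic closure of $\mathbb{Q}$; and for every computably presented algebraic closure $\overline{\mathbb{Q}}$ of $\mathbb{Q}$, every computable embedding $\iota\colon K\to\overline{\mathbb{Q}}$ and every valuation $w$ on $\overline{\mathbb{Q}}$ extending $v$ along $\iota$ (that is, $w\circ\iota$ is equivalent to $v$), the Henselization of $\iota(K)$ in $(\overline{\mathbb{Q}},w)$ is not a computable subset of $\overline{\mathbb{Q}}$. -/

import Mathlib

open Polynomial

/-- A computable presentation of a field: an identification, via `code`, of the field with a
computable subset of `ℕ` on which addition and multiplication are computable. -/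
structure ComputablePresentation (K : Type) [Field K] where
  code : K → ℕ
  code_injective : Function.Injective code
  computable_domain : ComputablePred fun n : ℕ => n ∈ Set.range code
  computable_add : ∃ f : ℕ → ℕ → ℕ, Computable₂ f ∧ ∀ a b, f (code a) (code b) = code (a + b)
  computable_mul : ∃ f : ℕ → ℕ → ℕ, Computable₂ f ∧ ∀ a b, f (code a) (code b) = code (a * b)

namespace ComputablePresentation

variable {K L : Type} [Field K] [Field L]

/-- A subset of a presented field is computable if its set of codes is. -/
def ComputableSubset (π : ComputablePresentation K) (S : Set K) : Prop :=
  ComputablePred fun n : ℕ => n ∈ π.code '' S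

/-- A map between presented fields is computable if it is so on codes. -/
def ComputableMap (π : ComputablePresentation K) (ρ : ComputablePresentation L)
    (g : K → L) : Prop :=
  ∃ f : ℕ → ℕ, Computable f ∧ ∀ a, f (π.code a) = ρ.code (g a)

/-- A valuation on a presented field is computable if the divisibility relation
`a ∣ b ↔ v a ≤ v b` (for additive `v`) is computable. Mathlib's valuations are written
multiplicatively, which reverses the order. -/
def ComputableValuation (π : ComputablePresentation K) {Γ : Type}
    [LinearOrderedCommGroupWithZero Γ] (v : Valuation K Γ) : Prop :=
  ComputablePred fun x : ℕ × ℕ => ∃ a b : K, π.code a = x.1 ∧ π.code b = x.2 ∧ v b ≤ v a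

/-- The polynomial `a₀ + a₁ X + ⋯ + aₙ Xⁿ` with coefficient list `[a₀, …, aₙ]`. -/
noncomputable def polyOfList (l : List K) : K[X] :=
  l.foldr (fun a f => C a + X * f) 0

/-- A polynomial over a field is reducible if it is a product of two nonconstant polynomials. -/
def ReduciblePoly (f : K[X]) : Prop :=
  ∃ g h : K[X], 0 < g.natDegree ∧ 0 < h.natDegree ∧ f = g * h

/-- The splitting set of the field (the set of reducible polynomials, polynomials being given by
the lists of codes of their coefficients) is computable. -/
def HasSplittingAlgorithm (π : ComputablePresentation K) : Prop :=
  ComputablePred fun l : List ℕ => ∃ m : List K, m.map π.code = l ∧ ReduciblePoly (polyOfList m)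

end ComputablePresentation

/-- A subfield `F` of a valued field `(L, w)` is Henselian for the restriction of `w`. -/
def IsHenselianSubfield {L : Type} [Field L] {Γ : Type} [LinearOrderedCommGroupWithZero Γ]
    (w : Valuation L Γ) (F : Subfield L) : Prop :=
  HenselianLocalRing (w.comap F.subtype).valuationSubring

/-- The Henselization of the subfield `K` inside the algebraically closed valued field `(L, w)`:
the smallest Henselian subfield of `(L, w)` that contains `K`, i.e. the intersection of all
Henselian subfields containing `K` (it is again Henselian, as the roots given by Hensel's lemma
are unique in `L`, and `L` itself is Henselian). -/
def henselization {L : Type} [Field L] {Γ : Type} [LinearOrderedCommGroupWithZero Γ]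
    (w : Valuation L Γ) (K : Subfield L) : Subfield L :=
  sInf {F : Subfield L | K ≤ F ∧ IsHenselianSubfield w F}

/-- The halting set `0'`: all `i` such that the `i`-th program halts on input `i`. -/
def haltingSet : Set ℕ :=
  {i | (Nat.Partrec.Code.eval (Denumerable.ofNat Nat.Partrec.Code i) i).Dom}

/-! The prime is `r = 2`, and `p` enumerates the odd primes. The field `K` is generated, inside a
numbered algebraic closure `Ω` of `ℚ`, by radicals `β s`: whenever stage `s` reveals that program
`i` halts on `i`, a root of `X ^ p i - 2 * q s` is thrown in, with an odd prime `q s` still free to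
be chosen.

The halting set is hidden in `K` and revealed by the Henselization. Over a Henselian field of
residue characteristic 2, Hensel's lemma at 1 gives the odd number `q s` a `p i`-th root, so
dividing `β s` by it yields a `p i`-th root of 2. Conversely, the Henselization lies in the closure
of `K` for `w` (`approxSubfield`, Henselian by Newton iteration), so it has no values other than
those of `K`. By `valuesDivide` these are rational multiples of the value of 2 whose denominators
divide products of `p j` with `j ∈ 0'`. Hence `i ∈ 0'` exactly when 2 has a `p i`-th root in the
Henselization (`mem_haltingSet_iff`), and deciding the Henselization would make the complement of
`0'` semidecidable. `field_map` transports this to every embedding of `K`.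

That `K` itself is decidable in `Ω` is due to the choice of `q s`. If a number field contains a
`p`-th root of `2 * q`, then the odd prime `q` ramifies in it, so large `q` are excluded
(`NumberField.exists_forall_pow_ne`). As `Ω` is the union of a computable chain of number fields
`ℚ⟮gen N⟯`, one can search for `q s` such that `β s` avoids a large member of the chain. Since `β s`
has prime degree over the preceding stage, no element of `ℚ⟮gen s⟯` enters `K` after stage `s`
(`Separated.mem_stage`). A splitting algorithm follows: factor over `Ω` and test whether products of
some of the linear factors are defined over `K`.

Every radical is totally ramified at 2. The terms of an expansion in powers of `β s` have distinct
values, so the valuation ring of `K` is the integral closure of the localization of `ℤ` at 2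
(`map_le_one_iff`). Integrality is semidecidable, and so is strict inequality of values
(`map_lt_one_iff`), so the valuation is computable.

All algorithms are unbounded searches. Semidecidable relations (`RE`) are closed under conjunction,
disjunction, existential and bounded universal quantifiers; `RE.exists_uniformization` and
`RE.exists_seq` extract computable choices from them, and decidability means that a relation and its
negation are both `RE`. The numbered closure `Ω` arises in this way too, from a tower of polynomials
with certificates of irreducibility. -/

/-! ### Numbered sets and computable maps -/

/-- A numbering of a set: a surjection from `ℕ`. -/
class Numbered (X : Type) where
  num : ℕ → X
  num_surjective : Function.Surjective num

open Numbered (num num_surjective)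

namespace Numbered

instance : Numbered ℕ := ⟨id, Function.surjective_id⟩

instance {X Y : Type} [Numbered X] [Numbered Y] : Numbered (X × Y) where
  num n := (num n.unpair.1, num n.unpair.2)
  num_surjective := by
    rintro ⟨x, y⟩
    obtain ⟨a, rfl⟩ := num_surjective x
    obtain ⟨b, rfl⟩ := num_surjective y
    exact ⟨Nat.pair a b, by simp⟩

instance {X : Type} [Numbered X] : Numbered (List X) where
  num n := (Denumerable.ofNat (List ℕ) n).map num
  num_surjective l := by
    obtain ⟨m, hm⟩ := (List.map_surjective_iff.2 (num_surjective (X := X))) l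
    exact ⟨Encodable.encode m, by simpa using hm⟩

/-- The numbering of a quotient of a numbered set. -/
abbrev ofSurjective {X Y : Type} [Numbered X] (f : X → Y) (hf : Function.Surjective f) :
    Numbered Y :=
  ⟨fun n => f (num n), hf.comp num_surjective⟩

theorem num_nat (n : ℕ) : (num n : ℕ) = n := rfl

theorem num_pair {X Y : Type} [Numbered X] [Numbered Y] (a b : ℕ) :
    (num (Nat.pair a b) : X × Y) = (num a, num b) := by
  change (num _, num _) = _
  simp

theorem num_prod {X Y : Type} [Numbered X] [Numbered Y] (n : ℕ) :
    (num n : X × Y) = (num n.unpair.1, num n.unpair.2) := rfl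

theorem num_list {X : Type} [Numbered X] (n : ℕ) :
    (num n : List X) = (Denumerable.ofNat (List ℕ) n).map num := rfl

theorem num_encode {X : Type} [Numbered X] (l : List ℕ) :
    (num (Encodable.encode l) : List X) = l.map num := by
  simp [num_list]

end Numbered

open Numbered

/-- A map between numbered sets is computable if it is tracked by a computable function. -/
@[fun_prop]
def Comp {X Y : Type} [Numbered X] [Numbered Y] (f : X → Y) : Prop :=
  ∃ F : ℕ → ℕ, Computable F ∧ ∀ n, num (F n) = f (num n)

/-- A predicate on a numbered set is semidecidable if its set of indices is. -/
def RE {X : Type} [Numbered X] (P : X → Prop) : Prop :=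
  ∃ B : ℕ → ℕ → Bool, Computable₂ B ∧ ∀ n, P (num n) ↔ ∃ k, B n k = true

/-- A fold becomes a primitive recursion on the number of entries already consumed from the reversed
list, a form covered by `Computable.nat_rec`. -/
theorem computable_list_foldr {α β σ : Type} [Primcodable α] [Primcodable β] [Primcodable σ]
    {f : α → List β} {g : α → σ} {h : α → β × σ → σ} (hf : Computable f) (hg : Computable g)
    (hh : Computable₂ h) :
    Computable fun a => (f a).foldr (fun b s => h a (b, s)) (g a) := by
  have key : ∀ (a : α) (l : List β) (k : ℕ),
      Nat.rec (g a) (fun k s => Option.casesOn (l[k]?) s fun b => h a (b, s)) k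
        = (l.take k).foldl (fun s b => h a (b, s)) (g a) := by
    intro a l k
    induction k with
    | zero => simp
    | succ k ih =>
      rw [List.take_add_one, List.foldl_append, ← ih]
      change (Option.casesOn l[k]? _ _ : σ) = _
      cases l[k]? <;> rfl
  have hr : Computable fun a => (f a).reverse := Computable.list_reverse.comp hf
  have step : Computable₂ fun (a : α) (p : ℕ × σ) =>
      (Option.casesOn ((f a).reverse[p.1]?) p.2 fun b => h a (b, p.2) : σ) := by
    refine Computable.option_casesOn (o := fun q : α × ℕ × σ => (f q.1).reverse[q.2.1]?)
      (f := fun q => q.2.2) (g := fun q b => h q.1 (b, q.2.2)) ?_ ?_ ?_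
    · exact Computable.list_getElem?.comp (hr.comp Computable.fst)
        (Computable.fst.comp Computable.snd)
    · exact Computable.snd.comp Computable.snd
    · exact hh.comp (Computable.fst.comp Computable.fst)
        (Computable.snd.pair (Computable.snd.comp (Computable.snd.comp Computable.fst)))
  refine (Computable.nat_rec (Computable.list_length.comp hr) hg step).of_eq fun a => ?_
  rw [key a (f a).reverse, List.take_length, List.foldl_reverse]

namespace Comp

variable {X Y Z W : Type} [Numbered X] [Numbered Y] [Numbered Z] [Numbered W]

@[fun_prop]
theorem id' : Comp fun x : X => x := ⟨id, Computable.id, fun _ => rfl⟩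

@[fun_prop]
theorem const (y : Y) : Comp fun _ : X => y := by
  obtain ⟨n, hn⟩ := num_surjective y
  exact ⟨fun _ => n, Computable.const n, fun _ => hn⟩

@[fun_prop]
theorem comp {g : Y → Z} {f : X → Y} (hg : Comp g) (hf : Comp f) : Comp fun x => g (f x) := by
  obtain ⟨G, hG, hG'⟩ := hg
  obtain ⟨F, hF, hF'⟩ := hf
  exact ⟨fun n => G (F n), hG.comp hF, fun n => by rw [hG', hF']⟩

@[fun_prop]
theorem prodMk {f : X → Y} {g : X → Z} (hf : Comp f) (hg : Comp g) :
    Comp fun x => (f x, g x) := by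
  obtain ⟨G, hG, hG'⟩ := hg
  obtain ⟨F, hF, hF'⟩ := hf
  exact ⟨fun n => Nat.pair (F n) (G n), Primrec₂.natPair.to_comp.comp hF hG,
    fun n => by rw [num_pair, hG', hF']⟩

@[fun_prop]
theorem fst : Comp (Prod.fst : X × Y → X) :=
  ⟨fun n => n.unpair.1, Computable.fst.comp Computable.unpair, fun _ => rfl⟩

@[fun_prop]
theorem snd : Comp (Prod.snd : X × Y → Y) :=
  ⟨fun n => n.unpair.2, Computable.snd.comp Computable.unpair, fun _ => rfl⟩

theorem of_computable {f : ℕ → ℕ} (hf : Computable f) : Comp f := ⟨f, hf, fun _ => rfl⟩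

theorem computable {f : ℕ → ℕ} : Comp f → Computable f
  | ⟨_, hF, h⟩ => hF.of_eq h

theorem of_computable₂ {F : ℕ → ℕ → ℕ} (hF : Computable₂ F) {f g : X → ℕ} (hf : Comp f)
    (hg : Comp g) : Comp fun x => F (f x) (g x) := by
  have : Comp fun p : ℕ × ℕ => F p.1 p.2 :=
    ⟨fun n => F n.unpair.1 n.unpair.2, hF.comp (Computable.fst.comp Computable.unpair)
      (Computable.snd.comp Computable.unpair), fun _ => rfl⟩
  exact this.comp (hf.prodMk hg)

@[fun_prop]
theorem nat_div {f g : X → ℕ} (hf : Comp f) (hg : Comp g) : Comp fun x => f x / g x :=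
  of_computable₂ Primrec.nat_div.to_comp hf hg

@[fun_prop]
theorem nat_mod {f g : X → ℕ} (hf : Comp f) (hg : Comp g) : Comp fun x => f x % g x :=
  of_computable₂ Primrec.nat_mod.to_comp hf hg

@[fun_prop]
theorem nat_unpair : Comp Nat.unpair := ⟨id, Computable.id, fun _ => rfl⟩

theorem nat_rec {f : X → ℕ} {g : X → Y} {h : X → ℕ → Y → Y} (hf : Comp f) (hg : Comp g)
    (hh : Comp fun p : X × ℕ × Y => h p.1 p.2.1 p.2.2) :
    Comp fun x => (Nat.rec (g x) (h x) (f x) : Y) := by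
  obtain ⟨F, hF, hF'⟩ := hf
  obtain ⟨G, hG, hG'⟩ := hg
  obtain ⟨H, hH, hH'⟩ := hh
  refine ⟨fun n => Nat.rec (G n) (fun k c => H (Nat.pair n (Nat.pair k c))) (F n),
    Computable.nat_rec (h := fun n (p : ℕ × ℕ) => H (Nat.pair n (Nat.pair p.1 p.2))) hF hG ?_,
    fun n => ?_⟩
  · exact hH.comp (Primrec₂.natPair.to_comp.comp Computable.fst
      (Primrec₂.natPair.to_comp.comp (Computable.fst.comp Computable.snd)
        (Computable.snd.comp Computable.snd)))
  · dsimp only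
    rw [← hF', num_nat]
    induction F n with
    | zero => exact hG' n
    | succ k ih => simp only [hH', num_pair, ih, num_nat]

theorem foldr {f : X → List Y} {g : X → Z} {h : X → Y → Z → Z} (hf : Comp f) (hg : Comp g)
    (hh : Comp fun p : X × Y × Z => h p.1 p.2.1 p.2.2) :
    Comp fun x => (f x).foldr (h x) (g x) := by
  obtain ⟨F, hF, hF'⟩ := hf
  obtain ⟨G, hG, hG'⟩ := hg
  obtain ⟨H, hH, hH'⟩ := hh
  refine ⟨fun n => (Denumerable.ofNat (List ℕ) (F n)).foldr
    (fun b s => H (Nat.pair n (Nat.pair b s))) (G n),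
    computable_list_foldr (h := fun n (p : ℕ × ℕ) => H (Nat.pair n (Nat.pair p.1 p.2)))
      ((Primrec.ofNat _).to_comp.comp hF) hG ?_, fun n => ?_⟩
  · exact hH.comp (Primrec₂.natPair.to_comp.comp Computable.fst
      (Primrec₂.natPair.to_comp.comp (Computable.fst.comp Computable.snd)
        (Computable.snd.comp Computable.snd)))
  · dsimp only
    rw [← hF', num_list]
    induction Denumerable.ofNat (List ℕ) (F n) with
    | nil => exact hG' n
    | cons a l ih => simp only [List.foldr_cons, List.map_cons, hH', num_pair, ih]

@[fun_prop]
theorem cons {f : X → Y} {g : X → List Y} (hf : Comp f) (hg : Comp g) :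
    Comp fun x => f x :: g x := by
  obtain ⟨F, hF, hF'⟩ := hf
  obtain ⟨G, hG, hG'⟩ := hg
  refine ⟨fun n => Encodable.encode (F n :: Denumerable.ofNat (List ℕ) (G n)),
    Computable.encode.comp (Computable.list_cons.comp hF ((Primrec.ofNat _).to_comp.comp hG)),
    fun n => ?_⟩
  dsimp only
  rw [num_encode, ← hG', ← hF', num_list]
  rfl

theorem map {f : X → List Y} {h : X → Y → Z} (hf : Comp f)
    (hh : Comp fun p : X × Y => h p.1 p.2) : Comp fun x => (f x).map (h x) := by
  have := foldr (Z := List Z) (g := fun _ => []) (h := fun x y z => h x y :: z) hf (const _)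
    (cons (hh.comp (by fun_prop : Comp fun p : X × Y × List Z => (p.1, p.2.1))) (by fun_prop))
  simpa only [List.map_eq_foldr] using this

@[fun_prop]
theorem append {f g : X → List Y} (hf : Comp f) (hg : Comp g) : Comp fun x => f x ++ g x := by
  have := foldr (g := g) (h := fun _ y z => y :: z) hf hg (by fun_prop)
  simpa using this

@[fun_prop]
theorem length : Comp (List.length : List X → ℕ) :=
  ⟨fun n => (Denumerable.ofNat (List ℕ) n).length,
    Computable.list_length.comp (Primrec.ofNat _).to_comp, fun n => by
      rw [num_nat, num_list, List.length_map]⟩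

@[fun_prop]
theorem range : Comp List.range :=
  ⟨fun n => Encodable.encode (List.range n), Computable.encode.comp Primrec.list_range.to_comp,
    fun n => by rw [num_encode, num_nat]; exact List.map_id _⟩

@[fun_prop]
theorem getD {f : X → List Y} {g : X → ℕ} {d : Y} (hf : Comp f) (hg : Comp g) :
    Comp fun x => (f x).getD (g x) d := by
  obtain ⟨F, hF, hF'⟩ := hf
  obtain ⟨G, hG, hG'⟩ := hg
  obtain ⟨c, rfl⟩ := num_surjective d
  refine ⟨fun n => (Denumerable.ofNat (List ℕ) (F n)).getD (G n) c,
    (Primrec.list_getD c).to_comp.comp ((Primrec.ofNat _).to_comp.comp hF) hG, fun n => ?_⟩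
  dsimp only
  rw [← hF', ← hG', num_list, num_nat, List.getD_map]

end Comp

/-! ### Closure properties of semidecidable predicates -/

namespace RE

variable {X Y Z : Type} [Numbered X] [Numbered Y] [Numbered Z]

theorem of_iff {P Q : X → Prop} (hP : RE P) (h : ∀ x, Q x ↔ P x) : RE Q := by
  rwa [show Q = P from funext fun x => propext (h x)]

theorem rePred {P : ℕ → Prop} : RE P → REPred P := by
  rintro ⟨B, hB, h⟩
  have : Partrec fun n => Nat.rfind fun k => (Part.some (B n k) : Part Bool) :=
    Partrec.rfind hB.partrec₂
  refine this.dom_re.of_eq fun n => ?_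
  refine Nat.rfind_dom.trans ((h n).trans ?_).symm
  exact ⟨fun ⟨k, hk⟩ => ⟨k, by rw [hk]; exact Part.mem_some _, fun _ => trivial⟩,
    fun ⟨k, hk, _⟩ => ⟨k, (Part.mem_some_iff.1 hk).symm⟩⟩

/-- The step bound of `evaln` serves as the witness: halting means halting within some number of
steps. -/
theorem of_rePred {P : ℕ → Prop} (hP : REPred P) : RE P := by
  obtain ⟨c, hc⟩ := Nat.Partrec.Code.exists_code.1
    (Partrec.nat_iff.1 (hP.map (Computable.const (0 : ℕ)).to₂))
  refine ⟨fun n k => (c.evaln k n).isSome, ?_, fun n => ?_⟩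
  · exact Primrec.option_isSome.to_comp.comp (Nat.Partrec.Code.primrec_evaln.to_comp.comp
      ((Computable.snd.pair (Computable.const c)).pair Computable.fst))
  · have h1 : P n ↔ (c.eval n).Dom := by
      rw [hc]
      simp [Part.dom_iff_mem]
    rw [num_nat, h1, Part.dom_iff_mem]
    simp only [Nat.Partrec.Code.evaln_complete, Option.isSome_iff_exists, Option.mem_def]
    exact exists_comm

theorem comp {P : Y → Prop} {f : X → Y} (hP : RE P) (hf : Comp f) : RE fun x => P (f x) := by
  obtain ⟨B, hB, h⟩ := hP
  obtain ⟨F, hF, hF'⟩ := hf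
  refine ⟨fun n k => B (F n) k, hB.comp (hF.comp Computable.fst) Computable.snd, fun n => ?_⟩
  dsimp only
  rw [← hF', h]

theorem or {P Q : X → Prop} (hP : RE P) (hQ : RE Q) : RE fun x => P x ∨ Q x := by
  obtain ⟨B, hB, h⟩ := hP
  obtain ⟨C, hC, h'⟩ := hQ
  refine ⟨fun n k => B n k || C n k, Primrec.or.to_comp.comp hB hC, fun n => ?_⟩
  simp [h, h', exists_or]

theorem and {P Q : X → Prop} (hP : RE P) (hQ : RE Q) : RE fun x => P x ∧ Q x := by
  obtain ⟨B, hB, h⟩ := hP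
  obtain ⟨C, hC, h'⟩ := hQ
  refine ⟨fun n k => B n k.unpair.1 && C n k.unpair.2, Primrec.and.to_comp.comp
    (hB.comp Computable.fst (Computable.fst.comp (Computable.unpair.comp Computable.snd)))
    (hC.comp Computable.fst (Computable.snd.comp (Computable.unpair.comp Computable.snd))),
    fun n => ?_⟩
  simp only [h, h', Bool.and_eq_true]
  constructor
  · rintro ⟨⟨a, ha⟩, b, hb⟩
    exact ⟨Nat.pair a b, by simpa using ⟨ha, hb⟩⟩
  · rintro ⟨k, ha, hb⟩
    exact ⟨⟨_, ha⟩, _, hb⟩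

theorem ex {P : X → Y → Prop} (hP : RE fun p : X × Y => P p.1 p.2) :
    RE fun x => ∃ y, P x y := by
  obtain ⟨B, hB, h⟩ := hP
  refine ⟨fun n k => B (Nat.pair n k.unpair.1) k.unpair.2, hB.comp
    (Primrec₂.natPair.to_comp.comp Computable.fst
      (Computable.fst.comp (Computable.unpair.comp Computable.snd)))
    (Computable.snd.comp (Computable.unpair.comp Computable.snd)), fun n => ?_⟩
  constructor
  · rintro ⟨y, hy⟩
    obtain ⟨m, rfl⟩ := num_surjective y
    obtain ⟨k, hk⟩ := (h (Nat.pair n m)).1 (by simpa [num_pair] using hy)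
    exact ⟨Nat.pair m k, by simpa using hk⟩
  · rintro ⟨k, hk⟩
    have := (h _).2 ⟨_, hk⟩
    exact ⟨num k.unpair.1, by simpa [num_pair] using this⟩

/-- The finitely many witnesses of a bounded conjunction fit into one number, read as a list. -/
theorem ball_lt {P : X → ℕ → Prop} {N : X → ℕ} (hN : Comp N)
    (hP : RE fun p : X × ℕ => P p.1 p.2) : RE fun x => ∀ i < N x, P x i := by
  obtain ⟨B, hB, h⟩ := hP
  obtain ⟨F, hF, hF'⟩ := hN
  let A : ℕ → ℕ → Bool := fun n k => Nat.rec true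
    (fun i acc => acc && B (Nat.pair n i) ((Denumerable.ofNat (List ℕ) k).getD i 0)) (F n)
  have hA : Computable₂ A := by
    refine Computable.nat_rec (f := fun p : ℕ × ℕ => F p.1) (g := fun _ => true)
      (h := fun (p : ℕ × ℕ) (q : ℕ × Bool) => q.2 && B (Nat.pair p.1 q.1)
        ((Denumerable.ofNat (List ℕ) p.2).getD q.1 0)) (hF.comp Computable.fst)
      (Computable.const _) ?_
    refine Primrec.and.to_comp.comp (Computable.snd.comp Computable.snd) (hB.comp
      (Primrec₂.natPair.to_comp.comp (Computable.fst.comp Computable.fst)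
        (Computable.fst.comp Computable.snd)) ((Primrec.list_getD 0).to_comp.comp
        ((Primrec.ofNat _).to_comp.comp (Computable.snd.comp Computable.fst))
        (Computable.fst.comp Computable.snd)))
  have key : ∀ (n k m : ℕ), (Nat.rec true
      (fun i acc => acc && B (Nat.pair n i) ((Denumerable.ofNat (List ℕ) k).getD i 0)) m : Bool)
        = true ↔ ∀ i < m, B (Nat.pair n i) ((Denumerable.ofNat (List ℕ) k).getD i 0) = true := by
    intro n k m
    induction m with
    | zero => simp
    | succ m ih => simp only [Bool.and_eq_true, ih, Nat.lt_succ_iff_lt_or_eq, or_imp, forall_and,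
        forall_eq]
  refine ⟨A, hA, fun n => ?_⟩
  simp only [A, key]
  rw [← hF', num_nat]
  constructor
  · intro H
    have : ∀ i, ∃ k, i < F n → B (Nat.pair n i) k = true := fun i => by
      by_cases hi : i < F n
      · obtain ⟨k, hk⟩ := (h (Nat.pair n i)).1 (by simpa [num_pair, num_nat] using H i hi)
        exact ⟨k, fun _ => hk⟩
      · exact ⟨0, fun h => absurd h hi⟩
    choose w hw using this
    refine ⟨Encodable.encode ((List.range (F n)).map w), fun i hi => ?_⟩
    rw [Denumerable.ofNat_encode, List.getD_eq_getElem _ _ (by simpa using hi)]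
    simpa using hw i hi
  · rintro ⟨k, hk⟩ i hi
    have := (h _).2 ⟨_, hk i hi⟩
    simpa [num_pair, num_nat] using this

theorem ball_mem {P : X → Y → Prop} {l : X → List Y} (hl : Comp l)
    (hP : RE fun p : X × Y => P p.1 p.2) : RE fun x => ∀ y ∈ l x, P x y := by
  have h : RE fun p : X × ℕ => P p.1 ((l p.1).getD p.2 (num 0)) :=
    hP.comp (f := fun p : X × ℕ => (p.1, (l p.1).getD p.2 (num 0))) (by fun_prop)
  refine (ball_lt (N := fun x => (l x).length)
    (P := fun x i => P x ((l x).getD i (num 0))) (by fun_prop) h).of_iff fun x => ?_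
  simp only [List.forall_mem_iff_getElem]
  refine forall₂_congr fun i hi => ?_
  rw [List.getD_eq_getElem _ _ hi]

theorem const {p : Prop} (h : p) : RE fun _ : X => p :=
  ⟨fun _ _ => true, Computable.const true, fun _ => by simp [h]⟩

theorem of_primrecRel {R : ℕ → ℕ → Prop} (hR : PrimrecRel R) {f g : X → ℕ} (hf : Comp f)
    (hg : Comp g) : RE fun x => R (f x) (g x) := by
  classical
  have : RE fun p : ℕ × ℕ => R p.1 p.2 :=
    ⟨fun n _ => decide (R n.unpair.1 n.unpair.2), ((hR.comp
      (Primrec.fst.comp (Primrec.unpair.comp Primrec.fst))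
      (Primrec.snd.comp (Primrec.unpair.comp Primrec.fst))).decide.to_comp : Computable
        fun p : ℕ × ℕ => decide (R p.1.unpair.1 p.1.unpair.2)), fun n => by simp [num_prod, num_nat]⟩
  exact this.comp (hf.prodMk hg)

theorem nat_lt {f g : X → ℕ} (hf : Comp f) (hg : Comp g) : RE fun x => f x < g x :=
  of_primrecRel Primrec.nat_lt hf hg

theorem nat_le {f g : X → ℕ} (hf : Comp f) (hg : Comp g) : RE fun x => f x ≤ g x :=
  of_primrecRel Primrec.nat_le hf hg

theorem nat_eq {f g : X → ℕ} (hf : Comp f) (hg : Comp g) : RE fun x => f x = g x :=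
  of_primrecRel Primrec.eq hf hg

theorem nat_ne {f g : X → ℕ} (hf : Comp f) (hg : Comp g) : RE fun x => f x ≠ g x :=
  of_primrecRel (Primrec.eq.not) hf hg

/-- Search through pairs of an index of `y` and a witness; the search stops because a `y` always
exists. The answer may depend on the index `n`, not only on `num n`. -/
theorem exists_uniformization {P : X → Y → Prop} (hP : RE fun p : X × Y => P p.1 p.2)
    (h : ∀ x, ∃ y, P x y) : ∃ F : ℕ → ℕ, Computable F ∧ ∀ n, P (num n) (num (F n)) := by
  obtain ⟨B, hB, hB'⟩ := hP
  have hex : ∀ n : ℕ, ∃ k : ℕ, B (Nat.pair n k.unpair.1) k.unpair.2 = true := fun n => by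
    obtain ⟨y, hy⟩ := h (num n)
    obtain ⟨m, rfl⟩ := num_surjective y
    obtain ⟨k, hk⟩ := (hB' (Nat.pair n m)).1 (by simpa [num_pair] using hy)
    exact ⟨Nat.pair m k, by simpa using hk⟩
  have hc : Computable fun p : ℕ × ℕ => B (Nat.pair p.1 p.2.unpair.1) p.2.unpair.2 := hB.comp
    (Primrec₂.natPair.to_comp.comp Computable.fst
      (Computable.fst.comp (Computable.unpair.comp Computable.snd)))
    (Computable.snd.comp (Computable.unpair.comp Computable.snd))
  have := Computable.find (P := fun n k : ℕ => B (Nat.pair n k.unpair.1) k.unpair.2 = true)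
    ⟨inferInstance, by simpa using hc⟩ hex
  refine ⟨fun n => (Nat.find (hex n)).unpair.1, Computable.fst.comp (Computable.unpair.comp this),
    fun n => ?_⟩
  have := (hB' _).2 ⟨_, Nat.find_spec (hex n)⟩
  simpa [num_pair] using this

end RE

/-- With a unique solution, uniformization is forced to return it. Operations that are awkward to
program are thus computed by recognizing their result. -/
theorem Comp.of_graph {X Y : Type} [Numbered X] [Numbered Y] {f : X → Y}
    (h : RE fun p : X × Y => p.2 = f p.1) : Comp f :=
  h.exists_uniformization (P := fun x y => y = f x) fun x => ⟨f x, rfl⟩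

/-- The list `[y (n - 1), …, y 0]`. -/
def prevList {Y : Type} (y : ℕ → Y) (n : ℕ) : List Y :=
  Nat.rec [] (fun k l => y k :: l) n

theorem prevList_succ {Y : Type} (y : ℕ → Y) (n : ℕ) :
    prevList y (n + 1) = y n :: prevList y n := rfl

theorem Comp.prevList {Y : Type} [Numbered Y] {y : ℕ → Y} (hy : Comp y) :
    Comp (prevList y) :=
  Comp.nat_rec (f := fun n : ℕ => n) (g := fun _ => []) (h := fun _ k l => y k :: l)
    (by fun_prop) (by fun_prop) (by fun_prop)

/-- Effective dependent choice for semidecidable relations. -/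
theorem RE.exists_seq {Y : Type} [Numbered Y] {R : List Y → Y → Prop}
    (hR : RE fun p : List Y × Y => R p.1 p.2) (V : List Y → Prop) (V0 : V [])
    (hex : ∀ l, V l → ∃ y, R l y) (hV : ∀ l y, V l → R l y → V (y :: l)) :
    ∃ y : ℕ → Y, Comp y ∧ ∀ n, V (prevList y n) ∧ R (prevList y n) (y n) := by
  obtain ⟨B, hB, hB'⟩ := hR
  -- `G c` searches for an index of a next term together with a witness. It is partial; the
  -- invariant `V` is what guarantees that it halts along the sequence.
  let G : ℕ → Part ℕ := fun c =>
    Nat.rfind fun k => (Part.some (B (Nat.pair c k.unpair.1) k.unpair.2) : Part Bool)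
  have hc : Computable fun p : ℕ × ℕ => B (Nat.pair p.1 p.2.unpair.1) p.2.unpair.2 := hB.comp
    (Primrec₂.natPair.to_comp.comp Computable.fst
      (Computable.fst.comp (Computable.unpair.comp Computable.snd)))
    (Computable.snd.comp (Computable.unpair.comp Computable.snd))
  have hG : Partrec G := Partrec.rfind (p := fun c k =>
    (Part.some (B (Nat.pair c k.unpair.1) k.unpair.2) : Part Bool)) hc.partrec
  let upd : ℕ → ℕ → ℕ := fun c k =>
    Encodable.encode (k.unpair.1 :: Denumerable.ofNat (List ℕ) c)
  have hupd : Computable₂ upd := Computable.encode.comp (Computable.list_cons.comp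
    (Computable.fst.comp (Computable.unpair.comp Computable.snd))
    ((Primrec.ofNat _).to_comp.comp Computable.fst))
  let S : ℕ → Part ℕ := fun n => Nat.rec (Part.some (Encodable.encode ([] : List ℕ)))
    (fun _ IH => IH.bind fun c => (G c).map (upd c)) n
  have hS : Partrec S := by
    refine Partrec.nat_rec (f := fun n : ℕ => n) (g := fun _ => Part.some _)
      (h := fun _ (q : ℕ × ℕ) => (G q.2).map (upd q.2)) Computable.id
      (Computable.const _).partrec ?_
    exact (hG.comp (Computable.snd.comp Computable.snd)).map
      (hupd.comp (Computable.snd.comp (Computable.snd.comp Computable.fst)) Computable.snd)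
  have hG' : ∀ c, V (num c) → ∃ k ∈ G c, R (num c) (num k.unpair.1) := fun c hc => by
    obtain ⟨y, hy⟩ := hex _ hc
    obtain ⟨m, rfl⟩ := num_surjective y
    obtain ⟨k, hk⟩ := (hB' (Nat.pair c m)).1 (by simpa [num_pair] using hy)
    have hdom : (G c).Dom := by
      refine Nat.rfind_dom.2 ?_
      exact ⟨Nat.pair m k, by simp [hk], fun _ => trivial⟩
    obtain ⟨j, hj⟩ := Part.dom_iff_mem.1 hdom
    refine ⟨j, hj, ?_⟩
    have := (hB' _).2 ⟨_, (Part.mem_some_iff.1 (Nat.rfind_spec hj)).symm⟩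
    simpa [num_pair] using this
  have hSV : ∀ n, ∃ c ∈ S n, V (num c) := fun n => by
    induction n with
    | zero => exact ⟨_, Part.mem_some _, by rw [num_encode]; exact V0⟩
    | succ n ih =>
      obtain ⟨c, hc, hVc⟩ := ih
      obtain ⟨k, hk, hRk⟩ := hG' c hVc
      refine ⟨upd c k, Part.mem_bind hc (Part.mem_map _ hk), ?_⟩
      rw [num_encode]
      exact hV _ _ hVc hRk
  choose s hs hsV using hSV
  have hsc : Computable s := hS.of_eq_tot hs
  have hstep : ∀ n, ∃ k, s (n + 1) = upd (s n) k ∧ R (num (s n)) (num k.unpair.1) := fun n => by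
    obtain ⟨k, hk, hRk⟩ := hG' (s n) (hsV n)
    exact ⟨k, Part.mem_unique (hs (n + 1)) (Part.mem_bind (hs n) (Part.mem_map _ hk)), hRk⟩
  -- The newest term is the head of the list at stage `n + 1`.
  let d : ℕ → ℕ := fun n => (Denumerable.ofNat (List ℕ) (s (n + 1))).getD 0 0
  have hd : Computable d := (Primrec.list_getD 0).to_comp.comp
    ((Primrec.ofNat _).to_comp.comp (hsc.comp Computable.succ)) (Computable.const 0)
  have hp : ∀ n, (num (s n) : List Y) = prevList (fun n => num (d n)) n := fun n => by
    induction n with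
    | zero =>
      rw [Part.mem_unique (hs 0) (Part.mem_some _), num_encode]
      rfl
    | succ n ih =>
      obtain ⟨k, hk, -⟩ := hstep n
      rw [prevList_succ, ← ih, hk, num_encode, List.map_cons, ← num_list]
      simp [d, hk, upd]
  refine ⟨fun n => num (d n), ⟨d, hd, fun _ => rfl⟩, fun n => ⟨hp n ▸ hsV n, ?_⟩⟩
  obtain ⟨k, hk, hRk⟩ := hstep n
  rw [← hp]
  simpa [d, hk, upd] using hRk

/-! ### Computable rings and fields -/

/-- A numbered commutative ring with computable operations and semidecidable equality. -/
class CRing (R : Type) [CommRing R] [Numbered R] : Prop where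
  comp_add : Comp fun p : R × R => p.1 + p.2
  comp_mul : Comp fun p : R × R => p.1 * p.2
  comp_neg : Comp fun x : R => -x
  re_eq : RE fun p : R × R => p.1 = p.2

/-- Addition is computable. -/
class CompAdd (R : Type) [Add R] [Numbered R] : Prop where
  comp_add : Comp fun p : R × R => p.1 + p.2

/-- Subtraction is computable. -/
class CompSub (R : Type) [Sub R] [Numbered R] : Prop where
  comp_sub : Comp fun p : R × R => p.1 - p.2

/-- Multiplication is computable. -/
class CompMul (R : Type) [Mul R] [Numbered R] : Prop where
  comp_mul : Comp fun p : R × R => p.1 * p.2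

instance : CompAdd ℕ := ⟨Comp.of_computable₂ Primrec.nat_add.to_comp Comp.fst Comp.snd⟩

instance : CompMul ℕ := ⟨Comp.of_computable₂ Primrec.nat_mul.to_comp Comp.fst Comp.snd⟩

section Operations

variable {X R : Type} [Numbered X] [Numbered R]

@[fun_prop]
theorem Comp.add [Add R] [CompAdd R] {f g : X → R} (hf : Comp f) (hg : Comp g) :
    Comp fun x => f x + g x :=
  CompAdd.comp_add.comp (hf.prodMk hg)

@[fun_prop]
theorem Comp.sub [Sub R] [CompSub R] {f g : X → R} (hf : Comp f) (hg : Comp g) :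
    Comp fun x => f x - g x :=
  CompSub.comp_sub.comp (hf.prodMk hg)

@[fun_prop]
theorem Comp.mul [Mul R] [CompMul R] {f g : X → R} (hf : Comp f) (hg : Comp g) :
    Comp fun x => f x * g x :=
  CompMul.comp_mul.comp (hf.prodMk hg)

@[fun_prop]
theorem Comp.pow [Monoid R] [CompMul R] {f : X → R} {n : X → ℕ} (hf : Comp f) (hn : Comp n) :
    Comp fun x => f x ^ n x := by
  have := Comp.nat_rec (f := n) (g := fun _ => (1 : R)) (h := fun x _ y => y * f x) hn
    (by fun_prop) (by fun_prop)
  convert this using 2 with x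
  induction n x with
  | zero => simp
  | succ k ih => rw [pow_succ, ih]

end Operations

section CRing

variable {X Y R : Type} [Numbered X] [Numbered Y] [CommRing R] [Numbered R] [CRing R]

instance : CompAdd R := ⟨CRing.comp_add⟩

instance : CompMul R := ⟨CRing.comp_mul⟩

@[fun_prop]
theorem Comp.neg {f : X → R} (hf : Comp f) : Comp fun x => -f x :=
  CRing.comp_neg.comp hf

instance : CompSub R := ⟨by simp only [sub_eq_add_neg]; fun_prop⟩

@[fun_prop]
theorem Comp.natCast {n : X → ℕ} (hn : Comp n) : Comp fun x => (n x : R) := by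
  have := Comp.nat_rec (f := n) (g := fun _ => (0 : R)) (h := fun _ _ y => y + 1) hn
    (by fun_prop) (by fun_prop)
  convert this using 2 with x
  induction n x with
  | zero => simp
  | succ k ih => rw [Nat.cast_succ, ih]

theorem Comp.list_prod {l : X → List R} (hl : Comp l) : Comp fun x => (l x).prod :=
  Comp.foldr (g := fun _ => (1 : R)) (h := fun _ y z => y * z) hl (by fun_prop) (by fun_prop)

theorem RE.eq {f g : X → R} (hf : Comp f) (hg : Comp g) : RE fun x => f x = g x :=
  CRing.re_eq.comp (f := fun x => (f x, g x)) (hf.prodMk hg)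

end CRing

section Field

variable {X K : Type} [Numbered X] [Field K] [Numbered K] [CRing K]

/-- In a field, being nonzero is witnessed by an inverse, so semidecidable equality is already
decidable. -/
theorem RE.ne {f g : X → K} (hf : Comp f) (hg : Comp g) : RE fun x => f x ≠ g x := by
  have : RE fun x => ∃ z : K, (f x - g x) * z = 1 := RE.ex (RE.eq (by fun_prop) (by fun_prop))
  refine this.of_iff fun x => ?_
  rw [← sub_ne_zero]
  exact ⟨fun h => ⟨_, mul_inv_cancel₀ h⟩, fun ⟨z, hz⟩ h => by simp [h] at hz⟩

theorem comp_inv : Comp fun x : K => x⁻¹ := by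
  refine Comp.of_graph (((RE.eq (f := fun p : K × K => p.1) (g := fun _ => 0) (by fun_prop)
    (by fun_prop)).and (RE.eq (f := fun p : K × K => p.2) (g := fun _ => 0) (by fun_prop)
    (by fun_prop))).or (RE.eq (f := fun p : K × K => p.1 * p.2) (g := fun _ => 1) (by fun_prop)
    (by fun_prop)) |>.of_iff fun p => ?_)
  rcases eq_or_ne p.1 0 with h | h
  · simp [h]
  · simp only [h, false_and, false_or, mul_comm p.1]
    exact (mul_eq_one_iff_eq_inv₀ h).symm

@[fun_prop]
theorem Comp.inv {f : X → K} (hf : Comp f) : Comp fun x => (f x)⁻¹ :=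
  comp_inv.comp hf

end Field

/-! ### The computable field of rational numbers -/

/-- The rational number `(a - b) / (c + 1)`. -/
def ratOf (t : ℕ × ℕ × ℕ) : ℚ := ((t.1 : ℚ) - t.2.1) / (t.2.2 + 1)

theorem ratOf_surjective : Function.Surjective ratOf := by
  intro x
  refine ⟨(x.num.toNat, (-x.num).toNat, x.den - 1), ?_⟩
  have h1 : ((x.num.toNat : ℚ) - (-x.num).toNat) = x.num := by
    exact_mod_cast Int.toNat_sub_toNat_neg x.num
  have h2 : ((x.den - 1 : ℕ) : ℚ) + 1 = x.den := by
    exact_mod_cast Nat.sub_add_cancel x.pos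
  rw [ratOf]
  dsimp only
  rw [h1, h2, Rat.num_div_den]

instance : Numbered ℚ := Numbered.ofSurjective ratOf ratOf_surjective

section Rat

variable {X : Type} [Numbered X]

theorem Comp.ratOf {f : X → ℕ × ℕ × ℕ} : Comp f → Comp fun x => ratOf (f x)
  | ⟨F, hF, h⟩ => ⟨F, hF, fun n => congrArg _root_.ratOf (h n)⟩

theorem ratOf_add (s t : ℕ × ℕ × ℕ) : ratOf s + ratOf t =
    ratOf (s.1 * (t.2.2 + 1) + t.1 * (s.2.2 + 1), s.2.1 * (t.2.2 + 1) + t.2.1 * (s.2.2 + 1),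
      s.2.2 * t.2.2 + s.2.2 + t.2.2) := by
  have h1 : (s.2.2 : ℚ) + 1 ≠ 0 := by positivity
  have h2 : (t.2.2 : ℚ) + 1 ≠ 0 := by positivity
  have h3 : ((s.2.2 * t.2.2 + s.2.2 + t.2.2 : ℕ) : ℚ) + 1 = (s.2.2 + 1) * (t.2.2 + 1) := by
    push_cast; ring
  simp only [ratOf]
  rw [h3]
  push_cast
  field_simp
  ring

theorem ratOf_mul (s t : ℕ × ℕ × ℕ) : ratOf s * ratOf t =
    ratOf (s.1 * t.1 + s.2.1 * t.2.1, s.1 * t.2.1 + s.2.1 * t.1,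
      s.2.2 * t.2.2 + s.2.2 + t.2.2) := by
  have h1 : (s.2.2 : ℚ) + 1 ≠ 0 := by positivity
  have h2 : (t.2.2 : ℚ) + 1 ≠ 0 := by positivity
  have h3 : ((s.2.2 * t.2.2 + s.2.2 + t.2.2 : ℕ) : ℚ) + 1 = (s.2.2 + 1) * (t.2.2 + 1) := by
    push_cast; ring
  simp only [ratOf]
  rw [h3]
  push_cast
  field_simp
  ring

theorem ratOf_neg (s : ℕ × ℕ × ℕ) : -ratOf s = ratOf (s.2.1, s.1, s.2.2) := by
  simp only [ratOf]
  ring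

/-- Cross-multiplication with the subtrahends moved to the other side leaves an equation of natural
numbers. -/
theorem ratOf_eq_iff (s t : ℕ × ℕ × ℕ) : ratOf s = ratOf t ↔
    s.1 * (t.2.2 + 1) + t.2.1 * (s.2.2 + 1) = t.1 * (s.2.2 + 1) + s.2.1 * (t.2.2 + 1) := by
  have h1 : (s.2.2 : ℚ) + 1 ≠ 0 := by positivity
  have h2 : (t.2.2 : ℚ) + 1 ≠ 0 := by positivity
  rw [ratOf, ratOf, div_eq_div_iff h1 h2, ← Nat.cast_inj (R := ℚ)]
  push_cast
  constructor <;> intro h <;> linarith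

instance : CRing ℚ where
  comp_add := by
    have : Comp fun p : (ℕ × ℕ × ℕ) × (ℕ × ℕ × ℕ) => ratOf p.1 + ratOf p.2 := by
      simp only [ratOf_add]
      exact Comp.ratOf (by fun_prop)
    exact this
  comp_mul := by
    have : Comp fun p : (ℕ × ℕ × ℕ) × (ℕ × ℕ × ℕ) => ratOf p.1 * ratOf p.2 := by
      simp only [ratOf_mul]
      exact Comp.ratOf (by fun_prop)
    exact this
  comp_neg := by
    have : Comp fun p : ℕ × ℕ × ℕ => -ratOf p := by
      simp only [ratOf_neg]
      exact Comp.ratOf (by fun_prop)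
    exact this
  re_eq := by
    have : RE fun p : (ℕ × ℕ × ℕ) × (ℕ × ℕ × ℕ) => ratOf p.1 = ratOf p.2 := by
      simp only [ratOf_eq_iff]
      exact RE.nat_eq (by fun_prop) (by fun_prop)
    exact this

theorem comp_algebraMap_rat {K : Type} [Field K] [CharZero K] [Numbered K] [CRing K] :
    Comp (algebraMap ℚ K) := by
  have : Comp fun t : ℕ × ℕ × ℕ => ((t.1 : K) - t.2.1) * ((t.2.2 + 1 : ℕ) : K)⁻¹ := by fun_prop
  obtain ⟨F, hF, h⟩ := this
  refine ⟨F, hF, fun n => (h n).trans ?_⟩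
  change _ = algebraMap ℚ K (ratOf (num n))
  simp [ratOf, div_eq_mul_inv]

@[fun_prop]
theorem Comp.algebraMap_rat {K : Type} [Field K] [CharZero K] [Numbered K] [CRing K] {f : X → ℚ}
    (hf : Comp f) : Comp fun x => algebraMap ℚ K (f x) :=
  comp_algebraMap_rat.comp hf

end Rat

/-! ### Computable polynomial rings -/

section Poly

open ComputablePresentation (polyOfList)

variable {X K : Type} [Numbered X] [Field K]

theorem polyOfList_nil : polyOfList ([] : List K) = 0 := rfl

theorem polyOfList_cons (a : K) (l : List K) :
    polyOfList (a :: l) = C a + Polynomial.X * polyOfList l := rfl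

theorem degree_polyOfList_lt (l : List K) : (polyOfList l).degree < l.length := by
  rw [degree_lt_iff_coeff_zero]
  induction l with
  | nil => simp [polyOfList_nil]
  | cons a l ih =>
    intro m hm
    obtain ⟨m, rfl⟩ : ∃ k, m = k + 1 := ⟨m - 1, by simp at hm; omega⟩
    simp only [List.length_cons, add_le_add_iff_right] at hm
    simp [polyOfList_cons, ih m hm]

theorem degree_polyOfList_lt_of_le {l : List K} {n : ℕ} (h : l.length ≤ n) :
    (polyOfList l).degree < n :=
  (degree_polyOfList_lt l).trans_le (by exact_mod_cast h)

theorem coeff_polyOfList (l : List K) (n : ℕ) : (polyOfList l).coeff n = l.getD n 0 := by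
  induction l generalizing n with
  | nil => simp [polyOfList_nil]
  | cons a l ih => cases n <;> simp [polyOfList_cons, ih]

theorem polyOfList_map_range (f : K[X]) {n : ℕ} (hf : f.degree < n) :
    polyOfList ((List.range n).map f.coeff) = f := by
  ext k
  rw [coeff_polyOfList]
  by_cases hk : k < n
  · rw [List.getD_eq_getElem _ _ (by simpa using hk)]
    simp
  · rw [List.getD_eq_default _ _ (by simpa using hk), coeff_eq_zero_of_degree_lt]
    exact hf.trans_le (by exact_mod_cast not_lt.1 hk)

theorem polyOfList_surjective : Function.Surjective (polyOfList : List K → K[X]) := fun f =>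
  ⟨_, polyOfList_map_range f (n := f.natDegree + 1) (by
    rcases eq_or_ne f 0 with rfl | h
    · exact WithBot.bot_lt_coe _
    · rw [degree_eq_natDegree h]
      exact_mod_cast Nat.lt_succ_self _)⟩

theorem eval₂_polyOfList {S : Type*} [CommRing S] (φ : K →+* S) (x : S) (l : List K) :
    (polyOfList l).eval₂ φ x = l.foldr (fun a s => φ a + x * s) 0 := by
  induction l with
  | nil => simp [polyOfList_nil]
  | cons a l ih => simp [polyOfList_cons, eval₂_add, ih]

theorem eq_of_forall_lt_eval_eq [CharZero K] {f g : K[X]} {n : ℕ} (hf : f.degree < n)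
    (hg : g.degree < n) (h : ∀ k < n, f.eval (k : K) = g.eval (k : K)) : f = g := by
  refine eq_of_degrees_lt_of_eval_finset_eq ((Finset.range n).map ⟨_, Nat.cast_injective (R := K)⟩)
    ?_ ?_ ?_
  · simpa using hf
  · simpa using hg
  · simpa using h

variable [Numbered K]

noncomputable instance : Numbered K[X] :=
  Numbered.ofSurjective polyOfList polyOfList_surjective

theorem comp_polyOfList : Comp (polyOfList : List K → K[X]) := ⟨id, Computable.id, fun _ => rfl⟩

@[fun_prop]
theorem Comp.polyOfList {f : X → List K} (hf : Comp f) : Comp fun x => polyOfList (f x) :=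
  comp_polyOfList.comp hf

@[fun_prop]
theorem Comp.polyC {f : X → K} (hf : Comp f) : Comp fun x => C (f x) := by
  have : Comp fun x => ComputablePresentation.polyOfList [f x] := by fun_prop
  simpa [polyOfList_cons, polyOfList_nil] using this

@[fun_prop]
theorem Comp.coeff {f : X → K[X]} {n : X → ℕ} (hf : Comp f) (hn : Comp n) :
    Comp fun x => (f x).coeff (n x) := by
  have : Comp fun p : List K × ℕ => (ComputablePresentation.polyOfList p.1).coeff p.2 := by
    simp only [coeff_polyOfList]
    fun_prop
  have h2 : Comp fun p : K[X] × ℕ => p.1.coeff p.2 := this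
  exact h2.comp (hf.prodMk hn)

variable [CRing K]

@[fun_prop]
theorem Comp.eval_polyOfList {f : X → List K} {g : X → K} (hf : Comp f) (hg : Comp g) :
    Comp fun x => (ComputablePresentation.polyOfList (f x)).eval (g x) := by
  simp only [eval, eval₂_polyOfList]
  exact Comp.foldr hf (by fun_prop) (by simp only [RingHom.id_apply]; fun_prop)

variable [CharZero K]

/-- In characteristic 0, polynomials of degree less than `n` are compared at the points `0, …, n -
1`. Evaluation is a fold, so no formula for the coefficients of a product is needed. -/
theorem re_poly_eq {f g : X → K[X]} {n : X → ℕ} (hn : Comp n) (hf : ∀ x, (f x).degree < n x)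
    (hg : ∀ x, (g x).degree < n x) (hf' : Comp fun p : X × ℕ => (f p.1).eval (p.2 : K))
    (hg' : Comp fun p : X × ℕ => (g p.1).eval (p.2 : K)) : RE fun x => f x = g x :=
  (RE.ball_lt (P := fun x k => (f x).eval (k : K) = (g x).eval (k : K)) hn
    (RE.eq hf' hg')).of_iff fun x =>
      ⟨fun h k _ => by rw [h], fun h => eq_of_forall_lt_eval_eq (hf x) (hg x) h⟩

instance : CRing K[X] where
  comp_add := by
    refine Comp.of_graph ?_
    have : RE fun p : (List K × List K) × List K =>
        polyOfList p.2 = polyOfList p.1.1 + polyOfList p.1.2 := by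
      refine re_poly_eq (n := fun p => p.1.1.length + p.1.2.length + p.2.length) (by fun_prop)
        (fun p => degree_polyOfList_lt_of_le (by omega)) (fun p => ?_) (by fun_prop)
        (by simp only [eval_add]; fun_prop)
      exact (degree_add_le _ _).trans_lt (max_lt (degree_polyOfList_lt_of_le (by omega))
        (degree_polyOfList_lt_of_le (by omega)))
    exact this
  comp_mul := by
    refine Comp.of_graph ?_
    have : RE fun p : (List K × List K) × List K =>
        polyOfList p.2 = polyOfList p.1.1 * polyOfList p.1.2 := by
      refine re_poly_eq (n := fun p => p.1.1.length + p.1.2.length + p.2.length) (by fun_prop)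
        (fun p => degree_polyOfList_lt_of_le (by omega)) (fun p => ?_) (by fun_prop)
        (by simp only [eval_mul]; fun_prop)
      rw [degree_lt_iff_coeff_zero]
      intro m hm
      rw [coeff_mul]
      refine Finset.sum_eq_zero fun x hx => ?_
      rw [Finset.HasAntidiagonal.mem_antidiagonal] at hx
      rw [coeff_polyOfList, coeff_polyOfList]
      by_cases h : x.1 < p.1.1.length
      · rw [List.getD_eq_default p.1.2 _ (by omega), mul_zero]
      · rw [List.getD_eq_default p.1.1 _ (by omega), zero_mul]
    exact this
  comp_neg := by
    refine Comp.of_graph ?_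
    have : RE fun p : List K × List K => polyOfList p.2 = - polyOfList p.1 := by
      refine re_poly_eq (n := fun p => p.1.length + p.2.length) (by fun_prop)
        (fun p => degree_polyOfList_lt_of_le (by omega)) (fun p => ?_) (by fun_prop)
        (by simp only [eval_neg]; fun_prop)
      rw [degree_neg]
      exact degree_polyOfList_lt_of_le (by omega)
    exact this
  re_eq := by
    have : RE fun p : List K × List K => polyOfList p.1 = polyOfList p.2 :=
      re_poly_eq (n := fun p => p.1.length + p.2.length) (by fun_prop)
        (fun p => degree_polyOfList_lt_of_le (by omega))
        (fun p => degree_polyOfList_lt_of_le (by omega)) (by fun_prop) (by fun_prop)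
    exact this

@[fun_prop]
theorem Comp.poly_comp {f g : X → K[X]} (hf : Comp f) (hg : Comp g) :
    Comp fun x => (f x).comp (g x) := by
  have : Comp fun p : List K × K[X] => (ComputablePresentation.polyOfList p.1).comp p.2 := by
    simp only [Polynomial.comp, eval₂_polyOfList]
    exact Comp.foldr (by fun_prop) (by fun_prop) (by fun_prop)
  have h2 : Comp fun p : K[X] × K[X] => p.1.comp p.2 := this
  exact h2.comp (hf.prodMk hg)

@[fun_prop]
theorem Comp.aeval_rat {f : X → ℚ[X]} {g : X → K} (hf : Comp f) (hg : Comp g) :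
    Comp fun x => aeval (g x) (f x) := by
  have : Comp fun p : List ℚ × K => aeval p.2 (ComputablePresentation.polyOfList p.1) := by
    simp only [aeval_def, eval₂_polyOfList]
    exact Comp.foldr (by fun_prop) (by fun_prop) (by fun_prop)
  have h2 : Comp fun p : ℚ[X] × K => aeval p.2 p.1 := this
  exact h2.comp (hf.prodMk hg)

end Poly

/-! ### Certificates of irreducibility over `ℚ` -/

section Irreducible

open ComputablePresentation (polyOfList)

/-- A bound for the absolute values of the integers `a - b`, `(a, b) ∈ l`. -/
def intListBound (l : List (ℕ × ℕ)) : ℕ := l.foldr (fun a s => a.1 + a.2 + s) 0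

/-- A bound for the coefficients of the monic integral divisors of the monic polynomial
with lower coefficients `l`. -/
def factorBound (l : List (ℕ × ℕ)) : ℕ :=
  2 ^ l.length * ((l.length + 1) * (intListBound l + 1))

/-- The monic integral polynomial with lower coefficients `a - b`, `(a, b) ∈ l`. -/
noncomputable def monicOfList (l : List (ℕ × ℕ)) : ℚ[X] :=
  polyOfList (l.map fun a => (a.1 : ℚ) - (a.2 : ℚ)) + X ^ l.length

/-- The polynomials of degree less than `d` with integral coefficients between `-b` and `b`,
for `n < (2 * b + 1) ^ d`. -/
noncomputable def boundedPoly (b d n : ℕ) : ℚ[X] :=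
  polyOfList ((List.range d).map fun j => ((n / (2 * b + 1) ^ j % (2 * b + 1) : ℕ) : ℚ) - (b : ℚ))

/-- A semidecidable sufficient condition for irreducibility. -/
def CertifiedIrreducible (m : ℚ[X]) : Prop :=
  ∃ l : List (ℕ × ℕ), 0 < l.length ∧ m = monicOfList l ∧
    ∀ n < (2 * factorBound l + 1) ^ l.length, boundedPoly (factorBound l) l.length n = 0 ∨
      ∃ u v : ℚ[X], u * boundedPoly (factorBound l) l.length n + v * m = 1

@[fun_prop]
theorem Comp.intListBound : Comp intListBound :=
  Comp.foldr (f := fun l : List (ℕ × ℕ) => l) (g := fun _ => 0)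
    (h := fun _ a s => a.1 + a.2 + s) (by fun_prop) (by fun_prop) (by fun_prop)

@[fun_prop]
theorem Comp.factorBound : Comp factorBound := by
  unfold _root_.factorBound
  fun_prop

theorem comp_monicOfList : Comp monicOfList := by
  unfold monicOfList
  refine Comp.add (Comp.polyOfList
    (Comp.map (h := fun _ (a : ℕ × ℕ) => (a.1 : ℚ) - (a.2 : ℚ)) ?_ ?_)) ?_ <;>
  fun_prop

theorem Comp.boundedPoly {Y : Type} [Numbered Y] {b d n : Y → ℕ} (hb : Comp b) (hd : Comp d)
    (hn : Comp n) : Comp fun y => boundedPoly (b y) (d y) (n y) := by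
  unfold _root_.boundedPoly
  exact Comp.polyOfList (Comp.map (h := fun y j =>
    ((n y / (2 * b y + 1) ^ j % (2 * b y + 1) : ℕ) : ℚ) - (b y : ℚ)) (by fun_prop) (by fun_prop))

theorem re_certifiedIrreducible : RE CertifiedIrreducible := by
  refine RE.ex (RE.and (RE.nat_lt (by fun_prop) (by fun_prop)) (RE.and
    (RE.eq (by fun_prop) (comp_monicOfList.comp (by fun_prop))) (RE.ball_lt (by fun_prop)
      (RE.or (RE.eq (Comp.boundedPoly (by fun_prop) (by fun_prop) (by fun_prop)) (by fun_prop))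
        (RE.ex (RE.ex (RE.eq (Comp.add (Comp.mul (by fun_prop)
          (Comp.boundedPoly (by fun_prop) (by fun_prop) (by fun_prop))) (by fun_prop))
            (by fun_prop))))))))

/-- Base `b` expansion: one bounded quantifier over `n` runs through all coefficient vectors. -/
theorem exists_lt_pow_digits (b : ℕ) (d : ℕ) : ∀ c : ℕ → ℕ, (∀ j, c j < b) →
    ∃ n < b ^ d, ∀ j < d, n / b ^ j % b = c j := by
  induction d with
  | zero => exact fun c _ => ⟨0, by simp, by simp⟩
  | succ d ih =>
    intro c hc
    obtain ⟨n, hn, h⟩ := ih (fun j => c (j + 1)) fun j => hc _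
    have hb : 0 < b := (Nat.zero_le _).trans_lt (hc 0)
    refine ⟨c 0 + b * n, ?_, fun j hj => ?_⟩
    · calc c 0 + b * n < b + b * n := by have := hc 0; omega
        _ = b * (n + 1) := by ring
        _ ≤ b * b ^ d := Nat.mul_le_mul_left _ hn
        _ = b ^ (d + 1) := by ring
    · cases j with
      | zero => simp [Nat.mod_eq_of_lt (hc 0)]
      | succ j =>
        rw [pow_succ', ← Nat.div_div_eq_div_mul, Nat.add_mul_div_left _ _ hb,
          Nat.div_eq_of_lt (hc 0), zero_add]
        exact h j (by omega)

theorem exists_boundedPoly_eq {f : ℤ[X]} {b d : ℕ} (hd : f.degree < d) (hb : ∀ j, |f.coeff j| ≤ b) :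
    ∃ n < (2 * b + 1) ^ d, boundedPoly b d n = f.map (Int.castRingHom ℚ) := by
  -- Shifting by `b` moves the coefficients from `[-b, b]` to the digits `0, …, 2 * b`.
  obtain ⟨n, hn, h⟩ := exists_lt_pow_digits (2 * b + 1) d (fun j => (f.coeff j + b).toNat)
    fun j => by have := abs_le.1 (hb j); omega
  refine ⟨n, hn, ?_⟩
  have hdeg : (f.map (Int.castRingHom ℚ)).degree < d := (degree_map_le).trans_lt hd
  rw [← polyOfList_map_range _ hdeg, boundedPoly]
  congr 1
  refine List.map_congr_left fun j hj => ?_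
  rw [h j (List.mem_range.1 hj), coeff_map]
  have h0 : 0 ≤ f.coeff j + b := by have := abs_le.1 (hb j); omega
  have : (((f.coeff j + b).toNat : ℤ) : ℚ) = ((f.coeff j + b : ℤ) : ℚ) := by
    rw [Int.toNat_of_nonneg h0]
  push_cast at this
  rw [this]
  simp

theorem coeff_monicOfList (l : List (ℕ × ℕ)) (n : ℕ) : (monicOfList l).coeff n =
    ((l.getD n (0, 0)).1 : ℚ) - ((l.getD n (0, 0)).2 : ℚ) + if n = l.length then 1 else 0 := by
  rw [monicOfList, coeff_add, coeff_polyOfList, coeff_X_pow]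
  congr 1
  have := List.getD_map (l := l) (n := n) (d := ((0, 0) : ℕ × ℕ))
    (fun a : ℕ × ℕ => (a.1 : ℚ) - (a.2 : ℚ))
  simpa using this

theorem monic_monicOfList (l : List (ℕ × ℕ)) : (monicOfList l).Monic := by
  rw [monicOfList, add_comm]
  exact monic_X_pow_add (by simpa using degree_polyOfList_lt (l.map fun a : ℕ × ℕ => (a.1 : ℚ) - a.2))

theorem natDegree_monicOfList (l : List (ℕ × ℕ)) : (monicOfList l).natDegree = l.length := by
  rw [monicOfList, add_comm]
  exact natDegree_eq_of_degree_eq_some (by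
    rw [degree_add_eq_left_of_degree_lt, degree_X_pow]
    rw [degree_X_pow]
    simpa using degree_polyOfList_lt (l.map fun a : ℕ × ℕ => (a.1 : ℚ) - a.2))

theorem getD_le_intListBound (l : List (ℕ × ℕ)) (n : ℕ) :
    (l.getD n (0, 0)).1 + (l.getD n (0, 0)).2 ≤ intListBound l := by
  induction l generalizing n with
  | nil => simp [intListBound]
  | cons a l ih =>
    have e : intListBound (a :: l) = a.1 + a.2 + intListBound l := rfl
    cases n with
    | zero => simp [e]
    | succ n => have := ih n; simp only [List.getD_cons_succ, e]; omega

theorem monicOfList_mem_lifts (l : List (ℕ × ℕ)) :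
    monicOfList l ∈ lifts (Int.castRingHom ℚ) := by
  rw [lifts_iff_coeff_lifts]
  intro n
  rw [coeff_monicOfList]
  refine ⟨((l.getD n (0, 0)).1 : ℤ) - ((l.getD n (0, 0)).2 : ℤ) + if n = l.length then 1 else 0, ?_⟩
  split_ifs <;> simp

theorem abs_coeff_monicOfList_le (l : List (ℕ × ℕ)) (n : ℕ) :
    |(monicOfList l).coeff n| ≤ intListBound l + 1 := by
  rw [coeff_monicOfList]
  have h : (((l.getD n (0, 0)).1 : ℚ) + ((l.getD n (0, 0)).2 : ℚ)) ≤ intListBound l := by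
    exact_mod_cast getD_le_intListBound l n
  have h1 : (0 : ℚ) ≤ (l.getD n (0, 0)).1 := Nat.cast_nonneg _
  have h2 : (0 : ℚ) ≤ (l.getD n (0, 0)).2 := Nat.cast_nonneg _
  rw [abs_le]
  split_ifs <;> constructor <;> linarith

/-- Mignotte's bound. A coefficient of `f` is at most a binomial coefficient times the Mahler
measure of `f * g`, because the monic cofactor has Mahler measure at least 1; the measure of the
product is bounded by the sum of its coefficients' absolute values. -/
theorem abs_coeff_le_factorBound {l : List (ℕ × ℕ)} {f g : ℤ[X]} (hg : g.Monic)
    (h : (f * g).map (Int.castRingHom ℚ) = monicOfList l) (hf : f.natDegree ≤ l.length) (n : ℕ) :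
    |f.coeff n| ≤ factorBound l := by
  have h1 := norm_coeff_le_choose_mul_mahlerMeasure_of_one_le_mahlerMeasure n
    (f.map (Int.castRingHom ℂ)) (g.map (Int.castRingHom ℂ))
    (one_le_mahlerMeasure_of_one_le_norm_leadingCoeff (by
      rw [(hg.map _).leadingCoeff]; simp))
  rw [← Polynomial.map_mul, coeff_map] at h1
  have e : (f * g).map (Int.castRingHom ℂ) = (monicOfList l).map (algebraMap ℚ ℂ) := by
    rw [← h, map_map]
    congr 1
  have h2 : ((f * g).map (Int.castRingHom ℂ)).mahlerMeasure
      ≤ (l.length + 1) * (intListBound l + 1) := by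
    refine (mahlerMeasure_le_sum_norm_coeff _).trans ?_
    rw [sum_over_range' _ (by simp) (l.length + 1) (by
      rw [e, natDegree_map, natDegree_monicOfList]; omega)]
    refine (Finset.sum_le_card_nsmul _ _ ((intListBound l : ℝ) + 1) fun i _ => ?_).trans ?_
    · rw [e, coeff_map]
      have := abs_coeff_monicOfList_le l i
      have h3 : ‖algebraMap ℚ ℂ ((monicOfList l).coeff i)‖ = ((|(monicOfList l).coeff i| : ℚ) : ℝ) := by
        simp
      rw [h3]
      exact_mod_cast this
    · simp [mul_add]
  have h3 : ‖(Int.castRingHom ℂ) (f.coeff n)‖ = ((|f.coeff n| : ℤ) : ℝ) := by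
    simp
  rw [h3] at h1
  have h4 : ((f.map (Int.castRingHom ℂ)).natDegree.choose n : ℝ) ≤ 2 ^ l.length := by
    have : (f.map (Int.castRingHom ℂ)).natDegree.choose n ≤ 2 ^ l.length :=
      (Nat.choose_le_two_pow _ _).trans
        (Nat.pow_le_pow_right (by norm_num) (natDegree_map_le.trans hf))
    exact_mod_cast this
  have h5 : ((|f.coeff n| : ℤ) : ℝ) ≤ 2 ^ l.length * ((l.length + 1) * (intListBound l + 1)) :=
    h1.trans (mul_le_mul h4 h2 (mahlerMeasure_nonneg _) (by positivity))
  rw [factorBound]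
  exact_mod_cast h5

/-- By Gauss's lemma it suffices to exclude proper monic factors over `ℤ`. Such a factor lies in the
enumerated box and is nonzero, so the certificate makes it coprime to `m`; as a divisor of `m` it is
then a unit. -/
theorem CertifiedIrreducible.irreducible {m : ℚ[X]} (h : CertifiedIrreducible m) :
    Irreducible m := by
  obtain ⟨l, hl, rfl, h⟩ := h
  obtain ⟨M, hM, hdeg, hmon⟩ := lifts_and_natDegree_eq_and_monic (monicOfList_mem_lifts l)
    (monic_monicOfList l)
  rw [natDegree_monicOfList] at hdeg
  rw [← hM]
  refine (hmon.irreducible_iff_irreducible_map_fraction_map (K := ℚ)).1 ?_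
  refine (Monic.irreducible_iff_natDegree hmon).2 ⟨by rintro rfl; simp at hdeg; omega, ?_⟩
  intro f g hf hg hfg
  by_contra! hcon
  have hfd : f.natDegree < l.length := by
    rw [← hdeg, ← hfg, hf.natDegree_mul hg]
    have := hcon.2
    omega
  obtain ⟨n, hn, hbox⟩ := exists_boundedPoly_eq (f := f) (b := factorBound l) (d := l.length)
    (degree_le_natDegree.trans_lt (by exact_mod_cast hfd))
    (abs_coeff_le_factorBound hg (by rw [hfg, hM]) hfd.le)
  have hunit : IsUnit (f.map (Int.castRingHom ℚ)) := by
    rcases h n hn with h0 | ⟨u, v, huv⟩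
    · rw [hbox] at h0
      exact absurd h0 (hf.map _).ne_zero
    · refine isUnit_of_dvd_one ?_
      rw [← huv, hbox, ← hM, ← hfg, Polynomial.map_mul]
      exact dvd_add (dvd_mul_left _ _) ((dvd_mul_right _ _).mul_left _)
  have := natDegree_eq_zero_of_isUnit hunit
  rw [hf.natDegree_map] at this
  exact hcon.1 this

theorem exists_monicOfList_eq {M : ℤ[X]} (hM : M.Monic) :
    ∃ l, l.length = M.natDegree ∧ M.map (Int.castRingHom ℚ) = monicOfList l := by
  let l := (List.range M.natDegree).map fun i => ((M.coeff i).toNat, (-M.coeff i).toNat)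
  have hl : l.length = M.natDegree := by simp [l]
  refine ⟨l, hl, ?_⟩
  ext n
  rw [coeff_monicOfList, coeff_map, hl]
  rcases lt_trichotomy n M.natDegree with h | h | h
  · rw [List.getD_eq_getElem _ _ (hl ▸ h)]
    simp only [l, List.getElem_map, List.getElem_range, h.ne, if_false, add_zero]
    have := Int.toNat_sub_toNat_neg (M.coeff n)
    rw [eq_intCast]
    exact_mod_cast congrArg (Int.cast : ℤ → ℚ) this.symm
  · rw [List.getD_eq_default _ _ (by omega), h, hM.coeff_natDegree]
    simp
  · rw [List.getD_eq_default _ _ (by omega), coeff_eq_zero_of_natDegree_lt h]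
    simp [h.ne']

/-- Nonzero members of the box have degree below that of the irreducible `M`, hence are coprime to
it. -/
theorem certifiedIrreducible_map {M : ℤ[X]} (hM : M.Monic)
    (hirr : Irreducible (M.map (Int.castRingHom ℚ))) :
    CertifiedIrreducible (M.map (Int.castRingHom ℚ)) := by
  have hd : 0 < M.natDegree := by
    rw [← hM.natDegree_map (Int.castRingHom ℚ)]
    exact hirr.natDegree_pos
  obtain ⟨l, hl, e⟩ := exists_monicOfList_eq hM
  refine ⟨l, hl ▸ hd, e, fun n _ => ?_⟩
  by_cases h0 : boundedPoly (factorBound l) l.length n = 0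
  · exact Or.inl h0
  · right
    have hdeg : (boundedPoly (factorBound l) l.length n).degree < (M.map (Int.castRingHom ℚ)).degree := by
      refine (degree_polyOfList_lt _).trans_le ?_
      rw [hM.degree_map, degree_eq_natDegree hM.ne_zero, List.length_map, List.length_range, hl]
    have hnd : ¬ M.map (Int.castRingHom ℚ) ∣ boundedPoly (factorBound l) l.length n := fun hdvd =>
      h0 (eq_zero_of_dvd_of_degree_lt hdvd hdeg)
    exact ((hirr.coprime_iff_not_dvd).2 hnd).symm

end Irreducible

/-! ### A computable algebraic closure of `ℚ` -/

section Numbering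

open IntermediateField

theorem IntermediateField.exists_adjoin_simple_eq {F E : Type*} [Field F] [CharZero F] [Field E]
    [Algebra F E] (S : IntermediateField F E) [FiniteDimensional F S] : ∃ α : E, F⟮α⟯ = S := by
  obtain ⟨⟨α, hα⟩, hprim⟩ := Field.exists_primitive_element F S
  refine ⟨α, ?_⟩
  have := congrArg (IntermediateField.map S.val) hprim
  rwa [adjoin_map, Set.image_singleton, ← AlgHom.fieldRange_eq_map, fieldRange_val] at this

/-- An algebraic extension with one root of each irreducible polynomial over the base is already
algebraically closed. This is why each polynomial needs to be treated only once in the tower, and no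
splitting is required. -/
theorem IntermediateField.eq_top_of_exists_root {F E : Type*} [Field F] [Field E] [Algebra F E]
    [Algebra.IsAlgebraic F E] (S : IntermediateField F E)
    (h : ∀ f : F[X], Irreducible f → ∃ x ∈ S, aeval x f = 0) : S = ⊤ := by
  have : IsAlgClosure F S := IsAlgClosure.of_exists_root fun f _ hf => by
    obtain ⟨y, hy, hfy⟩ := h f hf
    refine ⟨⟨y, hy⟩, ?_⟩
    apply (algebraMap S E).injective
    rw [map_zero, ← aeval_algebraMap_apply]
    exact hfy
  have := this.isAlgClosed
  refine eq_top_iff.2 fun x _ => ?_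
  obtain ⟨y, rfl⟩ := (IsAlgClosed.algebraMap_bijective_of_isIntegral (k := S) (K := E)).2 x
  exact y.2

variable {Ω : Type} [Field Ω] [CharZero Ω]

theorem mem_adjoin_iff_exists_aeval [Algebra.IsAlgebraic ℚ Ω] {x y : Ω} :
    x ∈ ℚ⟮y⟯ ↔ ∃ g : ℚ[X], aeval y g = x := by
  rw [← mem_toSubalgebra, adjoin_simple_toSubalgebra_of_isAlgebraic
    (Algebra.IsAlgebraic.isAlgebraic y), Algebra.adjoin_singleton_eq_range_aeval]
  rfl

theorem aeval_eq_zero_iff_dvd {m : ℚ[X]} {x : Ω} (hm : Irreducible m) (hx : aeval x m = 0)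
    (g : ℚ[X]) : aeval x g = 0 ↔ m ∣ g := by
  refine ⟨fun hg => ?_, fun ⟨c, hc⟩ => by rw [hc, map_mul, hx, zero_mul]⟩
  by_contra h
  obtain ⟨u, v, huv⟩ := (hm.coprime_iff_not_dvd).2 h
  have := congrArg (aeval x) huv
  simp [hx, hg] at this

/-- A primitive element of the field generated by `a` and `b` is scaled by an integer to become
integral: certificates exist only for monic polynomials with integer coefficients. -/
theorem exists_certifiedIrreducible_minpoly [Algebra.IsAlgebraic ℚ Ω] (a b : Ω) :
    ∃ α : Ω, CertifiedIrreducible (minpoly ℚ α) ∧ a ∈ ℚ⟮α⟯ ∧ b ∈ ℚ⟮α⟯ := by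
  have hfin : FiniteDimensional ℚ (adjoin ℚ {a, b}) :=
    finiteDimensional_adjoin fun x _ => Algebra.IsIntegral.isIntegral x
  obtain ⟨α, hprim'⟩ := (adjoin ℚ {a, b}).exists_adjoin_simple_eq
  have hα : IsAlgebraic ℤ α := (IsFractionRing.isAlgebraic_iff ℤ ℚ Ω).2
    (Algebra.IsAlgebraic.isAlgebraic α)
  obtain ⟨d, hd, hint⟩ := hα.exists_integral_multiple
  have hαd : IsIntegral ℤ ((d : Ω) * α) := by simpa using hint
  have hd' : (d : Ω) ≠ 0 := by exact_mod_cast hd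
  have hmem : α ∈ ℚ⟮(d : Ω) * α⟯ := by
    have h := mul_mem (inv_mem (intCast_mem ℚ⟮(d : Ω) * α⟯ d)) (mem_adjoin_simple_self ℚ ((d : Ω) * α))
    rwa [inv_mul_cancel_left₀ hd'] at h
  have hle : adjoin ℚ {a, b} ≤ ℚ⟮(d : Ω) * α⟯ := by
    rw [← hprim']
    exact adjoin_simple_le_iff.2 hmem
  refine ⟨d * α, ?_, hle (subset_adjoin _ _ (by simp)), hle (subset_adjoin _ _ (by simp))⟩
  have hmin := minpoly.isIntegrallyClosed_eq_field_fractions' ℚ hαd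
  rw [hmin]
  refine certifiedIrreducible_map (minpoly.monic hαd) ?_
  have := minpoly.irreducible (Algebra.IsIntegral.isIntegral (R := ℚ) ((d : Ω) * α))
  rwa [hmin] at this

/-- The relation between the data `l` of the lower stages of the tower and the data `y = (h, m)` of
the next one: the generator of the next stage is a root of `m`, the previous generator is
the value of `h` at it, and the next stage contains a root of the polynomial with index
`l.length`. -/
def TowerStep (l : List (ℚ[X] × ℚ[X])) (y : ℚ[X] × ℚ[X]) : Prop :=
  -- For the empty list the default `X` has root 0, so the first stage extends `ℚ` itself.
  CertifiedIrreducible y.2 ∧ (∃ c, (l.getD 0 (0, X)).2.comp y.1 = y.2 * c) ∧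
    ((∃ a : ℚ, (num l.length : ℚ[X]) = C a) ∨
      ∃ g c : ℚ[X], (num l.length : ℚ[X]).comp g = y.2 * c)

@[fun_prop]
theorem Comp.num {X Y : Type} [Numbered X] [Numbered Y] {f : Y → ℕ} (hf : Comp f) :
    Comp fun y => (num (f y) : X) := by
  have : Comp fun n : ℕ => (Numbered.num n : X) := ⟨id, Computable.id, fun _ => rfl⟩
  exact this.comp hf

theorem re_towerStep : RE fun p : List (ℚ[X] × ℚ[X]) × (ℚ[X] × ℚ[X]) => TowerStep p.1 p.2 := by
  unfold TowerStep
  exact RE.and (re_certifiedIrreducible.comp (by fun_prop)) (RE.and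
    (RE.ex (RE.eq (by fun_prop) (by fun_prop))) (RE.or (RE.ex (RE.eq (by fun_prop) (by fun_prop)))
      (RE.ex (RE.ex (RE.eq (by fun_prop) (by fun_prop))))))

variable (Ω) in
-- Solutions are read off from a bare algebraic closure. The relation `TowerStep` mentions rational
-- polynomials only, so it can be searched before `Ω` has any numbering.
theorem exists_towerStep [IsAlgClosed Ω] [Algebra.IsAlgebraic ℚ Ω] (l : List (ℚ[X] × ℚ[X]))
    (hl : Irreducible (l.getD 0 (0, X)).2) : ∃ y, TowerStep l y := by
  obtain ⟨θ, hθ⟩ := IsAlgClosed.exists_aeval_eq_zero Ω (l.getD 0 (0, X)).2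
    (degree_pos_of_irreducible hl).ne'
  by_cases hf : (num l.length : ℚ[X]).degree ≤ 0
  · obtain ⟨α, hα, ha, -⟩ := exists_certifiedIrreducible_minpoly θ 0
    obtain ⟨h, hh⟩ := mem_adjoin_iff_exists_aeval.1 ha
    refine ⟨(h, minpoly ℚ α), hα, ?_, Or.inl ⟨_, eq_C_of_degree_le_zero hf⟩⟩
    exact minpoly.dvd _ _ (by rw [aeval_comp, hh, hθ])
  · obtain ⟨ξ, hξ⟩ := IsAlgClosed.exists_aeval_eq_zero Ω (num l.length : ℚ[X])
      (not_le.1 hf).ne'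
    obtain ⟨α, hα, ha, hb⟩ := exists_certifiedIrreducible_minpoly θ ξ
    obtain ⟨h, hh⟩ := mem_adjoin_iff_exists_aeval.1 ha
    obtain ⟨g, hg⟩ := mem_adjoin_iff_exists_aeval.1 hb
    exact ⟨(h, minpoly ℚ α), hα, minpoly.dvd _ _ (by rw [aeval_comp, hh, hθ]),
      Or.inr ⟨g, minpoly.dvd _ _ (by rw [aeval_comp, hg, hξ])⟩⟩

/-- A numbered algebraic field exhausted by a computable chain of number fields with computable
generators and minimal polynomials. -/
class ComputableTower (Ω : Type) [Field Ω] [CharZero Ω] [Numbered Ω] extends CRing Ω where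
  gen : ℕ → Ω
  poly : ℕ → ℚ[X]
  comp_gen : Comp gen
  comp_poly : Comp poly
  irreducible_poly : ∀ n, Irreducible (poly n)
  aeval_poly : ∀ n, aeval (gen n) (poly n) = 0
  monotone_adjoin : Monotone fun n => ℚ⟮gen n⟯
  exists_mem : ∀ x : Ω, ∃ n, x ∈ ℚ⟮gen n⟯

/-- Divisibility sends any root of `m (n + 1)` under `h (n + 1)` to some root of `m n`; since `m n`
is irreducible, an automorphism of `Ω` moves that root to the one already chosen. -/
theorem exists_compatible_roots [IsAlgClosed Ω] [Algebra.IsAlgebraic ℚ Ω] {h m : ℕ → ℚ[X]}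
    (hm : ∀ n, Irreducible (m n)) (hh : ∀ n, m (n + 1) ∣ (m n).comp (h (n + 1))) :
    ∃ θ : ℕ → Ω, (∀ n, aeval (θ n) (m n) = 0) ∧ ∀ n, aeval (θ (n + 1)) (h (n + 1)) = θ n := by
  have root : ∀ n, ∃ x : Ω, aeval x (m n) = 0 := fun n =>
    IsAlgClosed.exists_aeval_eq_zero Ω _ (degree_pos_of_irreducible (hm n)).ne'
  have hnormal : Normal ℚ Ω := normal_iff.2 fun x =>
    ⟨Algebra.IsIntegral.isIntegral x, IsAlgClosed.splits _⟩
  have step : ∀ n (x : {x : Ω // aeval x (m n) = 0}),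
      ∃ y : {y : Ω // aeval y (m (n + 1)) = 0}, aeval y.1 (h (n + 1)) = x.1 := by
    rintro n ⟨x, hx⟩
    obtain ⟨y, hy⟩ := root (n + 1)
    obtain ⟨c, hc⟩ := hh n
    have hy' : aeval (aeval y (h (n + 1))) (m n) = 0 := by
      rw [← aeval_comp, hc, map_mul, hy, zero_mul]
    have : aeval x (minpoly ℚ (aeval y (h (n + 1)))) = 0 := by
      rw [aeval_eq_zero_iff_dvd (hm n) hx, ← aeval_eq_zero_iff_dvd (hm n) hy']
      exact minpoly.aeval _ _
    obtain ⟨σ, hσ⟩ := minpoly.exists_algEquiv_of_root'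
      (Algebra.IsAlgebraic.isAlgebraic (aeval y (h (n + 1)))) this
    have hσ' : ∀ f : ℚ[X], aeval (σ y) f = σ (aeval y f) := aeval_algHom_apply σ.toAlgHom y
    exact ⟨⟨σ y, by rw [hσ', hy, map_zero]⟩, by rw [hσ', hσ]⟩
  choose nxt hnxt using step
  let θ : ∀ n, {x : Ω // aeval x (m n) = 0} := fun n =>
    Nat.rec ⟨_, (root 0).choose_spec⟩ (fun n x => nxt n x) n
  exact ⟨fun n => (θ n).1, fun n => (θ n).2, fun n => hnxt n (θ n)⟩

/-- The polynomial expressing in terms of the generator of stage `n + k` the value of `g` at the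
generator of stage `n`. -/
noncomputable def liftPoly (h : ℕ → ℚ[X]) (n : ℕ) (g : ℚ[X]) (k : ℕ) : ℚ[X] :=
  Nat.rec g (fun k t => t.comp (h (n + k + 1))) k

theorem Comp.liftPoly {Y : Type} [Numbered Y] {h : ℕ → ℚ[X]} (hh : Comp h) {n k : Y → ℕ}
    {g : Y → ℚ[X]} (hn : Comp n) (hg : Comp g) (hk : Comp k) :
    Comp fun y => liftPoly h (n y) (g y) (k y) := by
  unfold _root_.liftPoly
  exact Comp.nat_rec (h := fun y k t => t.comp (h (n y + k + 1))) hk hg (by fun_prop)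

theorem aeval_liftPoly {h : ℕ → ℚ[X]} {θ : ℕ → Ω}
    (hθ : ∀ n, aeval (θ (n + 1)) (h (n + 1)) = θ n) (n : ℕ) (g : ℚ[X]) (k : ℕ) :
    aeval (θ (n + k)) (liftPoly h n g k) = aeval (θ n) g := by
  induction k with
  | zero => rfl
  | succ k ih =>
    change aeval (θ (n + k + 1)) ((liftPoly h n g k).comp (h (n + k + 1))) = _
    rw [aeval_comp, hθ, ih]

theorem exists_mem_of_exists_root [IsAlgClosed Ω] [Algebra.IsAlgebraic ℚ Ω] {θ : ℕ → Ω}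
    (hmono : Monotone fun n => ℚ⟮θ n⟯)
    (hroot : ∀ f : ℚ[X], Irreducible f → ∃ n, ∃ x ∈ ℚ⟮θ n⟯, aeval x f = 0) (x : Ω) :
    ∃ n, x ∈ ℚ⟮θ n⟯ := by
  have hmem : ∀ y, y ∈ (⨆ n, ℚ⟮θ n⟯) ↔ ∃ n, y ∈ ℚ⟮θ n⟯ := fun y => by
    rw [← SetLike.mem_coe, coe_iSup_of_directed hmono.directed_le]
    simp
  rw [← hmem]
  have htop : (⨆ n, ℚ⟮θ n⟯) = ⊤ := eq_top_of_exists_root _ fun f hf => by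
    obtain ⟨n, y, hy, hfy⟩ := hroot f hf
    exact ⟨y, (hmem y).2 ⟨n, hy⟩, hfy⟩
  rw [htop]
  exact mem_top

variable (Ω) in
theorem exists_computableTower [IsAlgClosed Ω] [Algebra.IsAlgebraic ℚ Ω] :
    ∃ _ : Numbered Ω, Nonempty (ComputableTower Ω) := by
  obtain ⟨y, hy, hR⟩ := re_towerStep.exists_seq
    (fun l => Irreducible (l.getD 0 (0, X)).2) irreducible_X (fun l hl => exists_towerStep Ω l hl)
    (fun l y _ h => h.1.irreducible)
  let h : ℕ → ℚ[X] := fun n => (y n).1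
  let m : ℕ → ℚ[X] := fun n => (y n).2
  have hh : Comp h := by fun_prop
  have hm : Comp m := by fun_prop
  have hirr : ∀ n, Irreducible (m n) := fun n => (hR n).2.1.irreducible
  obtain ⟨θ, hθ, hθh⟩ := exists_compatible_roots (Ω := Ω) (h := h) hirr fun n => (hR (n + 1)).2.2.1
  have hlen : ∀ n, (prevList y n).length = n := fun n => by
    induction n with
    | zero => rfl
    | succ n ih => rw [prevList_succ, List.length_cons, ih]
  have hmono : Monotone fun n => ℚ⟮θ n⟯ := monotone_nat_of_le_succ fun n =>
    adjoin_simple_le_iff.2 (mem_adjoin_iff_exists_aeval.2 ⟨_, hθh n⟩)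
  have hex : ∀ x, ∃ n, x ∈ ℚ⟮θ n⟯ := exists_mem_of_exists_root hmono fun f hf => by
    obtain ⟨n, rfl⟩ := num_surjective f
    refine ⟨n, ?_⟩
    rcases (hR n).2.2.2 with ⟨a, ha⟩ | ⟨g, c, hg⟩
    · rw [hlen] at ha
      rw [ha] at hf
      exact absurd hf.natDegree_pos (by simp)
    · rw [hlen] at hg
      refine ⟨aeval (θ n) g, mem_adjoin_iff_exists_aeval.2 ⟨g, rfl⟩, ?_⟩
      rw [← aeval_comp, hg, map_mul, hθ, zero_mul]
  -- Elements are named by a stage and a polynomial in its generator. Two names are brought to the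
  -- common stage `n + k` by `liftPoly` before any operation.
  let val : ℕ × ℚ[X] → Ω := fun p => aeval (θ p.1) p.2
  have hval : Function.Surjective val := fun x => by
    obtain ⟨n, hn⟩ := hex x
    obtain ⟨g, hg⟩ := mem_adjoin_iff_exists_aeval.1 hn
    exact ⟨(n, g), hg⟩
  let _ : Numbered Ω := Numbered.ofSurjective val hval
  have comp_val : Comp val := ⟨id, Computable.id, fun _ => rfl⟩
  have lift₁ : ∀ p : (ℕ × ℚ[X]) × ℕ × ℚ[X],
      aeval (θ (p.1.1 + p.2.1)) (liftPoly h p.1.1 p.1.2 p.2.1) = val p.1 := fun p =>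
    aeval_liftPoly hθh _ _ _
  have lift₂ : ∀ p : (ℕ × ℚ[X]) × ℕ × ℚ[X],
      aeval (θ (p.1.1 + p.2.1)) (liftPoly h p.2.1 p.2.2 p.1.1) = val p.2 := fun p => by
    rw [add_comm]
    exact aeval_liftPoly hθh _ _ _
  have compL₁ : Comp fun p : (ℕ × ℚ[X]) × ℕ × ℚ[X] => liftPoly h p.1.1 p.1.2 p.2.1 :=
    Comp.liftPoly hh (by fun_prop) (by fun_prop) (by fun_prop)
  have compL₂ : Comp fun p : (ℕ × ℚ[X]) × ℕ × ℚ[X] => liftPoly h p.2.1 p.2.2 p.1.1 :=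
    Comp.liftPoly hh (by fun_prop) (by fun_prop) (by fun_prop)
  have hC : CRing Ω :=
    { comp_add := by
        have : Comp fun p : (ℕ × ℚ[X]) × ℕ × ℚ[X] => val p.1 + val p.2 := by
          have e : (fun p : (ℕ × ℚ[X]) × ℕ × ℚ[X] => val p.1 + val p.2) = fun p =>
              val (p.1.1 + p.2.1, liftPoly h p.1.1 p.1.2 p.2.1 + liftPoly h p.2.1 p.2.2 p.1.1) := by
            funext p
            rw [← lift₁, ← lift₂, ← map_add]
          rw [e]
          fun_prop
        exact this
      comp_mul := by
        have : Comp fun p : (ℕ × ℚ[X]) × ℕ × ℚ[X] => val p.1 * val p.2 := by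
          have e : (fun p : (ℕ × ℚ[X]) × ℕ × ℚ[X] => val p.1 * val p.2) = fun p =>
              val (p.1.1 + p.2.1, liftPoly h p.1.1 p.1.2 p.2.1 * liftPoly h p.2.1 p.2.2 p.1.1) := by
            funext p
            rw [← lift₁, ← lift₂, ← map_mul]
          rw [e]
          fun_prop
        exact this
      comp_neg := by
        have : Comp fun p : ℕ × ℚ[X] => - val p := by
          have e : (fun p : ℕ × ℚ[X] => - val p) = fun p => val (p.1, -p.2) := by
            funext p
            simp [val]
          rw [e]
          fun_prop
        exact this
      re_eq := by
        have : RE fun p : (ℕ × ℚ[X]) × ℕ × ℚ[X] => val p.1 = val p.2 := by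
          -- At a common stage, equality of values is divisibility of the difference by the
          -- irreducible polynomial of the generator.
          have : RE fun p : (ℕ × ℚ[X]) × ℕ × ℚ[X] => ∃ c : ℚ[X],
              liftPoly h p.1.1 p.1.2 p.2.1 - liftPoly h p.2.1 p.2.2 p.1.1 = m (p.1.1 + p.2.1) * c :=
            RE.ex (RE.eq (Comp.sub (compL₁.comp Comp.fst) (compL₂.comp Comp.fst)) (by fun_prop))
          refine this.of_iff fun p => ?_
          rw [← lift₁, ← lift₂, ← sub_eq_zero, ← map_sub]
          exact aeval_eq_zero_iff_dvd (hirr _) (hθ _) _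
        exact this }
  refine ⟨inferInstance, ⟨{ hC with
    gen := θ
    poly := m
    comp_gen := ?_
    comp_poly := hm
    irreducible_poly := hirr
    aeval_poly := hθ
    monotone_adjoin := hmono
    exists_mem := hex }⟩⟩
  have e : θ = fun n => val (n, X) := by
    funext n
    simp [val]
  rw [e]
  fun_prop

end Numbering

/-! ### Deciding membership in number fields -/

section Membership

open IntermediateField

variable {Ω : Type} [Field Ω] [CharZero Ω] [Numbered Ω] [ComputableTower Ω]

@[fun_prop]
theorem Comp.gen : Comp (ComputableTower.gen : ℕ → Ω) := ComputableTower.comp_gen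

theorem exists_common_mem_adjoin_gen (x y : Ω) (n : ℕ) : ∃ N, n ≤ N ∧
    x ∈ ℚ⟮(ComputableTower.gen N : Ω)⟯ ∧ y ∈ ℚ⟮(ComputableTower.gen N : Ω)⟯ := by
  obtain ⟨a, ha⟩ := ComputableTower.exists_mem x
  obtain ⟨b, hb⟩ := ComputableTower.exists_mem y
  exact ⟨max n (max a b), le_max_left _ _,
    ComputableTower.monotone_adjoin (le_max_of_le_right (le_max_left _ _)) ha,
    ComputableTower.monotone_adjoin (le_max_of_le_right (le_max_right _ _)) hb⟩

variable [Algebra.IsAlgebraic ℚ Ω]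

theorem RE.mem_adjoin {Y : Type} [Numbered Y] {x y : Y → Ω} (hx : Comp x) (hy : Comp y) :
    RE fun z => x z ∈ ℚ⟮y z⟯ := by
  simp only [mem_adjoin_iff_exists_aeval]
  exact RE.ex (RE.eq (by fun_prop) (by fun_prop))

theorem IntermediateField.exists_algEquiv_ne {F E : Type*} [Field F] [CharZero F] [Field E]
    [Algebra F E] [IsAlgClosed E] [Algebra.IsAlgebraic F E] (S : IntermediateField F E) {x : E}
    (hx : x ∉ S) : ∃ σ : E ≃ₐ[F] E, (∀ y ∈ S, σ y = y) ∧ σ x ≠ x := by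
  have : Algebra.IsAlgebraic S E := Algebra.IsAlgebraic.tower_top (K := F) S
  have : Normal S E := normal_iff.2 fun x =>
    ⟨Algebra.IsIntegral.isIntegral x, IsAlgClosed.splits _⟩
  have : IsGalois S E := {}
  have h := (InfiniteGalois.mem_bot_iff_fixed (k := S) x).not
  rw [IntermediateField.mem_bot] at h
  have hx' : x ∉ Set.range (algebraMap S E) := by
    rintro ⟨y, rfl⟩
    exact hx y.2
  obtain ⟨σ, hσ⟩ := not_forall.1 (h.1 hx')
  exact ⟨σ.restrictScalars F, fun y hy => σ.commutes ⟨y, hy⟩, hσ⟩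

/-- Galois theory turns non-membership into an existential statement: some embedding of a common
stage `ℚ⟮gen N⟯`, given by another root `θ` of its polynomial, fixes `y` and moves `x`. -/
theorem not_mem_adjoin_iff [IsAlgClosed Ω] (x y : Ω) : x ∉ ℚ⟮y⟯ ↔
    ∃ (N : ℕ) (g a : ℚ[X]) (θ : Ω), aeval (ComputableTower.gen N : Ω) g = y ∧
      aeval (ComputableTower.gen N : Ω) a = x ∧ aeval θ (ComputableTower.poly Ω N) = 0 ∧
      aeval θ g = y ∧ aeval θ a ≠ x := by
  constructor
  · intro hx
    obtain ⟨N, -, hxN, hyN⟩ := exists_common_mem_adjoin_gen x y 0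
    obtain ⟨a, ha⟩ := mem_adjoin_iff_exists_aeval.1 hxN
    obtain ⟨g, hg⟩ := mem_adjoin_iff_exists_aeval.1 hyN
    obtain ⟨σ, hσ, hσx⟩ := exists_algEquiv_ne _ hx
    have hσ' : ∀ f : ℚ[X], aeval (σ (ComputableTower.gen N)) f =
      σ (aeval (ComputableTower.gen N) f) := aeval_algHom_apply σ.toAlgHom _
    refine ⟨N, g, a, σ (ComputableTower.gen N), hg, ha, ?_, ?_, ?_⟩
    · rw [hσ', ComputableTower.aeval_poly, map_zero]
    · rw [hσ', hg, hσ _ (mem_adjoin_simple_self ℚ y)]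
    · rwa [hσ', ha]
  · rintro ⟨N, g, a, θ, hg, ha, hθ, hθg, hθa⟩ hx
    obtain ⟨f, hf⟩ := mem_adjoin_iff_exists_aeval.1 hx
    apply hθa
    have h0 : aeval (ComputableTower.gen N : Ω) (f.comp g - a) = 0 := by
      rw [map_sub, aeval_comp, hg, hf, ha, sub_self]
    obtain ⟨c, hc⟩ := (aeval_eq_zero_iff_dvd (ComputableTower.irreducible_poly N)
      (ComputableTower.aeval_poly N) _).1 h0
    have := congrArg (aeval θ) hc
    rw [map_mul, hθ, zero_mul, map_sub, aeval_comp, hθg, hf, sub_eq_zero] at this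
    exact this.symm

theorem RE.not_mem_adjoin [IsAlgClosed Ω] {Y : Type} [Numbered Y] {x y : Y → Ω} (hx : Comp x)
    (hy : Comp y) : RE fun z => x z ∉ ℚ⟮y z⟯ := by
  have hp := ComputableTower.comp_poly (Ω := Ω)
  simp only [not_mem_adjoin_iff]
  exact RE.ex (RE.ex (RE.ex (RE.ex (RE.and (RE.eq (by fun_prop) (by fun_prop)) (RE.and
    (RE.eq (by fun_prop) (by fun_prop)) (RE.and (RE.eq (by fun_prop) (by fun_prop)) (RE.and
    (RE.eq (by fun_prop) (by fun_prop)) (RE.ne (by fun_prop) (by fun_prop)))))))))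

end Membership

/-! ### Enumerating the odd primes -/

section Primes

variable {X : Type} [Numbered X]

theorem RE.prime {f : X → ℕ} (hf : Comp f) : RE fun x => (f x).Prime := by
  have : RE fun n : ℕ => 2 ≤ n ∧ ∀ a < n, ∀ b < n, a * b ≠ n :=
    RE.and (RE.nat_le (by fun_prop) (by fun_prop)) (RE.ball_lt (by fun_prop)
      (RE.ball_lt (by fun_prop) (RE.nat_ne (by fun_prop) (by fun_prop))))
  refine RE.comp (P := Nat.Prime) (this.of_iff fun n => ?_) hf
  constructor
  · refine fun h => ⟨h.two_le, fun a ha b hb hab => ?_⟩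
    exact Nat.not_prime_mul (a := a) (b := b) (by rintro rfl; omega) (by rintro rfl; omega)
      (hab ▸ h)
  · rintro ⟨h2, h⟩
    by_contra hn
    obtain ⟨a, b, ha, hb, hab⟩ := (Nat.not_prime_iff_exists_mul_eq h2).1 hn
    exact h a ha b hb hab

theorem RE.not_prime {f : X → ℕ} (hf : Comp f) : RE fun x => ¬ (f x).Prime := by
  have : RE fun n : ℕ => n < 2 ∨ ∃ a b, a < n ∧ b < n ∧ a * b = n :=
    RE.or (RE.nat_lt (by fun_prop) (by fun_prop)) (RE.ex (RE.ex (RE.and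
      (RE.nat_lt (by fun_prop) (by fun_prop)) (RE.and
      (RE.nat_lt (by fun_prop) (by fun_prop)) (RE.nat_eq (by fun_prop) (by fun_prop))))))
  refine RE.comp (P := fun n => ¬ Nat.Prime n) (this.of_iff fun n => ?_) hf
  rcases lt_or_ge n 2 with h | h
  · simp only [h, true_or, iff_true]
    exact fun hp => absurd hp.two_le (by omega)
  · rw [Nat.not_prime_iff_exists_mul_eq h]
    exact (or_iff_right (by omega)).symm

theorem RE.nat_mem {f : X → ℕ} {l : X → List ℕ} (hf : Comp f) (hl : Comp l) :
    RE fun x => f x ∈ l x := by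
  have : RE fun x => ∃ i, i < (l x).length ∧ (l x).getD i 0 = f x :=
    RE.ex (RE.and (RE.nat_lt (by fun_prop) (by fun_prop)) (RE.nat_eq (by fun_prop) (by fun_prop)))
  refine this.of_iff fun x => ?_
  rw [List.mem_iff_getElem]
  refine exists_congr fun i => ⟨fun ⟨hi, h⟩ => ⟨hi, ?_⟩, fun ⟨hi, h⟩ => ⟨hi, ?_⟩⟩
  · rwa [List.getD_eq_getElem _ _ hi]
  · rwa [List.getD_eq_getElem _ _ hi] at h

theorem mem_prevList {Y : Type} (y : ℕ → Y) (n : ℕ) (z : Y) :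
    z ∈ prevList y n ↔ ∃ k < n, y k = z := by
  induction n with
  | zero => simp [prevList]
  | succ n ih =>
    rw [prevList_succ, List.mem_cons, ih]
    constructor
    · rintro (rfl | ⟨k, hk, rfl⟩)
      · exact ⟨n, by omega, rfl⟩
      · exact ⟨k, by omega, rfl⟩
    · rintro ⟨k, hk, rfl⟩
      rcases Nat.lt_succ_iff_lt_or_eq.1 hk with h | rfl
      · exact Or.inr ⟨k, h, rfl⟩
      · exact Or.inl rfl

theorem length_prevList {Y : Type} (y : ℕ → Y) (n : ℕ) : (prevList y n).length = n := by
  induction n with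
  | zero => rfl
  | succ n ih => rw [prevList_succ, List.length_cons, ih]

/-- There is a computable enumeration of the odd primes without repetition. -/
theorem exists_enumeration_odd_primes : ∃ p : ℕ → ℕ, Computable p ∧ Function.Injective p ∧
    Set.range p = {n | n.Prime ∧ n ≠ 2} := by
  -- `R` asks for the next odd prime in increasing order; the invariant `V` below says that `l` has
  -- skipped none.
  let R : List ℕ → ℕ → Prop := fun l y => (y.Prime ∧ y ≠ 2) ∧ (∀ e ∈ l, e < y) ∧
    ∀ z < y, z ∈ l ∨ z = 2 ∨ ¬ z.Prime
  have hR : RE fun p : List ℕ × ℕ => R p.1 p.2 :=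
    RE.and (RE.and (RE.prime (by fun_prop)) (RE.nat_ne (by fun_prop) (by fun_prop))) (RE.and
      (RE.ball_mem (by fun_prop) (RE.nat_lt (by fun_prop) (by fun_prop))) (RE.ball_lt (by fun_prop)
      (RE.or (RE.nat_mem (by fun_prop) (by fun_prop))
        (RE.or (RE.nat_eq (by fun_prop) (by fun_prop)) (RE.not_prime (by fun_prop))))))
  let V : List ℕ → Prop := fun l => ∀ e ∈ l, ∀ z ≤ e, z ∈ l ∨ z = 2 ∨ ¬ z.Prime
  have hex : ∀ l, V l → ∃ y, R l y := by
    intro l hl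
    have : ∃ y, (y.Prime ∧ y ≠ 2) ∧ y ∉ l := by
      obtain ⟨y, hy, hp⟩ := Nat.exists_infinite_primes (l.sum + 3)
      refine ⟨y, ⟨hp, by omega⟩, fun hm => ?_⟩
      have := List.single_le_sum (fun _ _ => Nat.zero_le _) y hm
      omega
    classical
    refine ⟨Nat.find this, (Nat.find_spec this).1, fun e he => ?_, fun z hz => ?_⟩
    · by_contra hlt
      rcases hl e he _ (not_lt.1 hlt) with h | h | h
      · exact (Nat.find_spec this).2 h
      · exact (Nat.find_spec this).1.2 h
      · exact h (Nat.find_spec this).1.1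
    · have := Nat.find_min this hz
      tauto
  obtain ⟨p, hp, h⟩ := hR.exists_seq V (by simp [V]) hex fun l y hl hy e he z hz => by
    rcases List.mem_cons.1 he with rfl | he
    · rcases hz.lt_or_eq with hz | rfl
      · exact (hy.2.2 z hz).imp_left (List.mem_cons_of_mem _)
      · exact Or.inl List.mem_cons_self
    · exact (hl e he z hz).imp_left (List.mem_cons_of_mem _)
  have hmono : StrictMono p := strictMono_nat_of_lt_succ fun n =>
    (h (n + 1)).2.2.1 _ (by rw [prevList_succ]; exact List.mem_cons_self)
  refine ⟨p, hp.computable, hmono.injective, Set.ext fun n => ⟨?_, fun hn => ?_⟩⟩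
  · rintro ⟨k, rfl⟩
    exact (h k).2.1
  · rcases (h (n + 1)).2.2.2 n ((Nat.lt_succ_self n).trans_le (hmono.id_le (n + 1))) with h | h | h
    · obtain ⟨k, -, hk⟩ := (mem_prevList _ _ _).1 h
      exact ⟨k, hk⟩
    · exact absurd h hn.2
    · exact absurd hn.1 h

end Primes

/-! ### Halting stages and the halting set -/

section Halting

open Nat.Partrec (Code)

/-- The program with index `s.unpair.1` halts on its index after exactly `s.unpair.2 + 1` steps. -/
def HaltsAtStage (s : ℕ) : Prop :=
  Code.evaln s.unpair.2 (Denumerable.ofNat Code s.unpair.1) s.unpair.1 = none ∧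
    Code.evaln (s.unpair.2 + 1) (Denumerable.ofNat Code s.unpair.1) s.unpair.1 ≠ none

theorem primrecPred_haltsAtStage : PrimrecPred HaltsAtStage := by
  have h1 : Primrec fun s : ℕ => s.unpair.1 := Primrec.fst.comp Primrec.unpair
  have h2 : Primrec fun s : ℕ => s.unpair.2 := Primrec.snd.comp Primrec.unpair
  have h3 : Primrec fun s : ℕ => Denumerable.ofNat Code s.unpair.1 :=
    (Primrec.ofNat Code).comp h1
  refine PrimrecPred.and ?_ (PrimrecPred.not ?_)
  · exact Primrec.eq.comp (Code.primrec_evaln.comp ((h2.pair h3).pair h1)) (Primrec.const none)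
  · exact Primrec.eq.comp (Code.primrec_evaln.comp (((Primrec.succ.comp h2).pair h3).pair h1))
      (Primrec.const none)

theorem RE.haltsAtStage {X : Type} [Numbered X] {f : X → ℕ} (hf : Comp f) :
    RE fun x => HaltsAtStage (f x) :=
  (RE.of_rePred primrecPred_haltsAtStage.computablePred.to_re).comp hf

theorem RE.not_haltsAtStage {X : Type} [Numbered X] {f : X → ℕ} (hf : Comp f) :
    RE fun x => ¬ HaltsAtStage (f x) :=
  (RE.of_rePred (P := fun s => ¬ HaltsAtStage s)
    primrecPred_haltsAtStage.computablePred.not.to_re).comp hf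

theorem HaltsAtStage.mem_haltingSet {s : ℕ} (h : HaltsAtStage s) : s.unpair.1 ∈ haltingSet := by
  obtain ⟨x, hx⟩ := Option.ne_none_iff_exists'.1 h.2
  exact Part.dom_iff_mem.2 ⟨x, Code.evaln_sound hx⟩

/-- Bounded evaluation is monotone in the bound, so it changes from `none` only once: each `i ∈ 0'`
owns a single stage. -/
theorem HaltsAtStage.eq {s t : ℕ} (hs : HaltsAtStage s) (ht : HaltsAtStage t)
    (h : s.unpair.1 = t.unpair.1) : s = t := by
  have key : ∀ {s t : ℕ}, HaltsAtStage s → HaltsAtStage t → s.unpair.1 = t.unpair.1 →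
      t.unpair.2 ≤ s.unpair.2 := by
    intro s t hs ht h
    by_contra hlt
    obtain ⟨x, hx⟩ := Option.ne_none_iff_exists'.1 hs.2
    have := Code.evaln_mono (Nat.succ_le_of_lt (not_le.1 hlt)) hx
    rw [h, ht.1] at this
    simp at this
  rw [← Nat.pair_unpair s, ← Nat.pair_unpair t, h,
    le_antisymm (key ht hs h.symm) (key hs ht h)]

theorem exists_haltsAtStage {i : ℕ} (hi : i ∈ haltingSet) :
    ∃ s, HaltsAtStage s ∧ s.unpair.1 = i := by
  classical
  obtain ⟨x, hx⟩ := Part.dom_iff_mem.1 hi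
  obtain ⟨k, hk⟩ := Code.evaln_complete.1 hx
  have hex : ∃ k, Code.evaln k (Denumerable.ofNat Code i) i ≠ none := ⟨k, by rw [hk]; simp⟩
  -- With bound 0 evaluation returns nothing, so the least successful bound is a successor.
  have hpos : Nat.find hex ≠ 0 := fun h => by
    have := Nat.find_spec hex
    rw [h] at this
    simp [Code.evaln] at this
  obtain ⟨t, ht⟩ := Nat.exists_eq_succ_of_ne_zero hpos
  refine ⟨Nat.pair i t, ⟨?_, ?_⟩, by simp⟩
  · simpa using Nat.find_min hex (m := t) (by omega)
  · have := Nat.find_spec hex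
    rw [ht] at this
    simpa using this

/-- Diagonalization: a program halting exactly on the complement is run on its own index. -/
theorem not_rePred_compl_haltingSet : ¬ REPred fun i => i ∉ haltingSet := by
  intro h
  obtain ⟨c, hc⟩ := Code.exists_code.1
    (Partrec.nat_iff.1 (h.map (Computable.const (0 : ℕ)).to₂))
  have h1 : ∀ n, n ∉ haltingSet ↔ (c.eval n).Dom := fun n => by
    rw [hc]
    simp [Part.dom_iff_mem]
  have h2 := h1 (Encodable.encode c)
  have h3 : Encodable.encode c ∈ haltingSet ↔ (c.eval (Encodable.encode c)).Dom := by
    simp [haltingSet]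
  tauto

end Halting

/-! ### Ramification of `q` in a field containing a root of `2 * q` -/

open scoped NumberField in
/-- For almost all primes `q`, a number field does not contain a `p`-th root of `2 * q`. -/
theorem NumberField.exists_forall_pow_ne (E : Type) [Field E] [NumberField E] {p : ℕ}
    (hp : 2 ≤ p) : ∃ D : ℕ, ∀ q : ℕ, q.Prime → D < q → ∀ b : E, b ^ p ≠ 2 * (q : E) := by
  let I := differentIdeal ℤ (𝓞 E)
  have hI : I ≠ ⊥ := differentIdeal_ne_bot
  -- A ramified prime divides the norm of the different, so primes beyond this norm are unramified.
  refine ⟨max 2 (Ideal.absNorm I), fun q hq hDq b hb => ?_⟩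
  have hq2 : 2 < q := (le_max_left _ _).trans_lt hDq
  have hint : IsIntegral ℤ b := by
    refine IsIntegral.of_pow (n := p) (by omega) ?_
    rw [hb]
    exact_mod_cast isIntegral_algebraMap (R := ℤ) (A := E) (x := 2 * q)
  let β : 𝓞 E := ⟨b, hint⟩
  have hβ : β ^ p = 2 * (q : 𝓞 E) := by
    apply RingOfIntegers.coe_injective
    rw [map_pow, map_mul, map_natCast, map_ofNat]
    exact hb
  have : Fact q.Prime := ⟨hq⟩
  have hmax : (Ideal.span {(q : ℤ)}).IsMaximal :=
    PrincipalIdealRing.isMaximal_of_irreducible (Nat.prime_iff_prime_int.1 hq).irreducible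
  obtain ⟨Q, hQ, hover⟩ := Ideal.exists_maximal_ideal_liesOver_of_isIntegral
    (S := 𝓞 E) (Ideal.span {(q : ℤ)})
  have hqQ : (q : 𝓞 E) ∈ Q := by
    have : (q : ℤ) ∈ Ideal.span {(q : ℤ)} := Ideal.mem_span_singleton_self _
    rw [hover.over] at this
    simpa using this
  have hβQ : β ∈ Q := hQ.isPrime.mem_of_pow_mem p (by
    rw [hβ]
    exact Q.mul_mem_left _ hqQ)
  have h2q : 2 * (q : 𝓞 E) ∈ Q ^ 2 := by
    rw [← hβ]
    exact Ideal.pow_le_pow_right hp (Ideal.pow_mem_pow hβQ p)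
  -- Since `q = 2 * k + 1`, one has `q = q ^ 2 - k * (2 * q)`, which removes the factor 2.
  have hqQ2 : (q : 𝓞 E) ∈ Q ^ 2 := by
    obtain ⟨k, hk⟩ := hq.odd_of_ne_two hq2.ne'
    have e : (q : 𝓞 E) = (q : 𝓞 E) ^ 2 - (k : 𝓞 E) * (2 * q) := by
      have : (q : 𝓞 E) = 2 * k + 1 := by exact_mod_cast congrArg (Nat.cast : ℕ → 𝓞 E) hk
      linear_combination (-(q : 𝓞 E)) * this
    rw [e]
    exact sub_mem (Ideal.pow_mem_pow hqQ 2) (Ideal.mul_mem_left _ _ h2q)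
  have hdvd : Q ^ 2 ∣ (Ideal.span {(q : ℤ)}).map (algebraMap ℤ (𝓞 E)) := by
    rw [Ideal.dvd_iff_le, Ideal.map_span, Set.image_singleton, Ideal.span_singleton_le_iff_mem]
    simpa using hqQ2
  have hne : Ideal.span {(q : ℤ)} ≠ ⊥ := by
    rw [Ne, Ideal.span_singleton_eq_bot]
    exact_mod_cast hq.ne_zero
  have hQI : Q ∣ I := by
    simpa using pow_sub_one_dvd_differentIdeal ℤ Q 2 hne hdvd
  have hmem : (Ideal.absNorm I : 𝓞 E) ∈ Q := Ideal.dvd_iff_le.1 hQI (Ideal.absNorm_mem I)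
  have hmem' : (Ideal.absNorm I : ℤ) ∈ Ideal.span {(q : ℤ)} := by
    rw [hover.over, Ideal.under_def, Ideal.mem_comap]
    simpa using hmem
  rw [Ideal.mem_span_singleton, Int.natCast_dvd_natCast] at hmem'
  have h0 : Ideal.absNorm I ≠ 0 := Ideal.absNorm_eq_zero_iff.not.2 hI
  have := Nat.le_of_dvd (Nat.pos_of_ne_zero h0) hmem'
  exact absurd ((le_max_right _ _).trans_lt hDq) (not_lt.2 this)

/-! ### Valuations above the 2-adic one -/

section Valuation

variable {L Γ : Type*} [Field L] [LinearOrderedCommGroupWithZero Γ] (w : Valuation L Γ)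

/-- By the ultrametric inequality a sum has the value of its strictly dominant term; distinct values
of the nonzero terms make the largest one dominant. -/
theorem Valuation.exists_sum_eq_of_injOn {ι : Type*} (S : Finset ι) (f : ι → L)
    (h : ∀ i ∈ S, ∀ j ∈ S, f i ≠ 0 → w (f i) = w (f j) → i = j) (hne : ∃ i ∈ S, f i ≠ 0) :
    ∃ i ∈ S, f i ≠ 0 ∧ w (∑ j ∈ S, f j) = w (f i) ∧ ∀ j ∈ S, w (f j) ≤ w (f i) := by
  classical
  obtain ⟨i₀, hi₀, hne₀⟩ := hne
  obtain ⟨i, hi, hmax⟩ := S.exists_max_image (fun i => w (f i)) ⟨i₀, hi₀⟩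
  have hfi : f i ≠ 0 := fun h0 => by
    have := hmax i₀ hi₀
    rw [h0, map_zero, le_zero_iff, w.zero_iff] at this
    exact hne₀ this
  refine ⟨i, hi, hfi, ?_, hmax⟩
  rw [← Finset.add_sum_erase S f hi]
  refine w.map_add_eq_of_lt_left (w.map_sum_lt (w.ne_zero_iff.2 hfi) fun j hj => ?_)
  obtain ⟨hji, hj⟩ := Finset.mem_erase.1 hj
  exact lt_of_le_of_ne (hmax j hj) fun e => hji (h i hi j hj hfi e.symm).symm

theorem Valuation.map_natCast_le_one (n : ℕ) : w (n : L) ≤ 1 := by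
  induction n with
  | zero => simp
  | succ n ih =>
    rw [Nat.cast_succ]
    exact w.map_add_le ih w.map_one.le

theorem Valuation.map_intCast_le_one (n : ℤ) : w (n : L) ≤ 1 := by
  obtain ⟨n, rfl | rfl⟩ := n.eq_nat_or_neg
  · simpa using w.map_natCast_le_one n
  · simpa using w.map_natCast_le_one n

variable {w}

theorem Valuation.map_odd (hw : w 2 < 1) {n : ℕ} (hn : Odd n) : w (n : L) = 1 := by
  obtain ⟨k, rfl⟩ := hn
  have h : w (2 * (k : L)) < w 1 := by
    rw [map_mul, map_one]
    exact mul_lt_one_of_lt_of_le hw (w.map_natCast_le_one k)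
  push_cast
  rw [w.map_add_eq_of_lt_right h, map_one]

theorem Valuation.exists_map_natCast_eq (hw : w 2 < 1) {n : ℕ} (hn : n ≠ 0) :
    ∃ k : ℕ, w (n : L) = w 2 ^ k ∧ (k = 0 → Odd n) := by
  obtain ⟨k, m, hm, rfl⟩ := Nat.exists_eq_two_pow_mul_odd hn
  refine ⟨k, ?_, ?_⟩
  · rw [Nat.cast_mul, map_mul, map_odd hw hm, mul_one]
    simp
  · rintro rfl
    simpa using hm

/-- Some multiple of the element by an odd number is integral. -/
def TwoIntegral (x : L) : Prop := ∃ d : ℕ, Odd d ∧ IsIntegral ℤ ((d : L) * x)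

theorem TwoIntegral.add {x y : L} : TwoIntegral x → TwoIntegral y → TwoIntegral (x + y) := by
  rintro ⟨d, hd, hx⟩ ⟨e, he, hy⟩
  refine ⟨d * e, hd.mul he, ?_⟩
  have := ((isIntegral_algebraMap (R := ℤ) (A := L) (x := e)).mul hx).add
    ((isIntegral_algebraMap (R := ℤ) (A := L) (x := d)).mul hy)
  have e' : ((d * e : ℕ) : L) * (x + y) =
      algebraMap ℤ L e * (d * x) + algebraMap ℤ L d * (e * y) := by
    push_cast [eq_intCast]
    ring
  rwa [e']

theorem TwoIntegral.zero : TwoIntegral (0 : L) := ⟨1, odd_one, by simpa using isIntegral_zero⟩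

theorem TwoIntegral.sum {ι : Type*} {S : Finset ι} {f : ι → L} (h : ∀ i ∈ S, TwoIntegral (f i)) :
    TwoIntegral (∑ i ∈ S, f i) :=
  Finset.sum_induction f TwoIntegral (fun _ _ => TwoIntegral.add) TwoIntegral.zero h

theorem TwoIntegral.of_pow {x : L} {n : ℕ} (hn : 0 < n) : TwoIntegral (x ^ n) → TwoIntegral x := by
  rintro ⟨d, hd, h⟩
  refine ⟨d, hd, IsIntegral.of_pow hn ?_⟩
  have := ((isIntegral_algebraMap (R := ℤ) (A := L) (x := d)).pow (n - 1)).mul h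
  rwa [← mul_assoc, eq_intCast, Int.cast_natCast, ← pow_succ, Nat.sub_add_cancel hn,
    ← mul_pow] at this

theorem Valuation.map_le_one_of_isIntegral {x : L} (hx : IsIntegral ℤ x) : w x ≤ 1 := by
  obtain ⟨f, hf, hfx⟩ := hx
  by_contra! h1
  have h0 : w x ≠ 0 := (zero_lt_one.trans h1).ne'
  have e : x ^ f.natDegree = - ∑ i ∈ Finset.range f.natDegree, (f.coeff i : L) * x ^ i := by
    rw [eval₂_eq_sum_range, Finset.sum_range_succ, hf.coeff_natDegree, map_one, one_mul] at hfx
    rw [eq_neg_iff_add_eq_zero, add_comm]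
    exact hfx
  have : w (x ^ f.natDegree) < w x ^ f.natDegree := by
    rw [e, Valuation.map_neg]
    refine w.map_sum_lt (pow_ne_zero _ h0) fun i hi => ?_
    rw [map_mul, map_pow]
    calc w (f.coeff i : L) * w x ^ i ≤ 1 * w x ^ i :=
          mul_le_mul_left (w.map_intCast_le_one _) _
      _ = w x ^ i := one_mul _
      _ < w x ^ f.natDegree := pow_lt_pow_right₀ h1 (Finset.mem_range.1 hi)
  rw [map_pow] at this
  exact lt_irrefl _ this

theorem TwoIntegral.map_le_one (hw : w 2 < 1) {x : L} : TwoIntegral x → w x ≤ 1 := by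
  rintro ⟨d, hd, h⟩
  have := Valuation.map_le_one_of_isIntegral (w := w) h
  rwa [map_mul, Valuation.map_odd hw hd, one_mul] at this

theorem Valuation.zpow_two_injective [CharZero L] (hw : w 2 < 1) :
    Function.Injective fun t : ℤ => w 2 ^ t :=
  (zpow_right_strictAnti₀ (zero_lt_iff.2 (w.ne_zero_iff.2 two_ne_zero)) hw).injective

variable [CharZero L]

theorem Valuation.exists_map_rat_eq (hw : w 2 < 1) {c : ℚ} (hc : c ≠ 0) :
    ∃ t : ℤ, w (c : L) = w 2 ^ t ∧ (0 ≤ t → Odd c.den) := by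
  obtain ⟨k, hk, hk'⟩ := exists_map_natCast_eq hw (Int.natAbs_ne_zero.2 (Rat.num_ne_zero.2 hc))
  obtain ⟨l, hl, hl'⟩ := exists_map_natCast_eq hw c.den_ne_zero
  have h2 : w 2 ≠ 0 := w.ne_zero_iff.2 two_ne_zero
  have hnum : w (c.num : L) = w 2 ^ k := by
    rw [← hk]
    rcases Int.natAbs_eq c.num with h | h
    · conv_lhs => rw [h]
      simp
    · conv_lhs => rw [h]
      simp
  refine ⟨k - l, ?_, fun ht => ?_⟩
  · rw [Rat.cast_def, map_div₀, hnum, hl, zpow_sub₀ h2, zpow_natCast, zpow_natCast]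
  -- An even denominator together with `t ≥ 0` forces an even numerator, contrary to lowest terms.
  · by_contra hodd
    have hl0 : l ≠ 0 := fun h => hodd (hl' h)
    have hk0 : k ≠ 0 := by omega
    have hden : 2 ∣ c.den := even_iff_two_dvd.1 (Nat.not_odd_iff_even.1 hodd)
    have hnum : 2 ∣ c.num.natAbs := by
      by_contra h
      have := map_odd hw (Nat.not_even_iff_odd.1 fun h' => h (even_iff_two_dvd.1 h'))
      rw [hk] at this
      exact (pow_lt_one₀ zero_le hw hk0).ne this
    have := Nat.dvd_gcd hnum hden
    rw [c.reduced.gcd_eq_one] at this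
    omega

theorem Valuation.map_rat_le_one_iff (hw : w 2 < 1) (c : ℚ) : w (c : L) ≤ 1 ↔ Odd c.den := by
  constructor
  · intro h
    rcases eq_or_ne c 0 with rfl | hc
    · simp
    · obtain ⟨t, ht, ht'⟩ := exists_map_rat_eq hw hc
      apply ht'
      by_contra hneg
      rw [ht] at h
      have : w 2 ^ (0 : ℤ) < w 2 ^ t :=
        zpow_right_strictAnti₀ (zero_lt_iff.2 (w.ne_zero_iff.2 two_ne_zero)) hw (not_le.1 hneg)
      rw [zpow_zero] at this
      exact absurd h (not_le.2 this)
  · intro h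
    rw [Rat.cast_def, map_div₀, map_odd hw h, div_one]
    exact w.map_intCast_le_one _

theorem Valuation.comap_rat_isEquiv (hw : w 2 < 1) :
    (w.comap (algebraMap ℚ L)).IsEquiv (Rat.padicValuation 2) := by
  refine Valuation.isEquiv_iff_val_le_one.2 fun {c} => ?_
  rw [Valuation.comap_apply, eq_ratCast, map_rat_le_one_iff hw, Rat.padicValuation_le_one_iff,
    Nat.odd_iff, Nat.two_dvd_ne_zero]

variable (L) in
-- Chevalley's extension theorem, applied to the proper ideal generated by 2 in the image of `ℤ`.
theorem exists_valuationSubring_two : ∃ A : ValuationSubring L, A.valuation 2 < 1 := by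
  let R : Subring L := (Int.castRingHom L).range
  have h2 : (2 : L) ∈ R := ⟨2, by simp⟩
  have hne : Ideal.span {(⟨2, h2⟩ : R)} ≠ ⊤ := by
    rw [Ne, Ideal.eq_top_iff_one, Ideal.mem_span_singleton']
    rintro ⟨⟨_, a, rfl⟩, ha⟩
    have h := congrArg (Subtype.val) ha
    have h' : ((a * 2 : ℤ) : L) = ((1 : ℤ) : L) := by
      push_cast
      simpa using h
    have := Int.cast_injective (α := L) h'
    omega
  obtain ⟨A, -, hA⟩ := Ideal.image_subset_nonunits_valuationSubring _ hne
  exact ⟨A, (A.mem_nonunits_iff).1 (hA ⟨⟨2, h2⟩, Ideal.mem_span_singleton_self _, rfl⟩)⟩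

/-- An algebraic element has a power whose value is a power of that of `2`. -/
theorem Valuation.exists_pow_eq_zpow_two [Algebra.IsAlgebraic ℚ L] (hw : w 2 < 1) {x : L}
    (hx : x ≠ 0) : ∃ n : ℕ, 0 < n ∧ ∃ t : ℤ, w x ^ n = w 2 ^ t := by
  have h0 : w x ≠ 0 := w.ne_zero_iff.2 hx
  have h2 : w 2 ≠ 0 := w.ne_zero_iff.2 two_ne_zero
  obtain ⟨f, hf, hfx⟩ := Algebra.IsAlgebraic.isAlgebraic (R := ℚ) x
  have hsum : ∑ i ∈ f.support, (f.coeff i : L) * x ^ i = 0 := by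
    rw [aeval_eq_sum_range' (Nat.lt_succ_self _)] at hfx
    rw [← hfx]
    refine Finset.sum_subset_zero_on_sdiff (fun i hi => ?_) (fun i hi => ?_) fun i _ => ?_
    · exact Finset.mem_range_succ_iff.2 (le_natDegree_of_mem_supp _ hi)
    · rw [notMem_support_iff.1 (Finset.mem_sdiff.1 hi).2, zero_smul]
    · rw [Algebra.smul_def, eq_ratCast]
  have hterm : ∀ i ∈ f.support, (f.coeff i : L) * x ^ i ≠ 0 := fun i hi =>
    mul_ne_zero (by exact_mod_cast mem_support_iff.1 hi) (pow_ne_zero _ hx)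
  obtain ⟨i₀, hi₀⟩ := nonempty_support_iff.2 hf
  -- Were the claim false, the nonzero terms of an algebraic equation for `x` would have distinct
  -- values and could not sum to 0.
  by_contra hcon
  have hinj : ∀ i ∈ f.support, ∀ j ∈ f.support, (f.coeff i : L) * x ^ i ≠ 0 →
      w ((f.coeff i : L) * x ^ i) = w ((f.coeff j : L) * x ^ j) → i = j := by
    intro i hi j hj _ hij
    obtain ⟨s, hs, -⟩ := exists_map_rat_eq hw (mem_support_iff.1 hi)
    obtain ⟨t, ht, -⟩ := exists_map_rat_eq hw (mem_support_iff.1 hj)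
    rw [map_mul, map_mul, map_pow, map_pow, hs, ht] at hij
    by_contra hne
    wlog hlt : i < j generalizing i j s t
    · exact this j hj i hi (hterm j hj) t ht s hij.symm hs (Ne.symm hne) (by omega)
    refine hcon ⟨j - i, by omega, s - t, ?_⟩
    have hi0 : w x ^ i ≠ 0 := pow_ne_zero _ h0
    have ht0 : w 2 ^ t ≠ 0 := zpow_ne_zero _ h2
    rw [zpow_sub₀ h2, eq_div_iff ht0]
    apply mul_right_cancel₀ hi0
    rw [hij, mul_right_comm, ← pow_add, Nat.sub_add_cancel hlt.le, mul_comm]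
  obtain ⟨i, hi, hne, hval, -⟩ := w.exists_sum_eq_of_injOn f.support
    (fun i => (f.coeff i : L) * x ^ i) hinj ⟨i₀, hi₀, hterm i₀ hi₀⟩
  rw [hsum, map_zero] at hval
  exact w.ne_zero_iff.2 hne hval.symm

/-- The rank is one: up to a power, every value is a power of that of 2. So precision may always be
measured in powers of 2. -/
theorem Valuation.exists_pow_le_two [Algebra.IsAlgebraic ℚ L] (hw : w 2 < 1) {x : L} (hx : w x < 1) :
    ∃ n : ℕ, w x ^ n ≤ w 2 := by
  have h2 : 0 < w 2 := zero_lt_iff.2 (w.ne_zero_iff.2 two_ne_zero)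
  rcases eq_or_ne x 0 with rfl | hx0
  · exact ⟨1, by simp⟩
  obtain ⟨n, hn, t, ht⟩ := Valuation.exists_pow_eq_zpow_two hw hx0
  refine ⟨n, ?_⟩
  have h1 : w 2 ^ t < 1 := ht ▸ pow_lt_one₀ zero_le hx hn.ne'
  have ht0 : 0 < t := by
    by_contra! hle
    exact absurd h1 (not_lt.2 (one_le_zpow_of_nonpos₀ h2 hw.le hle))
  rw [ht]
  calc w 2 ^ t ≤ w 2 ^ (1 : ℤ) := zpow_le_zpow_right_of_le_one₀ h2 hw.le ht0
    _ = w 2 := zpow_one _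

end Valuation

/-! ### Totally ramified towers of radicals -/

section Radicals

open IntermediateField

/-- A sequence of radicals `β s` of `2 * q s`, of exponents `p s.unpair.1`, for the stages `s` at
which a program is found to halt on its index. -/
structure RadicalSequence (Ω : Type) [Field Ω] [CharZero Ω] (p : ℕ → ℕ) where
  prime_p : ∀ i, (p i).Prime
  injective_p : Function.Injective p
  q : ℕ → ℕ
  β : ℕ → Ω
  strictMono_q : StrictMono q
  prime_q : ∀ {s}, HaltsAtStage s → (q s).Prime
  two_lt_q : ∀ {s}, HaltsAtStage s → 2 < q s
  eq_one : ∀ {s}, ¬ HaltsAtStage s → β s = 1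
  pow_eq : ∀ {s}, HaltsAtStage s → β s ^ p s.unpair.1 = 2 * (q s : Ω)

namespace RadicalSequence

variable {Ω : Type} [Field Ω] [CharZero Ω] {p : ℕ → ℕ} (S : RadicalSequence Ω p)

/-- The product of the radicals of the stages before `s`. -/
noncomputable def prod (s : ℕ) : Ω := ∏ t ∈ Finset.range s, S.β t

open Classical in
/-- The product of the exponents of the radicals of the stages before `s`. -/
noncomputable def exponent (_S : RadicalSequence Ω p) (s : ℕ) : ℕ :=
  ∏ t ∈ Finset.range s, if HaltsAtStage t then p t.unpair.1 else 1

/-- The field generated by the radicals of the stages before `s`. -/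
noncomputable def stage (s : ℕ) : IntermediateField ℚ Ω := ℚ⟮S.prod s⟯

theorem prod_succ (s : ℕ) : S.prod (s + 1) = S.prod s * S.β s := Finset.prod_range_succ _ _

theorem exponent_succ_of_halts {s : ℕ} (hs : HaltsAtStage s) :
    S.exponent (s + 1) = S.exponent s * p s.unpair.1 := by
  rw [exponent, Finset.prod_range_succ, if_pos hs, exponent]

theorem exponent_succ_of_not_halts {s : ℕ} (hs : ¬ HaltsAtStage s) :
    S.exponent (s + 1) = S.exponent s := by
  rw [exponent, Finset.prod_range_succ, if_neg hs, mul_one, exponent]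

theorem stage_succ_of_not_halts {s : ℕ} (hs : ¬ HaltsAtStage s) :
    S.stage (s + 1) = S.stage s := by
  rw [stage, prod_succ, S.eq_one hs, mul_one, stage]

theorem coprime_exponent {i s : ℕ} (h : ∀ t < s, HaltsAtStage t → t.unpair.1 ≠ i) :
    Nat.Coprime (p i) (S.exponent s) := by
  refine Nat.Coprime.prod_right fun t ht => ?_
  split_ifs with hts
  · exact (Nat.coprime_primes (S.prime_p _) (S.prime_p _)).2 fun e =>
      h t (Finset.mem_range.1 ht) hts (S.injective_p e).symm
  · exact Nat.coprime_one_right _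

theorem coprime_exponent_of_halts {s : ℕ} (hs : HaltsAtStage s) :
    Nat.Coprime (p s.unpair.1) (S.exponent s) :=
  S.coprime_exponent fun _ ht hts e => ht.ne (hts.eq hs e)

theorem beta_ne_zero (s : ℕ) : S.β s ≠ 0 := by
  by_cases hs : HaltsAtStage s
  · intro h0
    have := S.pow_eq hs
    rw [h0, zero_pow (S.prime_p _).ne_zero] at this
    exact mul_ne_zero two_ne_zero (Nat.cast_ne_zero.2 (S.prime_q hs).ne_zero) this.symm
  · rw [S.eq_one hs]
    exact one_ne_zero

theorem exists_prod_pow_exponent (s : ℕ) : ∃ c : ℚ, c ≠ 0 ∧ S.prod s ^ S.exponent s = (c : Ω) := by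
  induction s with
  | zero => exact ⟨1, one_ne_zero, by simp [prod]⟩
  | succ s ih =>
    obtain ⟨c, hc, h⟩ := ih
    by_cases hs : HaltsAtStage s
    · refine ⟨c ^ p s.unpair.1 * (2 * (S.q s : ℚ)) ^ S.exponent s, mul_ne_zero (pow_ne_zero _ hc)
        (pow_ne_zero _ (mul_ne_zero two_ne_zero (Nat.cast_ne_zero.2 (S.prime_q hs).ne_zero))), ?_⟩
      rw [prod_succ, S.exponent_succ_of_halts hs, mul_pow, pow_mul, h,
        mul_comm (S.exponent s), pow_mul, S.pow_eq hs]
      push_cast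
      rfl
    · rw [prod_succ, S.exponent_succ_of_not_halts hs, S.eq_one hs, mul_one]
      exact ⟨c, hc, h⟩

/-- The power of `S.prod s` by its exponent is rational, so the same power of `β s` lies in the
field generated by the new product, as does its `p`-th power; the exponents are coprime and Bézout
recovers `β s`. Thus a single generator suffices for each stage. -/
theorem beta_mem_stage_succ (s : ℕ) : S.β s ∈ S.stage (s + 1) := by
  by_cases hs : HaltsAtStage s
  · obtain ⟨c, hc, h⟩ := S.exists_prod_pow_exponent s
    have hc' : (c : Ω) ≠ 0 := by exact_mod_cast hc
    have h0 := S.beta_ne_zero s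
    have h1 : S.β s ^ S.exponent s ∈ S.stage (s + 1) := by
      have e : S.β s ^ S.exponent s = (c : Ω)⁻¹ * S.prod (s + 1) ^ S.exponent s := by
        rw [prod_succ, mul_pow, h, inv_mul_cancel_left₀ hc']
      rw [e]
      exact mul_mem (inv_mem (SubfieldClass.ratCast_mem _ c)) (pow_mem (mem_adjoin_simple_self _ _) _)
    have h2 : S.β s ^ p s.unpair.1 ∈ S.stage (s + 1) := by
      rw [S.pow_eq hs]
      exact mul_mem (ofNat_mem _ 2) (_root_.natCast_mem _ _)
    obtain ⟨a, b, hab⟩ := Nat.isCoprime_iff_coprime.2 (S.coprime_exponent_of_halts hs)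
    have e : S.β s = (S.β s ^ p s.unpair.1) ^ a * (S.β s ^ S.exponent s) ^ b := by
      rw [← zpow_natCast, ← zpow_natCast, ← zpow_mul, ← zpow_mul, ← zpow_add₀ h0, mul_comm _ a,
        mul_comm _ b, hab, zpow_one]
    rw [e]
    exact mul_mem (zpow_mem h2 a) (zpow_mem h1 b)
  · rw [S.eq_one hs]
    exact one_mem _

theorem prod_mem_stage_succ (s : ℕ) : S.prod s ∈ S.stage (s + 1) := by
  have e : S.prod s = S.prod (s + 1) * (S.β s)⁻¹ := by
    rw [prod_succ, mul_inv_cancel_right₀ (S.beta_ne_zero s)]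
  rw [e]
  exact mul_mem (mem_adjoin_simple_self _ _) (inv_mem (S.beta_mem_stage_succ s))

theorem monotone_stage : Monotone S.stage :=
  monotone_nat_of_le_succ fun s => adjoin_simple_le_iff.2 (S.prod_mem_stage_succ s)

/-- The field generated by all the radicals. -/
noncomputable def field : Subfield Ω := (⨆ s, S.stage s).toSubfield

theorem mem_field_iff {x : Ω} : x ∈ S.field ↔ ∃ s, x ∈ S.stage s := by
  have := IntermediateField.coe_iSup_of_directed S.monotone_stage.directed_le
  have h := Set.ext_iff.1 this x
  rw [Set.mem_iUnion] at h
  exact h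

theorem mem_adjoin_beta_of_mem_stage_succ {s : ℕ} {x : Ω} (hx : x ∈ S.stage (s + 1)) :
    x ∈ (S.stage s)⟮S.β s⟯ := by
  have : S.stage (s + 1) ≤ ((S.stage s)⟮S.β s⟯).restrictScalars ℚ := by
    refine adjoin_simple_le_iff.2 ?_
    rw [prod_succ]
    refine mul_mem ?_ (mem_adjoin_simple_self (S.stage s) (S.β s))
    exact ((S.stage s)⟮S.β s⟯).algebraMap_mem ⟨S.prod s, mem_adjoin_simple_self _ _⟩
  exact this hx

theorem mem_adjoin_of_mem_stage {F : IntermediateField ℚ Ω} {s : ℕ} {x : Ω}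
    (hF : ∀ t < s, HaltsAtStage t → S.β t ∈ F) (hx : x ∈ S.stage s) : x ∈ F := by
  have : S.stage s ≤ F := adjoin_simple_le_iff.2 (prod_mem fun t ht => by
    by_cases hts : HaltsAtStage t
    · exact hF t (Finset.mem_range.1 ht) hts
    · rw [S.eq_one hts]
      exact one_mem _)
  exact this hx

section Valuation

variable {Γ : Type*} [LinearOrderedCommGroupWithZero Γ] {w : Valuation Ω Γ}

theorem val_beta_pow (hw : w 2 < 1) {s : ℕ} (hs : HaltsAtStage s) :
    w (S.β s) ^ p s.unpair.1 = w 2 := by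
  rw [← map_pow, S.pow_eq hs, map_mul,
    Valuation.map_odd hw ((S.prime_q hs).odd_of_ne_two (S.two_lt_q hs).ne'), mul_one]

/-- The value of a nonzero element of the stage `s` is a rational multiple of that of `2`, with
denominator dividing the exponent of the stage. -/
def ValuesDivide (_S : RadicalSequence Ω p) (w : Valuation Ω Γ) (s : ℕ) : Prop :=
  ∀ x ∈ _S.stage s, x ≠ 0 → ∃ t : ℤ, w x ^ _S.exponent s = w 2 ^ t

variable {S}

/-- A value that is an `l`-th part of that of 2 would force `l` to divide the exponent of the stage.
-/
theorem ValuesDivide.forall_pow_ne {s : ℕ} (h : S.ValuesDivide w s) (hw : w 2 < 1) {l : ℕ}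
    (hl : l.Prime) (hcop : Nat.Coprime l (S.exponent s)) {x : Ω} (hx : x ∈ S.stage s) :
    w x ^ l ≠ w 2 := by
  intro e
  have hx0 : x ≠ 0 := by
    rintro rfl
    rw [map_zero, zero_pow hl.ne_zero] at e
    exact w.ne_zero_iff.2 two_ne_zero e.symm
  obtain ⟨t, ht⟩ := h x hx hx0
  have h1 : w 2 ^ ((S.exponent s : ℕ) : ℤ) = w 2 ^ (t * l) := by
    rw [zpow_mul, ← ht, zpow_natCast, zpow_natCast, ← pow_mul, mul_comm, pow_mul, e]
  have h2 := Valuation.zpow_two_injective hw h1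
  have h3 : l ∣ S.exponent s := by
    rw [← Int.natCast_dvd_natCast, h2]
    exact dvd_mul_left _ _
  exact hl.one_lt.ne' (Nat.dvd_one.1 (hcop ▸ Nat.dvd_gcd dvd_rfl h3))

theorem ValuesDivide.irreducible {s : ℕ} (h : S.ValuesDivide w s) (hw : w 2 < 1)
    (hs : HaltsAtStage s) :
    Irreducible (X ^ p s.unpair.1 - C ((2 * (S.q s : S.stage s) : S.stage s))) := by
  rw [X_pow_sub_C_irreducible_iff_of_prime (S.prime_p _)]
  intro b hb
  apply h.forall_pow_ne hw (S.prime_p s.unpair.1) (S.coprime_exponent_of_halts hs) b.2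
  have := congrArg (algebraMap (S.stage s) Ω) hb
  rw [map_pow, map_mul, map_natCast, map_ofNat] at this
  change (b : Ω) ^ p s.unpair.1 = 2 * (S.q s : Ω) at this
  rw [← map_pow, this, map_mul,
    Valuation.map_odd hw ((S.prime_q hs).odd_of_ne_two (S.two_lt_q hs).ne'), mul_one]

theorem aeval_beta {s : ℕ} (hs : HaltsAtStage s) :
    aeval (S.β s) (X ^ p s.unpair.1 - C ((2 * (S.q s : S.stage s) : S.stage s))) = 0 := by
  rw [map_sub, map_pow, aeval_X, aeval_C, map_mul, map_natCast, map_ofNat, S.pow_eq hs, sub_self]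

theorem exists_eq_sum {s : ℕ} [Algebra.IsAlgebraic ℚ Ω] (hs : HaltsAtStage s) {x : Ω}
    (hx : x ∈ S.stage (s + 1)) : ∃ c : ℕ → Ω, (∀ j, c j ∈ S.stage s) ∧
      x = ∑ j ∈ Finset.range (p s.unpair.1), c j * S.β s ^ j := by
  have : Algebra.IsAlgebraic (S.stage s) Ω := Algebra.IsAlgebraic.tower_top (K := ℚ) _
  have hmon := monic_X_pow_sub_C (2 * (S.q s : S.stage s) : S.stage s) (S.prime_p s.unpair.1).ne_zero
  have hx' := S.mem_adjoin_beta_of_mem_stage_succ hx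
  rw [← mem_toSubalgebra, adjoin_simple_toSubalgebra_of_isAlgebraic
    (Algebra.IsAlgebraic.isAlgebraic _), Algebra.adjoin_singleton_eq_range_aeval] at hx'
  obtain ⟨g, rfl⟩ := hx'
  let r := g %ₘ (X ^ p s.unpair.1 - C (2 * (S.q s : S.stage s) : S.stage s))
  have hr : aeval (S.β s) g = aeval (S.β s) r := by
    conv_lhs => rw [← modByMonic_add_div g (X ^ p s.unpair.1 - C (2 * (S.q s : S.stage s)))]
    rw [map_add, map_mul (aeval (S.β s)), aeval_beta hs, zero_mul, add_zero]
  have hdeg : r.natDegree < p s.unpair.1 := by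
    have := natDegree_modByMonic_lt g hmon (fun h => by
      have := congrArg natDegree h
      rw [natDegree_X_pow_sub_C, natDegree_one] at this
      exact (S.prime_p _).ne_zero this)
    rwa [natDegree_X_pow_sub_C] at this
  refine ⟨fun j => (r.coeff j : Ω), fun j => (r.coeff j).2, ?_⟩
  change aeval (S.β s) g = _
  rw [hr, aeval_eq_sum_range' hdeg]
  exact Finset.sum_congr rfl fun j _ => Algebra.smul_def _ _

/-- The powers of `β s` below `p` have values in different cosets of the value group of the stage,
because `p` is coprime to the exponent. -/
theorem ValuesDivide.term_injective {s : ℕ} (h : S.ValuesDivide w s) (hw : w 2 < 1)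
    (hs : HaltsAtStage s) {c : ℕ → Ω} (hc : ∀ j, c j ∈ S.stage s) :
    ∀ i ∈ Finset.range (p s.unpair.1), ∀ j ∈ Finset.range (p s.unpair.1),
      c i * S.β s ^ i ≠ 0 → w (c i * S.β s ^ i) = w (c j * S.β s ^ j) → i = j := by
  intro i hi j hj hne hij
  have hne' : c j * S.β s ^ j ≠ 0 := by
    rw [← w.ne_zero_iff, ← hij, w.ne_zero_iff]
    exact hne
  obtain ⟨a, ha⟩ := h _ (hc i) (left_ne_zero_of_mul hne)
  obtain ⟨b, hb⟩ := h _ (hc j) (left_ne_zero_of_mul hne')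
  have h2 : w 2 ≠ 0 := w.ne_zero_iff.2 two_ne_zero
  -- This power clears both denominators, so the exponents of `w 2` can be compared modulo `p`.
  have key : ∀ (i : ℕ) (a : ℤ), w (c i) ^ S.exponent s = w 2 ^ a →
      w (c i * S.β s ^ i) ^ (S.exponent s * p s.unpair.1) =
        w 2 ^ (a * p s.unpair.1 + i * S.exponent s) := by
    intro i a ha
    rw [map_mul, map_pow, mul_pow, pow_mul, ha, ← pow_mul,
      show i * (S.exponent s * p s.unpair.1) = p s.unpair.1 * (i * S.exponent s) by ring, pow_mul,
      S.val_beta_pow hw hs, zpow_add₀ h2, zpow_mul, zpow_natCast]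
    congr 1
    exact_mod_cast (zpow_natCast (w 2) (i * S.exponent s)).symm
  have e := Valuation.zpow_two_injective hw
    (((key i a ha).symm.trans (by rw [hij])).trans (key j b hb))
  have hdvd : (p s.unpair.1 : ℤ) ∣ ((i : ℤ) - j) * S.exponent s := ⟨b - a, by linear_combination e⟩
  have hdvd' : (p s.unpair.1 : ℤ) ∣ (i : ℤ) - j := IsCoprime.dvd_of_dvd_mul_right
    (Nat.isCoprime_iff_coprime.2 (S.coprime_exponent_of_halts hs)) hdvd
  have hi' := Finset.mem_range.1 hi
  have hj' := Finset.mem_range.1 hj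
  have := Int.eq_zero_of_abs_lt_dvd hdvd' (by rw [abs_lt]; omega)
  omega

/-- An element of the next stage has the value of one term `c j * β s ^ j`, so only the new
denominator `p` appears. -/
theorem valuesDivide (S : RadicalSequence Ω p) [Algebra.IsAlgebraic ℚ Ω] (hw : w 2 < 1) (s : ℕ) :
    S.ValuesDivide w s := by
  induction s with
  | zero =>
    intro x hx hx0
    rw [stage, prod, Finset.range_zero, Finset.prod_empty, adjoin_one, mem_bot] at hx
    obtain ⟨c, rfl⟩ := hx
    rw [eq_ratCast] at hx0 ⊢
    obtain ⟨t, ht, -⟩ := Valuation.exists_map_rat_eq hw (by simpa using hx0 : c ≠ 0)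
    exact ⟨t, by simpa [exponent] using ht⟩
  | succ s ih =>
    by_cases hs : HaltsAtStage s
    · intro x hx hx0
      obtain ⟨c, hc, rfl⟩ := exists_eq_sum hs hx
      have hne : ∃ j ∈ Finset.range (p s.unpair.1), c j * S.β s ^ j ≠ 0 := by
        by_contra! h
        exact hx0 (Finset.sum_eq_zero h)
      obtain ⟨j, hj, hj0, hval, -⟩ := w.exists_sum_eq_of_injOn _ _
        (ih.term_injective hw hs hc) hne
      obtain ⟨a, ha⟩ := ih _ (hc j) (left_ne_zero_of_mul hj0)
      refine ⟨a * p s.unpair.1 + j * S.exponent s, ?_⟩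
      rw [hval, S.exponent_succ_of_halts hs, map_mul, map_pow, mul_pow, pow_mul, ha, ← pow_mul,
        show j * (S.exponent s * p s.unpair.1) = p s.unpair.1 * (j * S.exponent s) by ring, pow_mul,
        S.val_beta_pow hw hs, zpow_add₀ (w.ne_zero_iff.2 two_ne_zero), zpow_mul, zpow_natCast]
      congr 1
      exact_mod_cast (zpow_natCast (w 2) (j * S.exponent s)).symm
    · rw [ValuesDivide, S.stage_succ_of_not_halts hs, S.exponent_succ_of_not_halts hs]
      exact ih

/-- No cancellation occurs in the expansion in powers of `β s`, so every term is as small as the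
sum. The `p`-th power of a term lies in the lower stage, since `β s ^ p` is rational, and induction
applies. With `TwoIntegral.map_le_one` this describes the valuation ring without reference to `w`.
-/
theorem twoIntegral_of_map_le_one [Algebra.IsAlgebraic ℚ Ω] (hw : w 2 < 1) {s : ℕ} {x : Ω}
    (hx : x ∈ S.stage s) (h1 : w x ≤ 1) : TwoIntegral x := by
  induction s generalizing x with
  | zero =>
    rw [stage, prod, Finset.range_zero, Finset.prod_empty, adjoin_one, mem_bot] at hx
    obtain ⟨c, rfl⟩ := hx
    rw [eq_ratCast, Valuation.map_rat_le_one_iff hw] at h1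
    refine ⟨c.den, h1, ?_⟩
    have e : (c.den : Ω) * algebraMap ℚ Ω c = algebraMap ℤ Ω c.num := by
      rw [eq_ratCast, eq_intCast]
      exact_mod_cast congrArg (Rat.cast : ℚ → Ω) (Rat.den_mul_eq_num c)
    rw [e]
    exact isIntegral_algebraMap
  | succ s ih =>
    by_cases hs : HaltsAtStage s
    · obtain ⟨c, hc, rfl⟩ := exists_eq_sum hs hx
      refine TwoIntegral.sum fun j hj => ?_
      rcases eq_or_ne (c j * S.β s ^ j) 0 with h0 | h0
      · rw [h0]
        exact TwoIntegral.zero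
      obtain ⟨i, -, -, hval, hmax⟩ := w.exists_sum_eq_of_injOn _ _
        ((S.valuesDivide hw s).term_injective hw hs hc) ⟨j, hj, h0⟩
      have hle : w (c j * S.β s ^ j) ≤ 1 := (hmax j hj).trans (hval ▸ h1)
      refine TwoIntegral.of_pow (S.prime_p s.unpair.1).pos (ih ?_ ?_)
      · rw [mul_pow, ← pow_mul, mul_comm j, pow_mul, S.pow_eq hs]
        exact mul_mem (pow_mem (hc j) _) (pow_mem (mul_mem (ofNat_mem _ 2) (_root_.natCast_mem _ _)) _)
      · rw [map_pow]
        exact pow_le_one₀ zero_le hle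
    · rw [S.stage_succ_of_not_halts hs] at hx
      exact ih hx h1

end Valuation

/-- The degree of `β s` over the stage is prime, so there is no field strictly between: an element
of `F` outside the stage would generate everything and bring `β s` into `F`. The degree is read off
from an auxiliary valuation above 2. -/
theorem mem_stage_of_mem_stage_succ [Algebra.IsAlgebraic ℚ Ω] {s : ℕ} (hs : HaltsAtStage s)
    {F : IntermediateField ℚ Ω} (hF : S.stage s ≤ F) (hβ : S.β s ∉ F) {x : Ω} (hxF : x ∈ F)
    (hx : x ∈ S.stage (s + 1)) : x ∈ S.stage s := by
  have : Algebra.IsAlgebraic (S.stage s) Ω := Algebra.IsAlgebraic.tower_top (K := ℚ) _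
  obtain ⟨A, hA⟩ := exists_valuationSubring_two Ω
  have hirr := (S.valuesDivide hA s).irreducible hA hs
  have hfin : ∀ y : Ω, FiniteDimensional (S.stage s) (S.stage s)⟮y⟯ := fun y =>
    adjoin.finiteDimensional (Algebra.IsIntegral.isIntegral y)
  have hrank : Module.finrank (S.stage s) (S.stage s)⟮S.β s⟯ = p s.unpair.1 := by
    rw [adjoin.finrank (Algebra.IsIntegral.isIntegral _),
      ← minpoly.eq_of_irreducible_of_monic hirr (aeval_beta hs)
        (monic_X_pow_sub_C _ (S.prime_p _).ne_zero), natDegree_X_pow_sub_C]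
  have hle : (S.stage s)⟮x⟯ ≤ (S.stage s)⟮S.β s⟯ :=
    adjoin_simple_le_iff.2 (S.mem_adjoin_beta_of_mem_stage_succ hx)
  have hdvd := finrank_dvd_of_le_right hle
  rw [hrank] at hdvd
  rcases (Nat.dvd_prime (S.prime_p _)).1 hdvd with h | h
  · rw [IntermediateField.finrank_eq_one_iff, adjoin_simple_eq_bot_iff, mem_bot] at h
    obtain ⟨y, rfl⟩ := h
    exact y.2
  · exfalso
    have e := eq_of_le_of_finrank_eq hle (h.trans hrank.symm)
    have hle' : (S.stage s)⟮x⟯ ≤ extendScalars hF := adjoin_simple_le_iff.2 hxF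
    exact hβ (hle' (e ▸ mem_adjoin_simple_self (S.stage s) (S.β s)))

end RadicalSequence

end Radicals

/-! ### Choosing the radicals and deciding the field -/

section Construction

open IntermediateField

variable {Ω : Type} [Field Ω] [CharZero Ω] [Numbered Ω] [ComputableTower Ω]

/-- The condition on the next pair `y = (q, β)` of a radical sequence with previous terms `l`:
at a halting stage, `β` has to avoid an initial part of the tower exhausting `Ω`. -/
def RadicalStep (p : ℕ → ℕ) (l : List (ℕ × Ω)) (y : ℕ × Ω) : Prop :=
  (∀ e ∈ l, e.1 < y.1) ∧ ((¬ HaltsAtStage l.length ∧ y.2 = 1) ∨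
    (HaltsAtStage l.length ∧ y.1.Prime ∧ 2 < y.1 ∧
      y.2 ^ p l.length.unpair.1 = 2 * (y.1 : Ω) ∧
      ∃ N, l.length ≤ N ∧ (l.map Prod.snd).prod ∈ ℚ⟮(ComputableTower.gen N : Ω)⟯ ∧
        y.2 ∉ ℚ⟮(ComputableTower.gen N : Ω)⟯))

theorem prod_map_prevList {Y M : Type} [CommMonoid M] (y : ℕ → Y) (f : Y → M) (n : ℕ) :
    ((prevList y n).map f).prod = ∏ t ∈ Finset.range n, f (y t) := by
  induction n with
  | zero => rfl
  | succ n ih =>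
    rw [prevList_succ, List.map_cons, List.prod_cons, ih, Finset.prod_range_succ, mul_comm]

namespace RadicalSequence

variable {p : ℕ → ℕ}

theorem comp_prod {S : RadicalSequence Ω p} (hS : Comp S.β) : Comp S.prod := by
  have : Comp fun n => ((prevList S.β n).map fun x => x).prod :=
    Comp.list_prod (Comp.map (Comp.prevList hS) (by fun_prop))
  simp only [prod_map_prevList] at this
  exact this

/-- Every new radical of the sequence avoids a large initial part of the tower exhausting `Ω`. -/
def Separated (S : RadicalSequence Ω p) : Prop :=
  ∀ s, HaltsAtStage s → ∃ N, s ≤ N ∧ S.prod s ∈ ℚ⟮(ComputableTower.gen N : Ω)⟯ ∧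
    S.β s ∉ ℚ⟮(ComputableTower.gen N : Ω)⟯

theorem re_mem_field [Algebra.IsAlgebraic ℚ Ω] {S : RadicalSequence Ω p} (hS : Comp S.β) :
    RE fun x : Ω => x ∈ S.field := by
  have h := comp_prod hS
  simp only [mem_field_iff]
  exact RE.ex (RE.mem_adjoin (by fun_prop) (by fun_prop))

/-- Descent on the stage `t` containing `x`: for `t ≥ s` the field `ℚ⟮gen N⟯` avoided by `β t`
contains both `x` and stage `t`, so `x` did not need `β t`. -/
theorem Separated.mem_stage [Algebra.IsAlgebraic ℚ Ω] {S : RadicalSequence Ω p}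
    (hS : S.Separated) {s : ℕ} {x : Ω} (hx : x ∈ S.field)
    (hxs : x ∈ ℚ⟮(ComputableTower.gen s : Ω)⟯) : x ∈ S.stage s := by
  obtain ⟨t, ht⟩ := S.mem_field_iff.1 hx
  induction t with
  | zero => exact S.monotone_stage (Nat.zero_le _) ht
  | succ t ih =>
    rcases le_or_gt (t + 1) s with h | h
    · exact S.monotone_stage h ht
    by_cases hs : HaltsAtStage t
    · obtain ⟨N, hN, hprod, hβ⟩ := hS t hs
      exact ih (S.mem_stage_of_mem_stage_succ hs (adjoin_simple_le_iff.2 hprod) hβ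
        (ComputableTower.monotone_adjoin (by omega) hxs) ht)
    · rw [S.stage_succ_of_not_halts hs] at ht
      exact ih ht

end RadicalSequence

variable [Algebra.IsAlgebraic ℚ Ω] [IsAlgClosed Ω]

theorem re_radicalStep {p : ℕ → ℕ} (hp : Computable p) :
    RE fun z : List (ℕ × Ω) × (ℕ × Ω) => RadicalStep p z.1 z.2 := by
  have hp' := Comp.of_computable hp
  have hu := Comp.nat_unpair
  exact RE.and (RE.ball_mem (by fun_prop) (RE.nat_lt (by fun_prop) (by fun_prop)))
    (RE.or (RE.and (RE.not_haltsAtStage (by fun_prop)) (RE.eq (by fun_prop) (by fun_prop)))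
    (RE.and (RE.haltsAtStage (by fun_prop)) (RE.and (RE.prime (by fun_prop)) (RE.and
      (RE.nat_lt (by fun_prop) (by fun_prop)) (RE.and (RE.eq (by fun_prop) (by fun_prop))
      (RE.ex (RE.and (RE.nat_le (by fun_prop) (by fun_prop)) (RE.and
        (RE.mem_adjoin (Comp.list_prod (Comp.map (by fun_prop) (by fun_prop))) (by fun_prop))
        (RE.not_mem_adjoin (by fun_prop) (by fun_prop))))))))))

/-- Fix first a member of the tower containing the previous product, then take `q` beyond its
ramification bound and beyond all previous terms; any root of `2 * q` then avoids that member. -/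
theorem exists_radicalStep {p : ℕ → ℕ} (hp : ∀ i, (p i).Prime) (l : List (ℕ × Ω)) :
    ∃ y, RadicalStep p l y := by
  have hle : ∀ e ∈ l, e.1 ≤ (l.map Prod.fst).sum := fun e he =>
    List.single_le_sum (fun _ _ => Nat.zero_le _) _ (List.mem_map_of_mem he)
  by_cases hs : HaltsAtStage l.length
  · obtain ⟨N, hN, hmem, -⟩ := exists_common_mem_adjoin_gen (l.map Prod.snd).prod 0 l.length
    have : FiniteDimensional ℚ ℚ⟮(ComputableTower.gen N : Ω)⟯ :=
      adjoin.finiteDimensional (Algebra.IsIntegral.isIntegral _)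
    have : NumberField ℚ⟮(ComputableTower.gen N : Ω)⟯ :=
      { to_finiteDimensional := by convert this }
    obtain ⟨D, hD⟩ := NumberField.exists_forall_pow_ne ℚ⟮(ComputableTower.gen N : Ω)⟯
      (hp l.length.unpair.1).two_le
    obtain ⟨q, hq, hqp⟩ := Nat.exists_infinite_primes (D + (l.map Prod.fst).sum + 3)
    obtain ⟨b, hb⟩ := IsAlgClosed.exists_pow_nat_eq (2 * (q : Ω)) (hp l.length.unpair.1).pos
    refine ⟨(q, b), fun e he => ?_, Or.inr ⟨hs, hqp, show 2 < q by omega, hb, N, hN, hmem,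
      fun h => ?_⟩⟩
    · have := hle e he
      change e.1 < q
      omega
    · refine hD q hqp (by omega) ⟨b, h⟩ (Subtype.ext ?_)
      exact hb
  · exact ⟨((l.map Prod.fst).sum + 1, 1), fun e he => Nat.lt_succ_of_le (hle e he),
      Or.inl ⟨hs, rfl⟩⟩

theorem exists_radicalSequence {p : ℕ → ℕ} (hp : Computable p) (hprime : ∀ i, (p i).Prime)
    (hinj : Function.Injective p) :
    ∃ S : RadicalSequence Ω p, Comp S.β ∧ S.Separated := by
  obtain ⟨y, hy, h⟩ := (re_radicalStep (Ω := Ω) hp).exists_seq (fun _ => True) trivial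
    (fun l _ => exists_radicalStep hprime l) fun _ _ _ _ => trivial
  have h' := fun n => (h n).2
  simp only [RadicalStep, length_prevList, prod_map_prevList] at h'
  let S : RadicalSequence Ω p :=
    { prime_p := hprime
      injective_p := hinj
      q := fun s => (y s).1
      β := fun s => (y s).2
      strictMono_q := strictMono_nat_of_lt_succ fun n =>
        (h' (n + 1)).1 _ (by rw [prevList_succ]; exact List.mem_cons_self)
      prime_q := fun {s} hs => ((h' s).2.resolve_left fun h => h.1 hs).2.1
      two_lt_q := fun {s} hs => ((h' s).2.resolve_left fun h => h.1 hs).2.2.1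
      eq_one := fun {s} hs => ((h' s).2.resolve_right fun h => hs h.1).2
      pow_eq := fun {s} hs => ((h' s).2.resolve_left fun h => h.1 hs).2.2.2.1 }
  exact ⟨S, Comp.snd.comp hy, fun s hs => ((h' s).2.resolve_left fun h => h.1 hs).2.2.2.2⟩

namespace RadicalSequence

variable {p : ℕ → ℕ} {S : RadicalSequence Ω p}

/-- Once `x` is located in `ℚ⟮gen s⟯`, membership in `K` is settled at stage `s`. -/
theorem re_not_mem_field (hS : Comp S.β) (hsep : S.Separated) : RE fun x : Ω => x ∉ S.field := by
  have h := comp_prod hS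
  have : RE fun x : Ω => ∃ s : ℕ, x ∈ ℚ⟮(ComputableTower.gen s : Ω)⟯ ∧ x ∉ ℚ⟮S.prod s⟯ :=
    RE.ex (RE.and (RE.mem_adjoin (by fun_prop) (by fun_prop))
      (RE.not_mem_adjoin (by fun_prop) (by fun_prop)))
  refine this.of_iff fun x => ⟨fun hx => ?_, ?_⟩
  · obtain ⟨s, hs⟩ := ComputableTower.exists_mem x
    exact ⟨s, hs, fun h => hx (S.mem_field_iff.2 ⟨s, h⟩)⟩
  · rintro ⟨s, hs, hn⟩ hx
    exact hn (hsep.mem_stage hx hs)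

end RadicalSequence

end Construction

/-! ### From numberings to presentations -/

theorem RE.rePred_of_num_encode {X : Type} [Primcodable X] [Numbered X]
    (h : ∀ x : X, num (Encodable.encode x) = x) {P : X → Prop} (hP : RE P) : REPred P := by
  have h1 : REPred fun n : ℕ => P (num n) := RE.rePred (hP.comp ⟨id, Computable.id, fun _ => rfl⟩)
  refine (Partrec.comp h1 Computable.encode).of_eq fun x => ?_
  beta_reduce
  rw [h]

theorem RE.computablePred {X : Type} [Primcodable X] [Numbered X]
    (h : ∀ x : X, num (Encodable.encode x) = x) {P : X → Prop} (hP : RE P)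
    (hP' : RE fun x => ¬ P x) : ComputablePred P :=
  ComputablePred.computable_iff_re_compl_re'.2
    ⟨hP.rePred_of_num_encode h, hP'.rePred_of_num_encode h⟩

theorem num_encode_nat_prod (x : ℕ × ℕ) : num (Encodable.encode x) = x :=
  num_pair x.1 x.2

theorem num_encode_nat_list (l : List ℕ) : num (Encodable.encode l) = l :=
  (num_encode l).trans (List.map_id l)

section LeastCode

variable {Ω : Type} [Numbered Ω]

open Classical in
/-- The least number of an element. -/
noncomputable def leastCode (x : Ω) : ℕ := Nat.find (num_surjective x)

theorem num_leastCode (x : Ω) : num (leastCode x) = x := by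
  classical
  exact Nat.find_spec (num_surjective x)

theorem eq_leastCode_iff (x : Ω) (n : ℕ) :
    n = leastCode x ↔ num n = x ∧ ∀ m < n, (num m : Ω) ≠ x := by
  classical
  rw [eq_comm]
  exact Nat.find_eq_iff _

theorem leastCode_injective : Function.Injective (leastCode : Ω → ℕ) :=
  Function.LeftInverse.injective num_leastCode

theorem mem_range_leastCode_iff [Field Ω] {K : Type} [Field K] (φ : K →+* Ω) (n : ℕ) :
    n ∈ Set.range (fun x => leastCode (φ x)) ↔
      (num n : Ω) ∈ φ.fieldRange ∧ n = leastCode (num n : Ω) := by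
  constructor
  · rintro ⟨x, rfl⟩
    simp only [num_leastCode]
    exact ⟨⟨x, rfl⟩, trivial⟩
  · rintro ⟨⟨x, hx⟩, hn⟩
    exact ⟨x, by simp only [hx]; exact hn.symm⟩

variable [Field Ω] [CRing Ω]

-- A presentation requires injective codes. Equality being decidable, the least number of an element
-- can be found.
@[fun_prop]
theorem comp_leastCode : Comp (leastCode : Ω → ℕ) := by
  refine Comp.of_graph ?_
  simp only [eq_leastCode_iff]
  exact RE.and (RE.eq (Comp.num (by fun_prop)) (by fun_prop))
    (RE.ball_lt (by fun_prop) (RE.ne (Comp.num (by fun_prop)) (by fun_prop)))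

variable {K : Type} [Field K] (φ : K →+* Ω)

theorem re_mem_range_leastCode (h : RE fun x : Ω => x ∈ φ.fieldRange) :
    RE fun n : ℕ => n ∈ Set.range (fun x => leastCode (φ x)) := by
  simp only [mem_range_leastCode_iff]
  exact RE.and (h.comp (Comp.num (by fun_prop)))
    (RE.nat_eq (by fun_prop) (comp_leastCode.comp (Comp.num (by fun_prop))))

theorem re_not_mem_range_leastCode (h : RE fun x : Ω => x ∉ φ.fieldRange) :
    RE fun n : ℕ => n ∉ Set.range (fun x => leastCode (φ x)) := by
  simp only [mem_range_leastCode_iff, not_and_or]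
  exact RE.or (h.comp (Comp.num (by fun_prop)))
    (RE.nat_ne (by fun_prop) (comp_leastCode.comp (Comp.num (by fun_prop))))

/-- The presentation of a decidable subfield of a numbered field. -/
noncomputable def presentation (h : RE fun x : Ω => x ∈ φ.fieldRange)
    (h' : RE fun x : Ω => x ∉ φ.fieldRange) : ComputablePresentation K where
  code x := leastCode (φ x)
  code_injective := leastCode_injective.comp φ.injective
  computable_domain := RE.computablePred (fun _ => rfl) (re_mem_range_leastCode φ h)
    (re_not_mem_range_leastCode φ h')
  computable_add := by
    have : Comp fun p : ℕ × ℕ => leastCode ((num p.1 : Ω) + num p.2) :=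
      comp_leastCode.comp (Comp.add (Comp.num (by fun_prop)) (Comp.num (by fun_prop)))
    obtain ⟨F, hF, hF'⟩ := this
    refine ⟨fun a b => F (Nat.pair a b), hF.comp Primrec₂.natPair.to_comp, fun a b => ?_⟩
    have := hF' (Nat.pair (leastCode (φ a)) (leastCode (φ b)))
    rw [num_pair] at this
    simpa [num_leastCode, num_nat] using this
  computable_mul := by
    have : Comp fun p : ℕ × ℕ => leastCode ((num p.1 : Ω) * num p.2) :=
      comp_leastCode.comp (Comp.mul (Comp.num (by fun_prop)) (Comp.num (by fun_prop)))
    obtain ⟨F, hF, hF'⟩ := this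
    refine ⟨fun a b => F (Nat.pair a b), hF.comp Primrec₂.natPair.to_comp, fun a b => ?_⟩
    have := hF' (Nat.pair (leastCode (φ a)) (leastCode (φ b)))
    rw [num_pair] at this
    simpa [num_leastCode, num_nat] using this

end LeastCode

/-! ### Computability of the valuation -/

section ComputableValuation

variable {Ω : Type} [Field Ω] [CharZero Ω]

theorem isIntegral_iff_exists_monicOfList {x : Ω} :
    IsIntegral ℤ x ↔ ∃ l, aeval x (monicOfList l) = 0 := by
  have e : (algebraMap ℚ Ω).comp (Int.castRingHom ℚ) = algebraMap ℤ Ω := RingHom.ext_int _ _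
  constructor
  · rintro ⟨M, hM, h⟩
    obtain ⟨l, -, hl⟩ := exists_monicOfList_eq hM
    refine ⟨l, ?_⟩
    rw [← hl, aeval_def, eval₂_map, e]
    exact h
  · rintro ⟨l, hl⟩
    obtain ⟨M, hM, -, hmon⟩ := lifts_and_natDegree_eq_and_monic (monicOfList_mem_lifts l)
      (monic_monicOfList l)
    refine ⟨M, hmon, ?_⟩
    rw [← hM, aeval_def, eval₂_map, e] at hl
    exact hl

theorem RE.twoIntegral [Numbered Ω] [CRing Ω] {Y : Type} [Numbered Y] {x : Y → Ω} (hx : Comp x) :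
    RE fun z => TwoIntegral (x z) := by
  have h := comp_monicOfList
  have : RE fun z => ∃ (k : ℕ) (l : List (ℕ × ℕ)),
      aeval (((2 * k + 1 : ℕ) : Ω) * x z) (monicOfList l) = 0 :=
    RE.ex (RE.ex (RE.eq (by fun_prop) (by fun_prop)))
  refine this.of_iff fun z => ?_
  simp only [TwoIntegral, isIntegral_iff_exists_monicOfList]
  constructor
  · rintro ⟨d, ⟨k, rfl⟩, h⟩
    exact ⟨k, h⟩
  · rintro ⟨k, h⟩
    exact ⟨2 * k + 1, ⟨k, rfl⟩, h⟩

namespace RadicalSequence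

variable {p : ℕ → ℕ} (S : RadicalSequence Ω p) [Algebra.IsAlgebraic ℚ Ω]
  {Γ : Type*} [LinearOrderedCommGroupWithZero Γ] {w : Valuation Ω Γ}

theorem map_le_one_iff (hw : w 2 < 1) {x : Ω} (hx : x ∈ S.field) : w x ≤ 1 ↔ TwoIntegral x := by
  obtain ⟨s, hs⟩ := S.mem_field_iff.1 hx
  exact ⟨twoIntegral_of_map_le_one hw hs, TwoIntegral.map_le_one hw⟩

/-- Rank one supplies a power of `x` divisible by 2. This positive certificate makes the complement
of the relation `v b ≤ v a` semidecidable. -/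
theorem map_lt_one_iff (hw : w 2 < 1) {x : Ω} (hx : x ∈ S.field) :
    w x < 1 ↔ ∃ k : ℕ, TwoIntegral (x ^ k * 2⁻¹) := by
  have h2 : w 2 ≠ 0 := w.ne_zero_iff.2 two_ne_zero
  have key : ∀ k : ℕ, TwoIntegral (x ^ k * 2⁻¹) ↔ w x ^ k ≤ w 2 := fun k => by
    rw [← S.map_le_one_iff hw (mul_mem (pow_mem hx k) (inv_mem (ofNat_mem _ 2))), map_mul, map_pow,
      map_inv₀, ← div_eq_mul_inv, div_le_one₀ (zero_lt_iff.2 h2)]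
  simp only [key]
  constructor
  · exact Valuation.exists_pow_le_two hw
  · rintro ⟨k, hk⟩
    by_contra! h
    exact absurd ((one_le_pow₀ h).trans hk) (not_le.2 hw)

theorem map_le_map_iff (hw : w 2 < 1) {a b : Ω} (ha : a ∈ S.field) (hb : b ∈ S.field) :
    w b ≤ w a ↔ b = 0 ∨ a ≠ 0 ∧ TwoIntegral (b * a⁻¹) := by
  rcases eq_or_ne a 0 with rfl | ha0
  · simp
  rw [← S.map_le_one_iff hw (mul_mem hb (inv_mem ha)), map_mul, map_inv₀, ← div_eq_mul_inv,
    div_le_one₀ (zero_lt_iff.2 (w.ne_zero_iff.2 ha0))]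
  constructor
  · exact fun h => Or.inr ⟨ha0, h⟩
  · rintro (rfl | h)
    · simp
    · exact h.2

theorem map_lt_map_iff (hw : w 2 < 1) {a b : Ω} (ha : a ∈ S.field) (hb : b ∈ S.field) :
    w a < w b ↔ b ≠ 0 ∧ ∃ k : ℕ, TwoIntegral ((a * b⁻¹) ^ k * 2⁻¹) := by
  rcases eq_or_ne b 0 with rfl | hb0
  · simp
  rw [← S.map_lt_one_iff hw (mul_mem ha (inv_mem hb)), map_mul, map_inv₀, ← div_eq_mul_inv,
    div_lt_one₀ (zero_lt_iff.2 (w.ne_zero_iff.2 hb0))]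
  exact ⟨fun h => ⟨hb0, h⟩, fun h => h.2⟩

variable {S} [Numbered Ω] [ComputableTower Ω] [IsAlgClosed Ω]

/-- The presentation of the field generated by the radicals. -/
noncomputable def fieldPresentation (hS : Comp S.β) (hsep : S.Separated) :
    ComputablePresentation S.field :=
  presentation S.field.subtype
    (by simpa only [Subfield.fieldRange_subtype] using re_mem_field hS)
    (by simpa only [Subfield.fieldRange_subtype] using re_not_mem_field hS hsep)

theorem re_mem_code (hS : Comp S.β) (hsep : S.Separated) {Y : Type} [Numbered Y] {f : Y → ℕ}
    (hf : Comp f) : RE fun y => f y ∈ Set.range (fieldPresentation hS hsep).code :=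
  (re_mem_range_leastCode S.field.subtype
    (by simpa only [Subfield.fieldRange_subtype] using re_mem_field hS)).comp hf

theorem re_not_mem_code (hS : Comp S.β) (hsep : S.Separated) {Y : Type} [Numbered Y] {f : Y → ℕ}
    (hf : Comp f) : RE fun y => f y ∉ Set.range (fieldPresentation hS hsep).code :=
  (re_not_mem_range_leastCode S.field.subtype
    (by simpa only [Subfield.fieldRange_subtype] using re_not_mem_field hS hsep)).comp hf

theorem num_code (hS : Comp S.β) (hsep : S.Separated) (x : S.field) :
    num ((fieldPresentation hS hsep).code x) = (x : Ω) := num_leastCode _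

theorem computableValuation (hS : Comp S.β) (hsep : S.Separated) (hw : w 2 < 1) {Δ : Type}
    [LinearOrderedCommGroupWithZero Δ] {v : Valuation S.field Δ}
    (hv : v.IsEquiv (w.comap S.field.subtype)) :
    (fieldPresentation hS hsep).ComputableValuation v := by
  have h1 : RE fun x : ℕ × ℕ => (x.1 ∈ Set.range (fieldPresentation hS hsep).code ∧
      x.2 ∈ Set.range (fieldPresentation hS hsep).code) ∧
      ((num x.2 : Ω) = 0 ∨ (num x.1 : Ω) ≠ 0 ∧ TwoIntegral ((num x.2 : Ω) * (num x.1 : Ω)⁻¹)) :=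
    RE.and (RE.and (re_mem_code hS hsep (by fun_prop)) (re_mem_code hS hsep (by fun_prop)))
      (RE.or (RE.eq (Comp.num (by fun_prop)) (by fun_prop)) (RE.and
        (RE.ne (Comp.num (by fun_prop)) (by fun_prop)) (RE.twoIntegral
          (Comp.mul (Comp.num (by fun_prop)) (Comp.inv (Comp.num (by fun_prop)))))))
  have h2 : RE fun x : ℕ × ℕ => (x.1 ∉ Set.range (fieldPresentation hS hsep).code ∨
      x.2 ∉ Set.range (fieldPresentation hS hsep).code) ∨
      ((x.1 ∈ Set.range (fieldPresentation hS hsep).code ∧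
      x.2 ∈ Set.range (fieldPresentation hS hsep).code) ∧
      ((num x.2 : Ω) ≠ 0 ∧ ∃ k : ℕ,
        TwoIntegral (((num x.1 : Ω) * (num x.2 : Ω)⁻¹) ^ k * 2⁻¹))) := by
    refine RE.or (RE.or (re_not_mem_code hS hsep (by fun_prop))
      (re_not_mem_code hS hsep (by fun_prop)))
      (RE.and (RE.and (re_mem_code hS hsep (by fun_prop)) (re_mem_code hS hsep (by fun_prop)))
      (RE.and (RE.ne (Comp.num (by fun_prop)) (by fun_prop)) (RE.ex (RE.twoIntegral ?_))))
    exact Comp.mul (Comp.pow (Comp.mul (Comp.num (by fun_prop))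
      (Comp.inv (Comp.num (by fun_prop)))) (by fun_prop)) (by fun_prop)
  have hle : ∀ a b : S.field, v b ≤ v a ↔ w (b : Ω) ≤ w (a : Ω) := fun a b => hv b a
  refine RE.computablePred num_encode_nat_prod (h1.of_iff ?_) (h2.of_iff ?_)
  · rintro ⟨m, n⟩
    constructor
    · rintro ⟨a, b, rfl, rfl, h⟩
      refine ⟨⟨⟨a, rfl⟩, ⟨b, rfl⟩⟩, ?_⟩
      rw [num_code, num_code]
      exact (S.map_le_map_iff hw a.2 b.2).1 ((hle a b).1 h)
    · rintro ⟨⟨⟨a, rfl⟩, ⟨b, rfl⟩⟩, h⟩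
      rw [num_code, num_code] at h
      exact ⟨a, b, rfl, rfl, (hle a b).2 ((S.map_le_map_iff hw a.2 b.2).2 h)⟩
  · rintro ⟨m, n⟩
    by_cases hm : m ∈ Set.range (fieldPresentation hS hsep).code
    · by_cases hn : n ∈ Set.range (fieldPresentation hS hsep).code
      · obtain ⟨a, rfl⟩ := hm
        obtain ⟨b, rfl⟩ := hn
        simp only [Set.mem_range_self, not_true, or_self, false_or, true_and, and_true, num_code]
        rw [← S.map_lt_map_iff hw a.2 b.2, ← not_le, ← hle, not_iff_not]
        constructor
        · rintro ⟨a', b', ha, hb, h⟩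
          rwa [← (fieldPresentation hS hsep).code_injective ha,
            ← (fieldPresentation hS hsep).code_injective hb]
        · exact fun h => ⟨a, b, rfl, rfl, h⟩
      · refine iff_of_true ?_ (Or.inl (Or.inr hn))
        rintro ⟨a, b, -, hb, -⟩
        exact hn ⟨b, hb⟩
    · refine iff_of_true ?_ (Or.inl (Or.inl hm))
      rintro ⟨a, b, ha, -⟩
      exact hm ⟨a, ha⟩

end RadicalSequence

end ComputableValuation

/-! ### The splitting algorithm -/

section Splitting

open ComputablePresentation

@[fun_prop]
theorem comp_sublists {X : Type} [Numbered X] : Comp (List.sublists' : List X → List (List X)) := by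
  have : Comp fun l : List X =>
      l.foldr (fun a (s : List (List X)) => s ++ s.map fun t => a :: t) [[]] :=
    Comp.foldr (h := fun _ a s => s ++ s.map fun t => a :: t) (by fun_prop) (by fun_prop)
      (Comp.append (by fun_prop) (Comp.map (X := List X × X × List (List X))
        (h := fun z t => z.2.1 :: t) (by fun_prop) (by fun_prop)))
  convert this with l
  induction l with
  | nil => rfl
  | cons a l ih => rw [List.foldr_cons, ← ih, List.sublists'_cons]

variable {Ω : Type} [Field Ω] (K : Subfield Ω)

/-- The monic polynomial with a given list of roots. -/
noncomputable def rootsPoly (l : List Ω) : Polynomial Ω := (l.map fun a => X - C a).prod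

theorem natDegree_rootsPoly (l : List Ω) : (rootsPoly l).natDegree = l.length := by
  have := natDegree_multiset_prod_X_sub_C_eq_card (l : Multiset Ω)
  rw [rootsPoly]
  simpa using this

theorem monic_rootsPoly (l : List Ω) : (rootsPoly l).Monic := by
  have := monic_multiset_prod_of_monic (l : Multiset Ω) (fun a => X - C a)
    fun a _ => monic_X_sub_C a
  rw [rootsPoly]
  simpa using this

theorem roots_rootsPoly (l : List Ω) : (rootsPoly l).roots = l := by
  have := roots_multiset_prod_X_sub_C (l : Multiset Ω)
  rw [rootsPoly]
  simpa using this

theorem exists_eq_C_mul_rootsPoly [IsAlgClosed Ω] (f : Polynomial Ω) :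
    ∃ l : List Ω, (l : Multiset Ω) = f.roots ∧ f = C f.leadingCoeff * rootsPoly l := by
  refine ⟨f.roots.toList, Multiset.coe_toList _, ?_⟩
  conv_lhs => rw [(IsAlgClosed.splits f).eq_prod_roots]
  congr 1
  conv_lhs => rw [← Multiset.coe_toList f.roots]
  rw [Multiset.map_coe, Multiset.prod_coe]
  rfl

theorem polyOfList_map_coe (m : List K) :
    polyOfList (m.map K.subtype) = (polyOfList m).map K.subtype := by
  induction m with
  | nil => simp [polyOfList_nil]
  | cons a m ih =>
    rw [List.map_cons, polyOfList_cons, ih, polyOfList_cons, Polynomial.map_add,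
      Polynomial.map_mul, map_C, map_X]

theorem natDegree_pos_iff_exists_coeff {f : Polynomial Ω} :
    0 < f.natDegree ↔ ∃ k, f.coeff (k + 1) ≠ 0 := by
  constructor
  · intro h
    refine ⟨f.natDegree - 1, ?_⟩
    rw [Nat.sub_add_cancel h]
    exact fun h0 => h.ne' (by rw [leadingCoeff_eq_zero.1 h0, natDegree_zero])
  · rintro ⟨k, hk⟩
    exact (Nat.succ_pos k).trans_le (le_natDegree_of_ne_zero hk)

/-- The list `l` of elements of `K` is the list of coefficients of a reducible polynomial
over `K`. -/
def ReducibleList (l : List Ω) : Prop :=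
  ∃ g h : List Ω, (∀ x ∈ g, x ∈ K) ∧ (∀ x ∈ h, x ∈ K) ∧ (∃ k, (polyOfList g).coeff (k + 1) ≠ 0) ∧
    (∃ k, (polyOfList h).coeff (k + 1) ≠ 0) ∧ polyOfList l = polyOfList g * polyOfList h

/-- The polynomial with coefficients `l` is constant, or no nontrivial part of its linear factors
has a product over `K`. -/
def IrreducibleList (l : List Ω) : Prop :=
  (∃ c, polyOfList l = C c) ∨ ∃ (c : Ω) (r : List Ω), c ≠ 0 ∧ polyOfList l = C c * rootsPoly r ∧
    ∀ t ∈ r.sublists', t.length = 0 ∨ t.length = r.length ∨ ∃ k, (rootsPoly t).coeff k ∉ K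

theorem reduciblePoly_iff (m : List K) :
    ReduciblePoly (polyOfList m) ↔ ReducibleList K (m.map K.subtype) := by
  simp only [ReducibleList, ← natDegree_pos_iff_exists_coeff]
  constructor
  · rintro ⟨g, h, hg, hh, e⟩
    obtain ⟨g, rfl⟩ := polyOfList_surjective g
    obtain ⟨h, rfl⟩ := polyOfList_surjective h
    refine ⟨g.map K.subtype, h.map K.subtype, ?_, ?_, ?_, ?_, ?_⟩
    · simp +contextual
    · simp +contextual
    · rwa [polyOfList_map_coe, natDegree_map]
    · rwa [polyOfList_map_coe, natDegree_map]
    · rw [polyOfList_map_coe, polyOfList_map_coe, polyOfList_map_coe, e, Polynomial.map_mul]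
  · rintro ⟨g, h, hg, hh, hg', hh', e⟩
    obtain ⟨g, rfl⟩ : ∃ g' : List K, g'.map K.subtype = g := by
      rw [← Set.mem_range, Set.range_list_map]
      exact fun x hx => ⟨⟨x, hg x hx⟩, rfl⟩
    obtain ⟨h, rfl⟩ : ∃ h' : List K, h'.map K.subtype = h := by
      rw [← Set.mem_range, Set.range_list_map]
      exact fun x hx => ⟨⟨x, hh x hx⟩, rfl⟩
    rw [polyOfList_map_coe, natDegree_map] at hg' hh'
    rw [polyOfList_map_coe, polyOfList_map_coe, polyOfList_map_coe, ← Polynomial.map_mul] at e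
    exact ⟨_, _, hg', hh', map_injective _ K.subtype.injective e⟩

/-- Over `Ω`, a factor is up to a constant the product of a sublist of the linear factors. Dividing
by its leading coefficient keeps it over `K`, so a missing factorization shows as a coefficient
outside `K` for each proper nonempty sublist. -/
theorem not_reduciblePoly_iff [IsAlgClosed Ω] (m : List K) :
    ¬ ReduciblePoly (polyOfList m) ↔ IrreducibleList K (m.map K.subtype) := by
  rw [IrreducibleList, polyOfList_map_coe]
  set F := polyOfList m
  constructor
  · intro hF
    by_cases h0 : F.natDegree = 0
    · rw [eq_C_of_natDegree_eq_zero h0]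
      exact Or.inl ⟨_, map_C _⟩
    right
    have hne : F ≠ 0 := by
      rintro h
      rw [h] at h0
      exact h0 natDegree_zero
    obtain ⟨r, -, hr⟩ := exists_eq_C_mul_rootsPoly (F.map K.subtype)
    have hc : (F.map K.subtype).leadingCoeff ≠ 0 :=
      leadingCoeff_ne_zero.2 ((Polynomial.map_ne_zero_iff K.subtype.injective).2 hne)
    have hdeg : F.natDegree = r.length := by
      rw [← natDegree_map K.subtype, hr, natDegree_C_mul hc, natDegree_rootsPoly]
    refine ⟨_, r, hc, hr, fun t ht => ?_⟩
    by_contra! hcon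
    obtain ⟨ht0, htr, hcoeff⟩ := hcon
    have hsub := List.mem_sublists'.1 ht
    obtain ⟨G, hG⟩ := (lifts_iff_coeff_lifts (f := K.subtype) (rootsPoly t)).2 fun k =>
      ⟨⟨_, hcoeff k⟩, rfl⟩
    have hG' : G.map K.subtype = rootsPoly t := hG
    have hdvd : G ∣ F := by
      rw [← map_dvd_map' K.subtype, hG', hr]
      exact Dvd.dvd.mul_left (List.Sublist.prod_dvd_prod (hsub.map _)) _
    obtain ⟨H, hH⟩ := hdvd
    have hGdeg : G.natDegree = t.length := by
      rw [← natDegree_map K.subtype, hG', natDegree_rootsPoly]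
    have hadd : F.natDegree = G.natDegree + H.natDegree := by
      rw [hH] at hne ⊢
      exact natDegree_mul (left_ne_zero_of_mul hne) (right_ne_zero_of_mul hne)
    have := hsub.length_le
    exact hF ⟨G, H, by omega, by omega, hH⟩
  · rintro h ⟨G, H, hG, hH, e⟩
    have hG0 : G ≠ 0 := by rintro rfl; simp at hG
    have hH0 : H ≠ 0 := by rintro rfl; simp at hH
    have hadd : F.natDegree = G.natDegree + H.natDegree := by rw [e, natDegree_mul hG0 hH0]
    rcases h with ⟨c, hc⟩ | ⟨c, r, hc, hr, hsub⟩
    · have := congrArg natDegree hc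
      rw [natDegree_map, natDegree_C] at this
      omega
    · have hdeg : F.natDegree = r.length := by
        rw [← natDegree_map K.subtype, hr, natDegree_C_mul hc, natDegree_rootsPoly]
      have hF0 : F.map K.subtype ≠ 0 := by
        rw [Polynomial.map_ne_zero_iff K.subtype.injective, e]
        exact mul_ne_zero hG0 hH0
      obtain ⟨t₀, ht₀, hGt⟩ := exists_eq_C_mul_rootsPoly (G.map K.subtype)
      have hle : (t₀ : Multiset Ω) ≤ r := by
        rw [ht₀, ← roots_rootsPoly r, ← roots_C_mul (rootsPoly r) hc, ← hr]
        exact roots.le_of_dvd hF0 (by rw [e, Polynomial.map_mul]; exact dvd_mul_right _ _)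
      obtain ⟨t, hperm, ht⟩ := Multiset.coe_le.1 hle
      have hroots : rootsPoly t = rootsPoly t₀ := (hperm.map _).prod_eq
      have hlc : (G.map K.subtype).leadingCoeff ≠ 0 :=
        leadingCoeff_ne_zero.2 ((Polynomial.map_ne_zero_iff K.subtype.injective).2 hG0)
      have htdeg : G.natDegree = t.length := by
        rw [← natDegree_map K.subtype, hGt, natDegree_C_mul hlc, natDegree_rootsPoly,
          hperm.length_eq]
      rcases hsub t (List.mem_sublists'.2 ht) with h | h | ⟨k, hk⟩
      · omega
      · omega
      · apply hk
        have : rootsPoly t = C (G.map K.subtype).leadingCoeff⁻¹ * G.map K.subtype := by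
          conv_rhs => rw [hGt]
          rw [← hroots, leadingCoeff_C_mul_of_isUnit hlc.isUnit,
            (monic_rootsPoly t).leadingCoeff, mul_one, ← mul_assoc, ← C_mul,
            inv_mul_cancel₀ hlc, C_1, one_mul]
        rw [this, coeff_C_mul, leadingCoeff_map, coeff_map]
        exact mul_mem (inv_mem G.leadingCoeff.2) (G.coeff k).2

variable [CharZero Ω] [Numbered Ω] [CRing Ω] {K}

@[fun_prop]
theorem comp_rootsPoly : Comp (rootsPoly : List Ω → Polynomial Ω) :=
  Comp.list_prod (Comp.map (by fun_prop) (by fun_prop))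

theorem re_reducibleList (h : RE fun x : Ω => x ∈ K) : RE (ReducibleList K) :=
  RE.ex (RE.ex (RE.and (RE.ball_mem (by fun_prop) (h.comp (by fun_prop)))
    (RE.and (RE.ball_mem (by fun_prop) (h.comp (by fun_prop)))
    (RE.and (RE.ex (RE.ne (by fun_prop) (by fun_prop)))
    (RE.and (RE.ex (RE.ne (by fun_prop) (by fun_prop)))
    (RE.eq (by fun_prop) (by fun_prop)))))))

theorem re_irreducibleList (h : RE fun x : Ω => x ∉ K) : RE (IrreducibleList K) :=
  RE.or (RE.ex (RE.eq (by fun_prop) (by fun_prop)))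
    (RE.ex (RE.ex (RE.and (RE.ne (by fun_prop) (by fun_prop))
    (RE.and (RE.eq (by fun_prop) (by fun_prop))
    (RE.ball_mem (by fun_prop) (RE.or (RE.nat_eq (by fun_prop) (by fun_prop))
      (RE.or (RE.nat_eq (by fun_prop) (by fun_prop)) (RE.ex (h.comp (by fun_prop))))))))))

end Splitting

namespace RadicalSequence

open ComputablePresentation

variable {Ω : Type} [Field Ω] [CharZero Ω] {p : ℕ → ℕ} {S : RadicalSequence Ω p}
  [Algebra.IsAlgebraic ℚ Ω] [Numbered Ω] [ComputableTower Ω] [IsAlgClosed Ω]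

theorem hasSplittingAlgorithm (hS : Comp S.β) (hsep : S.Separated) :
    (fieldPresentation hS hsep).HasSplittingAlgorithm := by
  have hnum : Comp fun l : List ℕ => l.map fun n => (num n : Ω) :=
    Comp.map (by fun_prop) (Comp.num (by fun_prop))
  have hmem : RE fun l : List ℕ => ∀ n ∈ l, n ∈ Set.range (fieldPresentation hS hsep).code :=
    RE.ball_mem (by fun_prop) (re_mem_code hS hsep (by fun_prop))
  have h1 : RE fun l : List ℕ => (∀ n ∈ l, n ∈ Set.range (fieldPresentation hS hsep).code) ∧
      ReducibleList S.field (l.map fun n => (num n : Ω)) :=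
    RE.and hmem ((re_reducibleList (re_mem_field hS)).comp hnum)
  have h2 : RE fun l : List ℕ => (∃ i : ℕ, i < l.length ∧
        l.getD i 0 ∉ Set.range (fieldPresentation hS hsep).code) ∨
      ((∀ n ∈ l, n ∈ Set.range (fieldPresentation hS hsep).code) ∧
      IrreducibleList S.field (l.map fun n => (num n : Ω))) :=
    RE.or (RE.ex (RE.and (RE.nat_lt (by fun_prop) (by fun_prop))
      (re_not_mem_code hS hsep (by fun_prop))))
      (RE.and hmem ((re_irreducibleList (re_not_mem_field hS hsep)).comp hnum))
  have hmap : ∀ m : List S.field, (m.map (fieldPresentation hS hsep).code).map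
      (fun n => (num n : Ω)) = m.map S.field.subtype := fun m => by
    rw [List.map_map]
    exact List.map_congr_left fun x _ => num_code hS hsep x
  have hmem' : ∀ m : List S.field, ∀ n ∈ m.map (fieldPresentation hS hsep).code,
      n ∈ Set.range (fieldPresentation hS hsep).code := fun m n hn => by
    obtain ⟨x, -, rfl⟩ := List.mem_map.1 hn
    exact ⟨x, rfl⟩
  have hlift : ∀ l : List ℕ, (∀ n ∈ l, n ∈ Set.range (fieldPresentation hS hsep).code) →
      ∃ m : List S.field, m.map (fieldPresentation hS hsep).code = l := fun l hl => by
    rw [← Set.mem_range, Set.range_list_map]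
    exact hl
  refine RE.computablePred num_encode_nat_list (h1.of_iff fun l => ?_) (h2.of_iff fun l => ?_)
  · constructor
    · rintro ⟨m, rfl, hm⟩
      refine ⟨hmem' m, ?_⟩
      rw [hmap]
      exact (reduciblePoly_iff _ m).1 hm
    · rintro ⟨hl, h⟩
      obtain ⟨m, rfl⟩ := hlift l hl
      rw [hmap] at h
      exact ⟨m, rfl, (reduciblePoly_iff _ m).2 h⟩
  · by_cases hl : ∀ n ∈ l, n ∈ Set.range (fieldPresentation hS hsep).code
    · obtain ⟨m, rfl⟩ := hlift l hl
      rw [hmap, ← not_reduciblePoly_iff]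
      constructor
      · exact fun h => Or.inr ⟨hl, fun h' => h ⟨m, rfl, h'⟩⟩
      · rintro (⟨i, hi, h⟩ | ⟨-, h⟩)
        · rw [List.getD_eq_getElem _ _ hi] at h
          exact absurd (hl _ (List.getElem_mem hi)) h
        · rintro ⟨m', hm', h'⟩
          exact h ((List.map_injective_iff.2
            (fieldPresentation hS hsep).code_injective hm') ▸ h')
    · refine iff_of_true ?_ (Or.inl ?_)
      · rintro ⟨m, rfl, -⟩
        exact hl (hmem' m)
      · push Not at hl
        obtain ⟨n, hn, hn'⟩ := hl
        obtain ⟨i, hi, rfl⟩ := List.getElem_of_mem hn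
        exact ⟨i, hi, by rwa [List.getD_eq_getElem _ _ hi]⟩

end RadicalSequence

/-! ### The closure of a subfield is Henselian -/

section Henselian

/-- One step of the Newton iteration, for a root in an extension ring. -/
theorem exists_newton_step {O R : Type*} [CommRing O] [CommRing R] (ψ : O →+* R) (f : O[X])
    {y : O} (hu : IsUnit (f.derivative.eval y)) {α : R} (hα : (f.map ψ).eval α = 0) :
    ∃ (y' : O) (c : R), α - ψ y' = c * (α - ψ y) ^ 2 := by
  obtain ⟨u, hu⟩ := hu.exists_right_inv
  obtain ⟨k, hk⟩ := (f.map ψ).binomExpansion (ψ y) (α - ψ y)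
  rw [add_sub_cancel, hα, derivative_map, eval_map_apply, eval_map_apply] at hk
  refine ⟨y - u * f.eval y, -ψ u * k, ?_⟩
  have hu' := congrArg ψ hu
  rw [map_mul, map_one] at hu'
  rw [map_sub, map_mul]
  linear_combination (-(ψ u)) * hk - (α - ψ y) * hu'

variable {L Γ : Type} [Field L] [LinearOrderedCommGroupWithZero Γ] {w : Valuation L Γ}

theorem Valuation.exists_mem_map_lt_one (s : Multiset L) (h : w s.prod < 1) :
    ∃ x ∈ s, w x < 1 := by
  by_contra! hs
  refine absurd h (not_lt.2 ?_)
  clear h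
  induction s using Multiset.induction_on with
  | empty => simp
  | cons a s ih =>
    rw [Multiset.prod_cons, map_mul]
    exact one_le_mul_of_one_le_of_one_le (hs a (Multiset.mem_cons_self a s))
      (ih fun x hx => hs x (Multiset.mem_cons_of_mem hx))

/-- `f.eval a` is the product of the differences of `a` and the roots, so one of these is small. -/
theorem Valuation.exists_root_of_map_eval_lt_one [IsAlgClosed L] {f : L[X]} (hf : f.Monic) {a : L}
    (h : w (f.eval a) < 1) : ∃ α, f.eval α = 0 ∧ w (a - α) < 1 := by
  rw [(IsAlgClosed.splits f).eval_eq_prod_roots_of_monic hf] at h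
  obtain ⟨x, hx, hx1⟩ := w.exists_mem_map_lt_one _ h
  obtain ⟨α, hα, rfl⟩ := Multiset.mem_map.1 hx
  exact ⟨α, (mem_roots'.1 hα).2, hx1⟩

variable [CharZero L] [Algebra.IsAlgebraic ℚ L]

theorem Valuation.exists_mul_pow_two_le_one (hw : w 2 < 1) (x : L) :
    ∃ n : ℕ, w x * w 2 ^ n ≤ 1 := by
  have h2 : 0 < w 2 := zero_lt_iff.2 (w.ne_zero_iff.2 two_ne_zero)
  rcases le_or_gt (w x) 1 with h | h
  · exact ⟨0, by simpa using h⟩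
  have hx0 : x ≠ 0 := by
    rintro rfl
    simp at h
  obtain ⟨n, hn, t, ht⟩ := Valuation.exists_pow_eq_zpow_two hw hx0
  refine ⟨t.natAbs, ?_⟩
  have h1 : w x ≤ w 2 ^ t := ht ▸ le_self_pow₀ h.le hn.ne'
  calc w x * w 2 ^ t.natAbs ≤ w 2 ^ t * w 2 ^ (t.natAbs : ℤ) := by
        rw [zpow_natCast]
        gcongr
    _ = w 2 ^ (t + t.natAbs) := (zpow_add₀ h2.ne' _ _).symm
    _ ≤ 1 := zpow_le_one₀ h2 hw.le (by omega)

/-- The elements of `L` approximated by elements of `K`, for a valuation of rank one. -/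
def approxSubfield (hw : w 2 < 1) (K : Subfield L) : Subfield L where
  carrier := {x | ∀ n : ℕ, ∃ y ∈ K, w (x - y) ≤ w 2 ^ n}
  zero_mem' n := ⟨0, zero_mem _, by simp⟩
  one_mem' n := ⟨1, one_mem _, by simp⟩
  add_mem' := by
    intro a b ha hb n
    obtain ⟨y, hy, h⟩ := ha n
    obtain ⟨z, hz, h'⟩ := hb n
    refine ⟨y + z, add_mem hy hz, ?_⟩
    rw [add_sub_add_comm]
    exact w.map_add_le h h'
  neg_mem' := by
    intro a ha n
    obtain ⟨y, hy, h⟩ := ha n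
    refine ⟨-y, neg_mem hy, ?_⟩
    rwa [neg_sub_neg, w.map_sub_swap]
  mul_mem' := by
    intro a b ha hb n
    obtain ⟨k, hk⟩ := Valuation.exists_mul_pow_two_le_one hw a
    obtain ⟨z, hz, h'⟩ := hb (n + k)
    -- The precision for `a` is fixed after `z`, whose size it has to absorb.
    obtain ⟨m, hm⟩ := Valuation.exists_mul_pow_two_le_one hw z
    obtain ⟨y, hy, h⟩ := ha (n + m)
    refine ⟨y * z, mul_mem hy hz, ?_⟩
    rw [show a * b - y * z = a * (b - z) + z * (a - y) by ring]
    refine w.map_add_le ?_ ?_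
    · rw [map_mul]
      calc w a * w (b - z) ≤ w a * w 2 ^ (n + k) := by gcongr
        _ = w a * w 2 ^ k * w 2 ^ n := by rw [pow_add]; ac_rfl
        _ ≤ 1 * w 2 ^ n := by gcongr
        _ = w 2 ^ n := one_mul _
    · rw [map_mul]
      calc w z * w (a - y) ≤ w z * w 2 ^ (n + m) := by gcongr
        _ = w z * w 2 ^ m * w 2 ^ n := by rw [pow_add]; ac_rfl
        _ ≤ 1 * w 2 ^ n := by gcongr
        _ = w 2 ^ n := one_mul _
  inv_mem' := by
    intro a ha n
    rcases eq_or_ne a 0 with rfl | ha0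
    · exact ⟨0, zero_mem _, by simp⟩
    have h2 : 0 < w 2 := zero_lt_iff.2 (w.ne_zero_iff.2 two_ne_zero)
    have hwa : 0 < w a := zero_lt_iff.2 (w.ne_zero_iff.2 ha0)
    obtain ⟨k, hk⟩ := Valuation.exists_mul_pow_two_le_one hw a⁻¹
    have hk' : w 2 ^ k ≤ w a := by
      rwa [map_inv₀, ← div_eq_inv_mul, div_le_one₀ hwa] at hk
    -- The two `k` compensate for division by `a * y`; the extra 1 makes the error strictly smaller
    -- than `a`, so that `y` and `a` have equal value.
    obtain ⟨y, hy, h⟩ := ha (n + k + k + 1)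
    have hlt : w (a - y) < w a := by
      refine (h.trans_lt ?_).trans_le hk'
      exact pow_lt_pow_right_of_lt_one₀ h2 hw (by omega)
    have hya : w y = w a := by
      rw [w.map_sub_swap] at hlt
      exact w.map_eq_of_sub_lt hlt
    have hy0 : y ≠ 0 := by
      rw [← w.ne_zero_iff, hya]
      exact hwa.ne'
    refine ⟨y⁻¹, inv_mem hy, ?_⟩
    rw [inv_sub_inv ha0 hy0, map_div₀, map_mul, hya, w.map_sub_swap, div_le_iff₀ (mul_pos hwa hwa)]
    calc w (a - y) ≤ w 2 ^ (n + k + k + 1) := h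
      _ ≤ w 2 ^ (n + k + k) := pow_le_pow_of_le_one h2.le hw.le (by omega)
      _ = w 2 ^ n * (w 2 ^ k * w 2 ^ k) := by rw [pow_add, pow_add, mul_assoc]
      _ ≤ w 2 ^ n * (w a * w a) := by gcongr

theorem le_approxSubfield (hw : w 2 < 1) (K : Subfield L) : K ≤ approxSubfield hw K :=
  fun x hx n => ⟨x, hx, by simp⟩

theorem mem_approxSubfield_of_forall {hw : w 2 < 1} {K : Subfield L} {x : L}
    (h : ∀ n : ℕ, ∃ y ∈ approxSubfield hw K, w (x - y) ≤ w 2 ^ n) : x ∈ approxSubfield hw K := by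
  intro n
  obtain ⟨y, hy, h1⟩ := h n
  obtain ⟨z, hz, h2⟩ := hy n
  refine ⟨z, hz, ?_⟩
  rw [← sub_add_sub_cancel x y z]
  exact w.map_add_le h1 h2

/-- The root of the polynomial exists in `L`; Newton iterates starting at `a₀` stay in the subfield
and converge to it, and limits of approximable elements are approximable. -/
theorem isHenselianSubfield_approxSubfield [IsAlgClosed L] (hw : w 2 < 1) (K : Subfield L) :
    IsHenselianSubfield w (approxSubfield hw K) := by
  let F := approxSubfield hw K
  let O := (w.comap F.subtype).valuationSubring
  let ψ : O →+* w.valuationSubring :=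
    { toFun := fun a => ⟨((a : F) : L), a.2⟩
      map_one' := rfl
      map_mul' := fun _ _ => rfl
      map_zero' := rfl
      map_add' := fun _ _ => rfl }
  have hmax : ∀ a : O, a ∈ IsLocalRing.maximalIdeal O ↔ w ((a : F) : L) < 1 :=
    fun _ => Valuation.mem_maximalIdeal_iff _ _
  refine { is_henselian := fun f hf a₀ h₀ h₁ => ?_ }
  have hunit : ∀ y : O, y - a₀ ∈ IsLocalRing.maximalIdeal O → IsUnit (f.derivative.eval y) := by
    intro y hy
    by_contra hn
    have h1 : f.derivative.eval y ∈ IsLocalRing.maximalIdeal O := hn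
    have h2 := Ideal.mem_of_dvd _ (sub_dvd_eval_sub y a₀ f.derivative) hy
    have h3 := sub_mem h1 h2
    rw [sub_sub_cancel] at h3
    exact h3 h₁
  let φ : O →+* L := w.valuationSubring.subtype.comp ψ
  obtain ⟨α, hα, hα1⟩ := Valuation.exists_root_of_map_eval_lt_one (w := w) (hf.map φ)
    (a := φ a₀) (by rw [eval_map_apply]; exact (hmax _).1 h₀)
  have hαint : w α ≤ 1 := by
    rw [← sub_sub_cancel (φ a₀) α]
    exact w.map_sub_le (a₀.2 : w ((a₀ : F) : L) ≤ 1) hα1.le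
  let α' : w.valuationSubring := ⟨α, hαint⟩
  have hα' : (f.map ψ).eval α' = 0 := by
    apply Subtype.ext
    change w.valuationSubring.subtype _ = 0
    rw [← eval_map_apply, map_map]
    exact hα
  -- Convergence is quadratic, but this linear rate is enough.
  have happrox : ∀ n : ℕ, ∃ y : O, w (α - φ y) ≤ w (α - φ a₀) ^ (n + 1) := by
    have hδ : w (α - φ a₀) < 1 := by rwa [w.map_sub_swap]
    intro n
    induction n with
    | zero => exact ⟨a₀, by simp⟩
    | succ n ih =>
      obtain ⟨y, hy⟩ := ih
      have hy0 : y - a₀ ∈ IsLocalRing.maximalIdeal O := by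
        rw [hmax]
        change w (φ y - φ a₀) < 1
        rw [show φ y - φ a₀ = (α - φ a₀) - (α - φ y) by ring]
        exact w.map_sub_lt hδ (hy.trans_lt (pow_lt_one₀ zero_le hδ (by omega)))
      obtain ⟨y', c, hc⟩ := exists_newton_step ψ f (hunit y hy0) hα'
      refine ⟨y', ?_⟩
      have hc' : α - φ y' = c * (α - φ y) ^ 2 := congrArg Subtype.val hc
      rw [hc', map_mul, map_pow]
      calc w c * w (α - φ y) ^ 2 ≤ 1 * (w (α - φ a₀) ^ (n + 1)) ^ 2 := by
            gcongr
            exact c.2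
        _ = w (α - φ a₀) ^ (2 * n + 2) := by rw [one_mul, ← pow_mul]; ring_nf
        _ ≤ w (α - φ a₀) ^ (n + 1 + 1) := pow_le_pow_of_le_one zero_le hδ.le (by omega)
  have hαF : α ∈ F := by
    refine mem_approxSubfield_of_forall fun n => ?_
    have hδ : w (α - φ a₀) < 1 := by rwa [w.map_sub_swap]
    obtain ⟨k, hk⟩ := Valuation.exists_pow_le_two hw hδ
    obtain ⟨y, hy⟩ := happrox (k * n)
    refine ⟨φ y, (y : F).2, hy.trans ?_⟩
    calc w (α - φ a₀) ^ (k * n + 1) ≤ w (α - φ a₀) ^ (k * n) :=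
          pow_le_pow_of_le_one zero_le hδ.le (by omega)
      _ = (w (α - φ a₀) ^ k) ^ n := pow_mul _ _ _
      _ ≤ w 2 ^ n := by gcongr
  have hinj : Function.Injective φ := fun a b h => Subtype.ext (Subtype.ext h)
  refine ⟨⟨⟨α, hαF⟩, hαint⟩, ?_, ?_⟩
  · apply hinj
    rw [← eval_map_apply, map_zero]
    exact hα
  · rw [hmax]
    change w (α - φ a₀) < 1
    rwa [w.map_sub_swap]

end Henselian

/-! ### Odd roots of odd integers -/

section HenselRoots

variable {L Γ : Type} [Field L] [LinearOrderedCommGroupWithZero Γ] {w : Valuation L Γ}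

/-- Modulo the maximal ideal, `X ^ m - q` is `X ^ m - 1`, and 1 is a simple root because `m` is odd
and the residue characteristic is 2. -/
theorem IsHenselianSubfield.exists_pow_eq {F : Subfield L} (hF : IsHenselianSubfield w F)
    (hw : w 2 < 1) {m q : ℕ} (hm : Odd m) (hq : Odd q) :
    ∃ u ∈ F, u ^ m = (q : L) ∧ w (u - 1) < 1 := by
  let O := (w.comap F.subtype).valuationSubring
  have hmax : ∀ a : O, a ∈ IsLocalRing.maximalIdeal O ↔ w ((a : F) : L) < 1 :=
    fun _ => Valuation.mem_maximalIdeal_iff _ _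
  have hH : HenselianLocalRing O := hF
  have hunit : IsUnit (m : O) := by
    by_contra hn
    have h1 : (m : O) ∈ IsLocalRing.maximalIdeal O := hn
    rw [hmax] at h1
    have h2 : w (m : L) < 1 := by simpa using h1
    exact h2.ne (Valuation.map_odd hw hm)
  obtain ⟨u, hu, hu1⟩ := hH.is_henselian (X ^ m - C (q : O)) (monic_X_pow_sub_C _ hm.pos.ne') 1
    (by
      obtain ⟨k, rfl⟩ := hq
      rw [hmax]
      have e : (((eval 1 (X ^ m - C ((2 * k + 1 : ℕ) : O)) : O) : F) : L) = -(2 * (k : L)) := by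
        simp only [eval_sub, eval_pow, eval_X, one_pow, eval_C]
        push_cast
        rw [sub_add_cancel_right]
        rfl
      rw [e, Valuation.map_neg, map_mul]
      exact mul_lt_one_of_lt_of_le hw (w.map_natCast_le_one k))
    (by simpa [derivative_X_pow] using hunit)
  refine ⟨(u : F), (u : F).2, ?_, (hmax _).1 hu1⟩
  rw [IsRoot.def, eval_sub, eval_pow, eval_X, eval_C, sub_eq_zero] at hu
  have := congrArg (fun a : O => ((a : F) : L)) hu
  simpa using this

/-- The cofactor of `a - b` in `a ^ m - b ^ m` reduces to `m`, a unit. So all Henselian subfields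
share the same root near 1, and it lies in their intersection, whether or not that is known to be
Henselian. -/
theorem Valuation.eq_of_pow_eq (hw : w 2 < 1) {m : ℕ} (hm : Odd m) {a b : L} (h : a ^ m = b ^ m)
    (ha : w (a - 1) < 1) (hb : w (b - 1) < 1) : a = b := by
  have hint : ∀ {x : L}, w (x - 1) < 1 → w x ≤ 1 := fun {x} hx => by
    rw [← sub_add_cancel x 1]
    exact w.map_add_le hx.le w.map_one.le
  let R := w.valuationSubring
  let a' : R := ⟨a, hint ha⟩
  let b' : R := ⟨b, hint hb⟩
  have hres : ∀ x : R, w ((x : L) - 1) < 1 → IsLocalRing.residue R x = 1 := fun x hx => by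
    rw [← sub_eq_zero, ← map_one (IsLocalRing.residue R), ← _root_.map_sub, IsLocalRing.residue_eq_zero_iff,
      Valuation.mem_maximalIdeal_iff]
    exact hx
  have hmul : (∑ i ∈ Finset.range m, a' ^ i * b' ^ (m - 1 - i)) * (a' - b') = 0 := by
    rw [geom_sum₂_mul, sub_eq_zero]
    exact Subtype.ext h
  rcases mul_eq_zero.1 hmul with h0 | h0
  · exfalso
    have h1 := congrArg (IsLocalRing.residue R) h0
    simp only [map_sum, map_mul, map_pow, hres a' ha, hres b' hb, one_pow, mul_one,
      Finset.sum_const, Finset.card_range, nsmul_eq_mul, map_zero] at h1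
    rw [← map_natCast (IsLocalRing.residue R), IsLocalRing.residue_eq_zero_iff,
      Valuation.mem_maximalIdeal_iff] at h1
    have h2 : w (m : L) < 1 := by simpa using h1
    exact h2.ne (Valuation.map_odd hw hm)
  · exact congrArg Subtype.val (sub_eq_zero.1 h0)

end HenselRoots

/-! ### The halting set inside the Henselization -/

namespace RadicalSequence

variable {Ω L : Type} [Field Ω] [CharZero Ω] [Field L] [CharZero L] {p : ℕ → ℕ}

theorem beta_mem_field (S : RadicalSequence Ω p) (s : ℕ) : S.β s ∈ S.field :=
  S.mem_field_iff.2 ⟨s + 1, S.beta_mem_stage_succ s⟩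

/-- The image of a radical sequence under an embedding of the field it generates. -/
noncomputable def map (S : RadicalSequence Ω p) (ι : S.field →+* L) : RadicalSequence L p where
  prime_p := S.prime_p
  injective_p := S.injective_p
  q := S.q
  β s := ι ⟨S.β s, S.beta_mem_field s⟩
  strictMono_q := S.strictMono_q
  prime_q := S.prime_q
  two_lt_q := S.two_lt_q
  eq_one {s} hs := by
    rw [← map_one ι]
    exact congrArg ι (Subtype.ext (S.eq_one hs))
  pow_eq {s} hs := by
    rw [← map_pow, ← map_natCast ι, ← map_ofNat ι, ← map_mul]
    exact congrArg ι (Subtype.ext (S.pow_eq hs))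

/-- The image of `K` is again generated by a radical sequence, so results on `S.field` apply in any
closure. -/
theorem field_map (S : RadicalSequence Ω p) [Algebra.IsAlgebraic ℚ Ω] [Algebra.IsAlgebraic ℚ L]
    (ι : S.field →+* L) : (S.map ι).field = ι.fieldRange := by
  let P : ℕ → S.field := fun s => ∏ t ∈ Finset.range s, ⟨S.β t, S.beta_mem_field t⟩
  have hP : ∀ s, S.field.subtype (P s) = S.prod s := fun s => map_prod S.field.subtype _ _
  have hP' : ∀ s, ι (P s) = (S.map ι).prod s := fun s => map_prod ι _ _
  ext x
  rw [mem_field_iff]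
  constructor
  · rintro ⟨s, hs⟩
    obtain ⟨g, rfl⟩ := mem_adjoin_iff_exists_aeval.1 hs
    refine ⟨aeval (P s) g, ?_⟩
    rw [← hP']
    exact (aeval_algHom_apply ι.toRatAlgHom (P s) g).symm
  · rintro ⟨y, rfl⟩
    obtain ⟨s, hs⟩ := S.mem_field_iff.1 y.2
    obtain ⟨g, hg⟩ := mem_adjoin_iff_exists_aeval.1 hs
    refine ⟨s, mem_adjoin_iff_exists_aeval.2 ⟨g, ?_⟩⟩
    have e : aeval (P s) g = y := by
      apply S.field.subtype.injective
      rw [← hP] at hg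
      exact (aeval_algHom_apply S.field.subtype.toRatAlgHom (P s) g).symm.trans hg
    rw [← hP', ← e]
    exact aeval_algHom_apply ι.toRatAlgHom (P s) g

variable {Γ : Type} [LinearOrderedCommGroupWithZero Γ] {w : Valuation L Γ}

/-- The Henselization of the field of the radicals computes the halting set. -/
theorem mem_haltingSet_iff [IsAlgClosed L] [Algebra.IsAlgebraic ℚ L] (S : RadicalSequence L p)
    (hp : ∀ i, p i ≠ 2) (hw : w 2 < 1) (i : ℕ) :
    i ∈ haltingSet ↔ ∃ x ∈ henselization w S.field, x ^ p i = 2 := by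
  have hodd : Odd (p i) := (S.prime_p i).odd_of_ne_two (hp i)
  constructor
  · intro hi
    obtain ⟨s, hs, rfl⟩ := exists_haltsAtStage hi
    have hq : Odd (S.q s) := (S.prime_q hs).odd_of_ne_two (S.two_lt_q hs).ne'
    -- One Henselian subfield supplies the root `u`; uniqueness then places it in every other.
    obtain ⟨u, -, hu, hu1⟩ :=
      (isHenselianSubfield_approxSubfield hw S.field).exists_pow_eq hw hodd hq
    refine ⟨S.β s / u, ?_, ?_⟩
    · rw [henselization, Subfield.mem_sInf]
      rintro F ⟨hKF, hF⟩
      obtain ⟨u', hu'F, hu', hu'1⟩ := hF.exists_pow_eq hw hodd hq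
      rw [Valuation.eq_of_pow_eq hw hodd (hu.trans hu'.symm) hu1 hu'1]
      exact div_mem (hKF (S.beta_mem_field s)) hu'F
    · rw [div_pow, S.pow_eq hs, hu,
        mul_div_cancel_right₀ _ (Nat.cast_ne_zero.2 (S.prime_q hs).ne_zero)]
  · rintro ⟨x, hx, hx2⟩
    by_contra hi
    have hxF : x ∈ approxSubfield hw S.field := by
      rw [henselization, Subfield.mem_sInf] at hx
      exact hx _ ⟨le_approxSubfield hw _, isHenselianSubfield_approxSubfield hw _⟩
    obtain ⟨y, hy, hxy⟩ := hxF 1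
    have hval : w x ^ p i = w 2 := by rw [← map_pow, hx2]
    have hx0 : 0 < w x := by
      refine zero_lt_iff.2 fun h0 => w.ne_zero_iff.2 (two_ne_zero (α := L)) ?_
      rw [← hval, h0, zero_pow (S.prime_p i).ne_zero]
    have hx1 : w x < 1 := by
      by_contra! h
      exact absurd ((one_le_pow₀ h).trans hval.le) (not_le.2 hw)
    -- A root of 2 is larger than 2, so approximating `x` up to 2 gives an element of `K` of the
    -- same value, which the value group forbids.
    have hlt : w 2 < w x := by
      rw [← hval]
      exact pow_lt_self_of_lt_one₀ hx0 hx1 (S.prime_p i).one_lt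
    rw [pow_one, w.map_sub_swap] at hxy
    have hyx : w y = w x := w.map_eq_of_sub_lt (hxy.trans_lt hlt)
    obtain ⟨s, hs⟩ := S.mem_field_iff.1 hy
    refine (S.valuesDivide hw s).forall_pow_ne hw (S.prime_p i)
      (S.coprime_exponent fun t _ hts e => hi (e ▸ hts.mem_haltingSet)) hs ?_
    rw [hyx, hval]

end RadicalSequence

/-! ### From presentations back to numberings -/

namespace ComputablePresentation

variable {L : Type} [Field L] (ρ : ComputablePresentation L)

open Classical in
/-- The element with a given code, and `0` if there is none. -/
noncomputable def elt (n : ℕ) : L := if h : n ∈ Set.range ρ.code then h.choose else 0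

theorem elt_code (x : L) : ρ.elt (ρ.code x) = x := by
  have h : ρ.code x ∈ Set.range ρ.code := ⟨x, rfl⟩
  rw [elt, dif_pos h]
  exact ρ.code_injective h.choose_spec

/-- The numbering of a presented field. -/
noncomputable abbrev numbered : Numbered L := ⟨ρ.elt, fun x => ⟨_, ρ.elt_code x⟩⟩

theorem computable_code_elt : Computable fun n => ρ.code (ρ.elt n) := by
  obtain ⟨D, hD⟩ := ρ.computable_domain
  refine (Computable.cond hD Computable.id (Computable.const (ρ.code 0))).of_eq fun n => ?_
  by_cases h : n ∈ Set.range ρ.code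
  · obtain ⟨x, rfl⟩ := h
    simp [elt_code]
  · rw [elt, dif_neg h]
    simp [h]

theorem comp_code : letI := ρ.numbered; Comp ρ.code :=
  let := ρ.numbered
  ⟨_, ρ.computable_code_elt, fun _ => rfl⟩

theorem cRing : letI := ρ.numbered; CRing L := by
  let := ρ.numbered
  have hc : Comp ρ.code := ρ.comp_code
  have key : ∀ g : L → L → L, (∃ f : ℕ → ℕ → ℕ, Computable₂ f ∧
      ∀ a b, f (ρ.code a) (ρ.code b) = ρ.code (g a b)) → Comp fun z : L × L => g z.1 z.2 := by
    rintro g ⟨f, hf, h⟩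
    have hfc : Comp fun z : L × L => f (ρ.code z.1) (ρ.code z.2) :=
      Comp.of_computable₂ hf (by fun_prop) (by fun_prop)
    have hnum : Comp fun z : L × L => (num (f (ρ.code z.1) (ρ.code z.2)) : L) := Comp.num hfc
    simp only [h] at hnum
    convert hnum using 2 with z
    exact (ρ.elt_code _).symm
  have hadd := key _ ρ.computable_add
  have heq : RE fun z : L × L => z.1 = z.2 := (RE.nat_eq (hc.comp Comp.fst) (hc.comp Comp.snd)).of_iff
    fun z => ρ.code_injective.eq_iff.symm
  -- Negation is not part of a presentation; it is found by searching for the element with sum 0.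
  refine ⟨hadd, key _ ρ.computable_mul, Comp.of_graph ?_, heq⟩
  refine (heq.comp (hadd.prodMk (Comp.const 0))).of_iff fun z => ?_
  rw [add_comm]
  exact eq_neg_iff_add_eq_zero

theorem ComputableSubset.re_not_mem {s : Set L} (hs : ρ.ComputableSubset s) :
    letI := ρ.numbered; RE fun x : L => x ∉ s := by
  let := ρ.numbered
  refine ((RE.of_rePred hs.not.to_re).comp ρ.comp_code).of_iff fun x => not_congr ?_
  exact (ρ.code_injective.mem_set_image).symm

end ComputablePresentation

/-! ### Non-computability of the Henselization -/

namespace RadicalSequence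

variable {L : Type} [Field L] [CharZero L] {p : ℕ → ℕ} {Γ : Type}
  [LinearOrderedCommGroupWithZero Γ] {w : Valuation L Γ}

/-- The absence of a `p i`-th root of 2 can be verified by a search: list all roots of `X ^ p i - 2`
in `L` and check each to be outside the Henselization. So the complement of `0'` would be
semidecidable. -/
theorem not_computableSubset_henselization [IsAlgClosed L] [Algebra.IsAlgebraic ℚ L]
    (S : RadicalSequence L p) (hcomp : Computable p) (hp : ∀ i, p i ≠ 2) (hw : w 2 < 1)
    (ρ : ComputablePresentation L) : ¬ ρ.ComputableSubset (henselization w S.field : Set L) := by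
  intro h
  let := ρ.numbered
  have := ρ.cRing
  have hp' := Comp.of_computable hcomp
  have hre : RE fun i : ℕ => ∃ l : List L, rootsPoly l = X ^ p i - C 2 ∧
      ∀ x ∈ l, x ∉ (henselization w S.field : Set L) :=
    RE.ex (RE.and (RE.eq (by fun_prop) (by fun_prop))
      (RE.ball_mem (by fun_prop) ((ComputablePresentation.ComputableSubset.re_not_mem ρ h).comp
        (by fun_prop))))
  refine not_rePred_compl_haltingSet (hre.of_iff fun i => ?_).rePred
  rw [S.mem_haltingSet_iff hp hw]
  have hroot : ∀ {l : List L} {x : L}, rootsPoly l = X ^ p i - C 2 → (x ∈ l ↔ x ^ p i = 2) := by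
    intro l x hl
    rw [← Multiset.mem_coe, ← roots_rootsPoly, hl, mem_roots (X_pow_sub_C_ne_zero
      (S.prime_p i).pos 2), IsRoot.def, eval_sub, eval_pow, eval_X, eval_C, sub_eq_zero]
  constructor
  · intro hn
    obtain ⟨l, -, hl⟩ := exists_eq_C_mul_rootsPoly (X ^ p i - C (2 : L))
    rw [(monic_X_pow_sub_C _ (S.prime_p i).ne_zero).leadingCoeff, C_1, one_mul] at hl
    exact ⟨l, hl.symm, fun x hx hxH => hn ⟨x, hxH, (hroot hl.symm).1 hx⟩⟩
  · rintro ⟨l, hl, hn⟩ ⟨x, hx, hx2⟩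
    exact hn x ((hroot hl).2 hx2) hx

end RadicalSequence

/-! ### Generators of the field and the main theorem -/

namespace RadicalSequence

variable {Ω : Type} [Field Ω] [CharZero Ω] {p : ℕ → ℕ}

theorem adjoin_beta_eq_top (S : RadicalSequence Ω p) {B : Set S.field}
    (hB : ∀ s, HaltsAtStage s → ⟨S.β s, S.beta_mem_field s⟩ ∈ B) :
    IntermediateField.adjoin ℚ B = ⊤ := by
  refine eq_top_iff.2 fun x _ => ?_
  obtain ⟨s, hs⟩ := S.mem_field_iff.1 x.2
  let f : S.field →ₐ[ℚ] Ω := S.field.subtype.toRatAlgHom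
  have hx : (x : Ω) ∈ (IntermediateField.adjoin ℚ B).map f :=
    S.mem_adjoin_of_mem_stage (fun t _ ht =>
      ⟨_, IntermediateField.subset_adjoin ℚ B (hB t ht), rfl⟩) hs
  obtain ⟨y, hy, hyx⟩ := hx
  exact Subtype.ext (show (y : Ω) = x from hyx) ▸ hy

end RadicalSequence

theorem exists_isAlgClosed_isAlgebraic_rat : ∃ (Ω : Type) (_ : Field Ω) (_ : CharZero Ω),
    IsAlgClosed Ω ∧ Algebra.IsAlgebraic ℚ Ω := by
  refine ⟨AlgebraicClosure ℚ, inferInstance, inferInstance, inferInstance, ?_⟩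
  have h := AlgebraicClosure.isAlgebraic ℚ
  -- The two `ℚ`-algebra structures on the closure have to be identified.
  rwa [Subsingleton.elim (AlgebraicClosure.instAlgebra ℚ) DivisionRing.toRatAlgebra] at h

theorem mainTheorem8 :
    ∃ (K : Type) (_ : Field K) (_ : CharZero K)
      (Γ : Type) (_ : LinearOrderedCommGroupWithZero Γ) (v : Valuation K Γ)
      (π : ComputablePresentation K),
      -- `(K, v)` is a computable algebraic valued field with a splitting algorithm
      Algebra.IsAlgebraic ℚ K ∧
      Function.Surjective v ∧
      π.ComputableValuation v ∧
      π.HasSplittingAlgorithm ∧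
      -- `K = ℚ((r qᵢ)^(1/pᵢ) : i ∈ 0')` and `v` extends the `r`-adic valuation
      (∃ (r : ℕ) (_ : Fact r.Prime) (p q : ℕ → ℕ) (β : ℕ → K),
        Computable p ∧ Function.Injective p ∧
        Set.range p = {n | n.Prime ∧ n ≠ r} ∧
        (∀ i ∈ haltingSet, (q i).Prime ∧ q i ≡ 1 [MOD r]) ∧
        Set.InjOn q haltingSet ∧
        (∀ i ∈ haltingSet, β i ^ p i = (r : K) * (q i : K)) ∧
        IntermediateField.adjoin ℚ (β '' haltingSet) = ⊤ ∧
        (v.comap (algebraMap ℚ K)).IsEquiv (Rat.padicValuation r)) ∧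
      -- `K` embeds computably into a computable algebraic closure of `ℚ`
      (∃ (L : Type) (_ : Field L) (_ : CharZero L) (ρ : ComputablePresentation L) (ι : K →+* L),
        IsAlgClosure ℚ L ∧ π.ComputableMap ρ ι) ∧
      -- inside every such closure, for every extension `w` of `v`, the Henselization of `K` is
      -- not a computable subset
      (∀ (L : Type) (_ : Field L) (_ : CharZero L) (ρ : ComputablePresentation L) (ι : K →+* L),
        IsAlgClosure ℚ L → π.ComputableMap ρ ι →
        ∀ (Δ : Type) (_ : LinearOrderedCommGroupWithZero Δ) (w : Valuation L Δ),
          (w.comap ι).IsEquiv v →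
          ¬ ρ.ComputableSubset (henselization w ι.fieldRange : Set L)) := by
  obtain ⟨p, hp, hinj, hrange⟩ := exists_enumeration_odd_primes
  have hpi : ∀ i, (p i).Prime ∧ p i ≠ 2 := fun i => hrange.subset ⟨i, rfl⟩
  obtain ⟨Ω, _, _, _, _⟩ := exists_isAlgClosed_isAlgebraic_rat
  obtain ⟨_, ⟨_⟩⟩ := exists_computableTower Ω
  obtain ⟨S, hS, hsep⟩ := exists_radicalSequence (Ω := Ω) hp (fun i => (hpi i).1) hinj
  obtain ⟨A, hA⟩ := exists_valuationSubring_two Ω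
  -- The valuation of the restricted ring, rather than the restricted valuation, is surjective onto
  -- its value group.
  let v := (A.comap S.field.subtype).valuation
  have hv : v.IsEquiv (A.valuation.comap S.field.subtype) := by
    refine Valuation.isEquiv_iff_val_le_one.2 fun {x} => ?_
    rw [ValuationSubring.valuation_le_one_iff, ValuationSubring.mem_comap, Valuation.comap_apply,
      ValuationSubring.valuation_le_one_iff]
  have hv2 : v 2 < 1 := by
    rw [hv.lt_one_iff_lt_one]
    exact hA
  -- The sequence is indexed by stages; `stg` reindexes it by the elements of `0'`.
  choose! stg hstg using fun i (hi : i ∈ haltingSet) => exists_haltsAtStage hi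
  refine ⟨S.field, inferInstance, inferInstance, _, inferInstance, v,
    RadicalSequence.fieldPresentation hS hsep, ?_, ValuationSubring.valuation_surjective _,
    RadicalSequence.computableValuation hS hsep hA hv,
    RadicalSequence.hasSplittingAlgorithm hS hsep,
    ⟨2, ⟨Nat.prime_two⟩, p, fun i => S.q (stg i), fun i => ⟨S.β (stg i), S.beta_mem_field _⟩,
      hp, hinj, hrange, fun i hi => ⟨S.prime_q (hstg i hi).1, ?_⟩, ?_, fun i hi => ?_, ?_,
      Valuation.comap_rat_isEquiv hv2⟩, ?_, ?_⟩
  · exact Algebra.IsAlgebraic.of_injective S.field.subtype.toRatAlgHom Subtype.val_injective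
  · exact Nat.odd_iff.1 ((S.prime_q (hstg i hi).1).odd_of_ne_two (S.two_lt_q (hstg i hi).1).ne')
  · intro i hi j hj e
    rw [← (hstg i hi).2, ← (hstg j hj).2, S.strictMono_q.injective e]
  · apply Subtype.ext
    have := S.pow_eq (hstg i hi).1
    rw [(hstg i hi).2] at this
    exact this
  · refine S.adjoin_beta_eq_top fun s hs => ⟨s.unpair.1, hs.mem_haltingSet, ?_⟩
    simp only [(hstg _ hs.mem_haltingSet).1.eq hs (hstg _ hs.mem_haltingSet).2]
  · refine ⟨Ω, inferInstance, inferInstance, presentation (RingHom.id Ω) ?_ ?_, S.field.subtype,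
      ⟨inferInstance, inferInstance⟩, id, Computable.id, fun _ => rfl⟩
    · exact (RE.const trivial).of_iff fun x => iff_true_intro ⟨x, rfl⟩
    -- The complement of `Ω` in itself is empty, expressed by the false relation `0 < 0`. Codes in
    -- `K` and `Ω` agree, so the identity tracks the inclusion.
    · exact (RE.nat_lt (Comp.const 0) (Comp.const 0)).of_iff fun x =>
        iff_of_false (fun h => h ⟨x, rfl⟩) (lt_irrefl 0)
  · intro L _ _ ρ ι hL _ Δ _ w hw
    have := hL.isAlgClosed
    have := hL.isAlgebraic
    rw [← S.field_map ι]
    refine (S.map ι).not_computableSubset_henselization hp (fun i => (hpi i).2) ?_ ρ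
    rw [← map_ofNat ι 2]
    exact hw.symm.lt_one_iff_lt_one.1 hv2
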